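/- **Setting.** Let $\lambda\in\mathbb C$ with $\lambda\notin\{\tfrac12-\tfrac k2 : k\in\mathbb Z_{\ge 0}\}$, let $\ell\in\mathbb Z$ and let $N\ge 1$ be an integer, with $4\mid N$ if $\ell$ is odd. Let $\chi$ be a Dirichlet character mod $N$ with $\chi(-1)=i^\ell$ if $\ell$ is even and $\chi(-1)=1$ if $\ell$ is odd. Let $\mathbb P_N$ be a set of odd primes not dividing $N$ that contains, for all coprime positive integers $a,b$, a prime of the form $am+b$ with $m\in\mathbb Z_{>0}$. Complex powers have their principal values, and $(\operatorname{sgn}x)^{\ell/2}$ is $1$ for $x>0$ and $i^\ell$ for $x<0$. *Test functions.* $\mathcal V=\mathcal V^\infty_{\lambda,\ell}$ is the space of $C^\infty$ functions $f:\mathbb R\to\mathbb C$ such that $f_\infty(x)=(\operatorname{sgn}x)^{\ell/2}|x|^{-2\lambda}f(-1/x)$ $(x\neq0)$ extends to a $C^\infty$ function $f_\infty$ on $\mathbb R$, topologized by the seminorms $\sup_x (1+x^2)^{\operatorname{Re}\lambda}\sum_{j\le n}|(D_\lambda^jf)(x)|$ $(n\ge0)$, where $D_\lambda=(1+x^2)\frac{d}{dx}+2\lambda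 x$. Put $f(\infty)=f_\infty(0)$ and $f_\infty(\infty)=(f_\infty)_\infty(0)=i^\ell f(0)$. A distribution is a continuous linear functional on $\mathcal V$. For $t\ne0$ put $\mathcal Ff(t)=\bigl(\tfrac{-1}{2\pi it}\bigr)^m\int_{\mathbb R}f^{(m)}(x)e^{2\pi ixt}\,dx$ for any positive integer $m>1-2\operatorname{Re}\lambda$, and let $\mathcal Ff(0)$ be the value at $s=1$ of the meromorphic continuation of $\int_0^\infty x^{s-1}f(x)\,dx+\int_0^\infty x^{s-1}f(-x)\,dx$. *Group.* $\widetilde G$ is the group of pairs $(g,\varphi)$, with $g=\begin{pmatrix}a&b\\c&d\end{pmatrix}\in SL_2(\mathbb R)$ and $\varphi$ holomorphic on the upper half plane with $\varphi(z)^4=(cz+d)^2$, with product $(g_1,\varphi_1)(g_2,\varphi_2)=(g_1g_2,\varphi_1(g_2z)\varphi_2(z))$. For $\xi^4=1$ put $[g,\xi]=(g,\xi (cz+d)^{1/2})$. It acts on $\mathcal V$ by $$(\pi([g,\xi])f)(x)=|a-cx|^{-2\lambda}f\Bigl(\frac{dx-b}{a-cx}\Bigr)\cdot\begin{cases}\xi^{-\ell}&(a-cx>0)\\(i\xi)^{-\ell}&(a-cx<0,\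 c\ge0)\\(-i\xi)^{-\ell}&(a-cx<0,\ c<0)\end{cases}$$ and, where $a-cx=0$, by $|c|^{2\lambda}f(\infty)$ times $\xi^{-\ell}$ if $c<0$ and $(i\xi)^{-\ell}$ if $c>0$. It acts on distributions by $(\pi^*(\tilde g)T)(f)=T(\pi(\tilde g^{-1})f)$. Let $\widetilde\Delta(N)$ be the subgroup generated by $\left[\begin{pmatrix}1&1\\0&1\end{pmatrix},1\right]$ and $\left[\begin{pmatrix}1&0\\N&1\end{pmatrix},1\right]$. Let $\widetilde\Gamma_0(N)=\{[\gamma,\pm1]:\gamma\in\Gamma_0(N)\}$ if $\ell$ is even, and $\widetilde\Gamma_0(N)=\{[\gamma,\varepsilon_d^{-1}(\tfrac cd)]:\gamma=\begin{pmatrix}a&b\\c&d\end{pmatrix}\in\Gamma_0(N)\}$ if $\ell$ is odd; here $\varepsilon_d=1$ or $i$ according as $d\equiv1$ or $3$ mod $4$, and $(\tfrac cd)$ is the Jacobi symbol $(\tfrac c{|d|})$, multiplied by $-1$ if $c<0$ and $d<0$. Put $\chi([\gamma,\xi])=\chi(d)$. A distribution $T$ is automorphic for a group $\widetilde\Gamma\subset\widetilde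 G$ with character $\chi$ if $\pi^*(\tilde\gamma)T=\chi(\tilde\gamma)T$ for all $\tilde\gamma\in\widetilde\Gamma$. *Twists.* For a prime $r\in\mathbb P_N$ and a Dirichlet character $\psi$ mod $r$ (the principal one included) put $\tau_\psi(n)=\sum_{m\bmod r,\,(m,r)=1}\psi(m)e^{2\pi imn/r}$ and $\psi^*(k)=\overline{\psi(k)}\left(\frac kr\right)^\ell$, and let $C_{\ell,r}=1$ if $\ell$ is even, $C_{\ell,r}=\varepsilon_r^\ell$ if $\ell$ is odd. **Proposition.** Let $(\alpha(n))_{n\in\mathbb Z}$, $(\beta(n))_{n\in\mathbb Z}$ be complex sequences of polynomial growth and $\alpha(\infty),\beta(\infty)\in\mathbb C$ such that the Ferrar–Suzuki summation formula of level $N$ $$\alpha(\infty)f(\infty)+\sum_{n\in\mathbb Z}\alpha(n)(\mathcal Ff)(n)=\beta(\infty)f_\infty(\infty)+\sum_{n\in\mathbb Z}\beta(n)(\mathcal Ff_\infty)\Bigl(\frac nN\Bigr)$$ holds for all $f\in\mathcal V$. Then the left side $T(f)$ defines a distribution $T$ that is automorphic for $\widetilde\Delta(N)$ with trivial character, and the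 following are equivalent: (i) $T$ is automorphic for $\widetilde\Gamma_0(N)$ with character $\chi$. (ii) For every $r\in\mathbb P_N$, every Dirichlet character $\psi$ mod $r$ and every $f\in\mathcal V$, $$\alpha(\infty)\tau_\psi(0)f(\infty)+\sum_{n\in\mathbb Z}\alpha(n)\tau_\psi(n)(\mathcal Ff)(n)=\overline{\chi(r)}\,C_{\ell,r}\,\psi^*(-N)\Bigl\{r^{-2\lambda}\beta(\infty)\tau_{\psi^*}(0)f_\infty(\infty)+r^{2\lambda-2}\sum_{n\in\mathbb Z}\beta(n)\tau_{\psi^*}(n)(\mathcal Ff_\infty)\Bigl(\frac n{Nr^2}\Bigr)\Bigr\}.$$ -/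

import Mathlib

open scoped MatrixGroups ContDiff Manifold

noncomputable section

namespace FerrarSuzuki

open UpperHalfPlane Complex

/-- The automorphy factor `j(g, z) = c z + d`. -/
def autFactor (g : SL(2, ℝ)) (z : ℍ) : ℂ := ((g 1 0 : ℝ) : ℂ) * (z : ℂ) + ((g 1 1 : ℝ) : ℂ)

theorem autFactor_eq_denom (g : SL(2, ℝ)) (z : ℍ) :
    autFactor g z = denom (g : GL (Fin 2) ℝ) z := by
  simp [autFactor, denom]

theorem autFactor_ne_zero (g : SL(2, ℝ)) (z : ℍ) : autFactor g z ≠ 0 := by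
  rw [autFactor_eq_denom]; exact denom_ne_zero _ z

theorem autFactor_mul (g h : SL(2, ℝ)) (z : ℍ) :
    autFactor (g * h) z = autFactor g (h • z) * autFactor h z := by
  have := denom_cocycle_σ (g : GL (Fin 2) ℝ) (h : GL (Fin 2) ℝ) z
  rw [autFactor_eq_denom, autFactor_eq_denom, autFactor_eq_denom]
  have e : ((h • z : ℍ)) = (h : GL (Fin 2) ℝ) • z := rfl
  rw [e]
  rw [map_mul, this]
  simp [σ]

theorem mdifferentiable_smul_SL (g : SL(2, ℝ)) :
    MDifferentiable 𝓘(ℂ) 𝓘(ℂ) (fun z : ℍ => g • z) := by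
  have h : 0 < ((g : GL (Fin 2) ℝ)).det.val := by simp
  exact mdifferentiable_smul h

/-- The covering group of `SL(2, ℝ)`: pairs `(g, φ)` with `g ∈ SL(2, ℝ)` and `φ` holomorphic on the
upper half plane such that `φ(z) ^ 4 = j(g, z) ^ 2`. -/
@[ext]
structure Cover where
  /-- the underlying matrix -/
  mat : SL(2, ℝ)
  /-- the chosen fourth root of the square of the automorphy factor -/
  fn : ℍ → ℂ
  holo : MDifferentiable 𝓘(ℂ) 𝓘(ℂ) fn
  pow_four : ∀ z, fn z ^ 4 = autFactor mat z ^ 2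

namespace Cover

theorem fn_ne_zero (G : Cover) (z : ℍ) : G.fn z ≠ 0 := by
  intro h
  have := G.pow_four z
  rw [h] at this
  exact autFactor_ne_zero G.mat z (by simpa using this.symm)

instance : Mul Cover where
  mul G H :=
    { mat := G.mat * H.mat
      fn := fun z => G.fn (H.mat • z) * H.fn z
      holo := (G.holo.comp (mdifferentiable_smul_SL H.mat)).mul H.holo
      pow_four := fun z => by
        rw [mul_pow, G.pow_four, H.pow_four, autFactor_mul, mul_pow] }

instance : One Cover where
  one :=
    { mat := 1
      fn := fun _ => 1
      holo := mdifferentiable_const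
      pow_four := fun z => by simp [autFactor] }

instance : Inv Cover where
  inv G :=
    { mat := G.mat⁻¹
      fn := fun z => (G.fn (G.mat⁻¹ • z))⁻¹
      holo := by
        have h := G.holo.comp (mdifferentiable_smul_SL G.mat⁻¹)
        intro z
        exact (h z).inv (G.fn_ne_zero _)
      pow_four := fun z => by
        have h := autFactor_mul G.mat G.mat⁻¹ z
        have h1 : autFactor (1 : SL(2, ℝ)) z = 1 := by simp [autFactor]
        rw [mul_inv_cancel, h1] at h
        rw [inv_pow, G.pow_four, eq_comm, ← inv_pow]
        congr 1
        exact eq_inv_of_mul_eq_one_right h.symm }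

@[simp] theorem mul_mat (G H : Cover) : (G * H).mat = G.mat * H.mat := rfl
@[simp] theorem mul_fn (G H : Cover) (z : ℍ) : (G * H).fn z = G.fn (H.mat • z) * H.fn z := rfl
@[simp] theorem one_mat : (1 : Cover).mat = 1 := rfl
@[simp] theorem one_fn (z : ℍ) : (1 : Cover).fn z = 1 := rfl
@[simp] theorem inv_mat (G : Cover) : G⁻¹.mat = G.mat⁻¹ := rfl
@[simp] theorem inv_fn (G : Cover) (z : ℍ) : G⁻¹.fn z = (G.fn (G.mat⁻¹ • z))⁻¹ := rfl

instance : Group Cover where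
  mul_assoc A B C := by
    ext1
    · simp [mul_assoc]
    · funext z; simp [mul_smul, mul_assoc]
  one_mul A := by
    ext1
    · simp
    · funext z; simp
  mul_one A := by
    ext1
    · simp
    · funext z; simp
  inv_mul_cancel A := by
    ext1
    · simp
    · funext z; simp [A.fn_ne_zero]

/-- The element `[g, ξ] = (g, ξ j(g, z) ^ (1/2))`, with the principal value of the square root. -/
def lift (g : SL(2, ℝ)) (ξ : ℂ) (hξ : ξ ^ 4 = 1) : Cover where
  mat := g
  fn := fun z => ξ * autFactor g z ^ (1 / 2 : ℂ)
  holo := by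
    by_cases hc : g 1 0 = 0
    · have : (fun z => ξ * autFactor g z ^ (1 / 2 : ℂ)) =
          fun _ : ℍ => ξ * ((g 1 1 : ℝ) : ℂ) ^ (1 / 2 : ℂ) := by
        funext z; simp [autFactor, hc]
      rw [this]
      exact mdifferentiable_const
    · have hd : MDifferentiable 𝓘(ℂ) 𝓘(ℂ) (fun z : ℍ => autFactor g z) := by
        simp only [autFactor_eq_denom]
        exact mdifferentiable_denom _
      intro z
      have hs : autFactor g z ∈ slitPlane := by
        refine Or.inr ?_
        have : (autFactor g z).im = g 1 0 * z.im := by simp [autFactor]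
        rw [this]
        exact mul_ne_zero hc z.im_ne_zero
      have h1 : DifferentiableAt ℂ (fun w : ℂ => ξ * w ^ (1 / 2 : ℂ)) (autFactor g z) :=
        ((differentiableAt_id).cpow_const hs).const_mul ξ
      exact h1.mdifferentiableAt.comp z (hd z)
  pow_four := fun z => by
    rw [mul_pow, hξ, one_mul, ← cpow_nat_mul]
    norm_num

/-- The unique `ξ` with `(g, φ) = [g, ξ]`, read off at the point `z = i`. -/
def root (G : Cover) : ℂ := G.fn UpperHalfPlane.I / autFactor G.mat UpperHalfPlane.I ^ (1 / 2 : ℂ)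

end Cover
end FerrarSuzuki

namespace FerrarSuzuki

open Complex

/-- `(sgn x) ^ (ℓ/2)` for `x ≠ 0`: it is `1` for `x > 0` and `i ^ ℓ` for `x < 0`. -/
def sgnPow (ℓ : ℤ) (x : ℝ) : ℂ := if 0 < x then 1 else I ^ ℓ

/-- The formula `(sgn x) ^ (ℓ/2) |x| ^ (-2λ) f(-1/x)`, meaningful for `x ≠ 0`. -/
def rawInf (lam : ℂ) (ℓ : ℤ) (f : ℝ → ℂ) (x : ℝ) : ℂ :=
  sgnPow ℓ x * ((|x| : ℝ) : ℂ) ^ (-2 * lam) * f (-1 / x)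

/-- The space of smooth `f : ℝ → ℂ` for which `(sgn x) ^ (ℓ/2) |x| ^ (-2λ) f(-1/x)` extends to a
smooth function on `ℝ`. -/
def lineSubmodule (lam : ℂ) (ℓ : ℤ) : Submodule ℂ (ℝ → ℂ) where
  carrier := {f | ContDiff ℝ ∞ f ∧
    ∃ h : ℝ → ℂ, ContDiff ℝ ∞ h ∧ ∀ x, x ≠ 0 → h x = rawInf lam ℓ f x}
  add_mem' := by
    rintro f g ⟨hf, F, hF, hF'⟩ ⟨hg, H, hH, hH'⟩
    refine ⟨hf.add hg, F + H, hF.add hH, fun x hx => ?_⟩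
    simp [rawInf, hF' x hx, hH' x hx, mul_add]
  zero_mem' := ⟨contDiff_const, 0, contDiff_const, fun x _ => by simp [rawInf]⟩
  smul_mem' := by
    rintro c f ⟨hf, F, hF, hF'⟩
    refine ⟨contDiff_const.smul hf, c • F, contDiff_const.smul hF, fun x hx => ?_⟩
    simp [rawInf, hF' x hx]
    ring

/-- The line model `𝒱^∞_{λ,ℓ}` of the smooth principal series, with its own Fréchet topology. -/
def LineModel (lam : ℂ) (ℓ : ℤ) : Type := lineSubmodule lam ℓ

namespace LineModel

variable {lam : ℂ} {ℓ : ℤ}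

instance : AddCommGroup (LineModel lam ℓ) := inferInstanceAs (AddCommGroup (lineSubmodule lam ℓ))
instance : Module ℂ (LineModel lam ℓ) := inferInstanceAs (Module ℂ (lineSubmodule lam ℓ))

instance : FunLike (LineModel lam ℓ) ℝ ℂ where
  coe f := Subtype.val (p := fun g => g ∈ lineSubmodule lam ℓ) f
  coe_injective _ _ h := Subtype.ext h

theorem mem (f : LineModel lam ℓ) : (f : ℝ → ℂ) ∈ lineSubmodule lam ℓ :=
  Subtype.property (p := fun g => g ∈ lineSubmodule lam ℓ) f

@[simp] theorem add_apply (f g : LineModel lam ℓ) (x : ℝ) : (f + g) x = f x + g x := rfl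
@[simp] theorem smul_apply (c : ℂ) (f : LineModel lam ℓ) (x : ℝ) : (c • f) x = c * f x := rfl


/-- The smooth extension to `ℝ` of `(sgn x) ^ (ℓ/2) |x| ^ (-2λ) f(-1/x)`. -/
def infFun (f : LineModel lam ℓ) : ℝ → ℂ := f.mem.2.choose

theorem contDiff (f : LineModel lam ℓ) : ContDiff ℝ ∞ (f : ℝ → ℂ) := f.mem.1

theorem infFun_contDiff (f : LineModel lam ℓ) : ContDiff ℝ ∞ f.infFun := f.mem.2.choose_spec.1

theorem infFun_eq (f : LineModel lam ℓ) {x : ℝ} (hx : x ≠ 0) :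
    f.infFun x = rawInf lam ℓ f x := f.mem.2.choose_spec.2 x hx

end LineModel

theorem eq_of_eq_off_zero {h k : ℝ → ℂ} (hh : Continuous h) (hk : Continuous k)
    (H : ∀ x, x ≠ 0 → h x = k x) : h = k :=
  Continuous.ext_on (dense_compl_singleton (0 : ℝ)) hh hk (fun x hx => H x hx)

namespace LineModel

variable {lam : ℂ} {ℓ : ℤ}

theorem infFun_unique (f : LineModel lam ℓ) {h : ℝ → ℂ} (hh : Continuous h)
    (H : ∀ x, x ≠ 0 → h x = rawInf lam ℓ f x) : f.infFun = h :=
  eq_of_eq_off_zero f.infFun_contDiff.continuous hh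
    (fun x hx => by rw [f.infFun_eq hx, H x hx])

theorem infFun_add (f g : LineModel lam ℓ) : (f + g).infFun = f.infFun + g.infFun := by
  refine infFun_unique _ (f.infFun_contDiff.continuous.add g.infFun_contDiff.continuous) ?_
  intro x hx
  simp [rawInf, f.infFun_eq hx, g.infFun_eq hx, mul_add]

theorem infFun_smul (c : ℂ) (f : LineModel lam ℓ) : (c • f).infFun = c • f.infFun := by
  refine infFun_unique _ (f.infFun_contDiff.continuous.const_smul c) ?_
  intro x hx
  simp [rawInf, f.infFun_eq hx]
  ring

end LineModel

theorem ofReal_abs_cpow_mul (a b : ℝ) (s : ℂ) :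
    ((|a * b| : ℝ) : ℂ) ^ s = ((|a| : ℝ) : ℂ) ^ s * ((|b| : ℝ) : ℂ) ^ s := by
  rw [abs_mul, ofReal_mul, mul_cpow_ofReal_nonneg (abs_nonneg _) (abs_nonneg _)]

theorem abs_cpow_ne_zero {x : ℝ} (hx : x ≠ 0) (s : ℂ) : ((|x| : ℝ) : ℂ) ^ s ≠ 0 := by
  rw [Ne, cpow_eq_zero_iff]
  simp [hx]

theorem ofReal_abs_cpow_inv (a : ℝ) (s : ℂ) :
    ((|a⁻¹| : ℝ) : ℂ) ^ s = (((|a| : ℝ) : ℂ) ^ s)⁻¹ := by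
  by_cases ha : a = 0
  · by_cases hs : s = 0
    · simp [hs]
    · simp [ha, zero_cpow hs]
  · refine eq_inv_of_mul_eq_one_left ?_
    rw [← ofReal_abs_cpow_mul]
    simp [ha]

theorem sgnPow_mul_neg_inv (ℓ : ℤ) {x : ℝ} (hx : x ≠ 0) :
    sgnPow ℓ x * sgnPow ℓ (-1 / x) = I ^ ℓ := by
  rcases lt_or_gt_of_ne hx with h | h
  · have h2 : 0 < -1 / x := div_pos_of_neg_of_neg (by norm_num) h
    simp [sgnPow, h2, h.not_gt]
  · have h2 : ¬ 0 < -1 / x := not_lt.2 (div_neg_of_neg_of_pos (by norm_num) h).le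
    simp [sgnPow, h2, h]

theorem rawInf_rawInf (lam : ℂ) (ℓ : ℤ) (f : ℝ → ℂ) {x : ℝ} (hx : x ≠ 0) :
    rawInf lam ℓ (rawInf lam ℓ f) x = I ^ ℓ * f x := by
  have h1 := sgnPow_mul_neg_inv ℓ hx
  have h2 : ((|(-1 / x)| : ℝ) : ℂ) ^ (-2 * lam) = (((|x| : ℝ) : ℂ) ^ (-2 * lam))⁻¹ := by
    rw [← ofReal_abs_cpow_inv]; simp [abs_div]
  have h3 : -1 / (-1 / x) = x := by field_simp
  have h4 := abs_cpow_ne_zero hx (-2 * lam)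
  simp only [rawInf]
  rw [h2, h3, ← h1]
  generalize ((|x| : ℝ) : ℂ) ^ (-2 * lam) = w at *
  field_simp

namespace LineModel

variable {lam : ℂ} {ℓ : ℤ}

/-- The operation `f ↦ f_∞` on the line model. -/
def inf (f : LineModel lam ℓ) : LineModel lam ℓ :=
  ⟨f.infFun, f.infFun_contDiff, fun x => I ^ ℓ * f x, contDiff_const.mul f.contDiff, by
    intro x hx
    have h := rawInf_rawInf lam ℓ f hx
    simp only
    rw [← h]
    simp only [rawInf]
    rw [f.infFun_eq (div_ne_zero (by norm_num) hx)]
    rfl⟩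

/-- The value `f(∞) = f_∞(0)`. -/
def atInfty (f : LineModel lam ℓ) : ℂ := f.inf 0

end LineModel

/-- Auxiliary normal form of the principal series action. -/
def moebiusForm (lam : ℂ) (f : ℝ → ℂ) (v : ℂ) (a b c d : ℝ) (p q : ℂ) (x : ℝ) : ℂ :=
  if a - c * x = 0 then ((|c| : ℝ) : ℂ) ^ (2 * lam) * v * (if c < 0 then p else q)
  else ((|a - c * x| : ℝ) : ℂ) ^ (-2 * lam) * f ((d * x - b) / (a - c * x)) *
    (if 0 < a - c * x then p else q)

theorem contDiffAt_abs_cpow (s : ℂ) {x : ℝ} (hx : x ≠ 0) :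
    ContDiffAt ℝ ∞ (fun y : ℝ => ((|y| : ℝ) : ℂ) ^ s) x := by
  have h1 : ContDiffAt ℝ ∞ (fun y : ℝ => Complex.exp (((Real.log y : ℝ) : ℂ) * s)) x :=
    ((ofRealCLM.contDiff.contDiffAt.comp x (Real.contDiffAt_log.2 hx)).mul contDiffAt_const).cexp
  refine h1.congr_of_eventuallyEq ?_
  filter_upwards [isOpen_ne.mem_nhds hx] with y hy
  have : ((|y| : ℝ) : ℂ) ≠ 0 := by simpa using hy
  rw [cpow_def_of_ne_zero this, ← ofReal_log (abs_nonneg y), Real.log_abs]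

theorem contDiff_moebiusForm {lam : ℂ} {ℓ : ℤ} {f h : ℝ → ℂ} (hf : ContDiff ℝ ∞ f)
    (hh : ContDiff ℝ ∞ h) (H : ∀ x, x ≠ 0 → h x = rawInf lam ℓ f x) {a b c d : ℝ} {p q : ℂ}
    (det : a * d - b * c = 1) (hpos : 0 < c → p = I ^ ℓ * q) (hneg : c < 0 → q = I ^ ℓ * p) :
    ContDiff ℝ ∞ (moebiusForm lam f (h 0) a b c d p q) := by
  rw [contDiff_iff_contDiffAt]
  intro x
  have hl : ContDiff ℝ ∞ (fun y : ℝ => a - c * y) := contDiff_const.sub (contDiff_const.mul contDiff_id)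
  have hm : ContDiff ℝ ∞ (fun y : ℝ => d * y - b) := (contDiff_const.mul contDiff_id).sub contDiff_const
  by_cases hx : a - c * x = 0
  · have hc : c ≠ 0 := by
      rintro rfl
      have : a = 0 := by simpa using hx
      simp [this] at det
    have hcx : 0 < c * (d * x - b) := by
      have : c * (d * x - b) = 1 := by linear_combination det - d * hx
      rw [this]; exact one_pos
    have hne : d * x - b ≠ 0 := fun h0 => by simp [h0] at hcx
    have hev : ∀ᶠ y in nhds x, 0 < c * (d * y - b) :=
      (contDiff_const.mul hm).continuous.continuousAt.eventually (lt_mem_nhds hcx)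
    have hsm : ContDiffAt ℝ ∞ (fun y : ℝ => ((|d * y - b| : ℝ) : ℂ) ^ (-2 * lam) *
        h (-(a - c * y) / (d * y - b)) * (if c < 0 then p else q)) x :=
      (((contDiffAt_abs_cpow (-2 * lam) hne).comp x hm.contDiffAt).mul
        (hh.contDiffAt.comp x (hl.neg.contDiffAt.div hm.contDiffAt hne))).mul contDiffAt_const
    refine hsm.congr_of_eventuallyEq ?_
    filter_upwards [hev] with y hy
    have hney : d * y - b ≠ 0 := fun h0 => by simp [h0] at hy
    unfold moebiusForm
    by_cases hy0 : a - c * y = 0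
    · rw [if_pos hy0, hy0]
      have e : d * y - b = c⁻¹ := by
        have : c * (d * y - b) = 1 := by linear_combination det - d * hy0
        exact eq_inv_of_mul_eq_one_right this
      rw [e, ofReal_abs_cpow_inv, neg_mul, cpow_neg, inv_inv]
      simp
    · rw [if_neg hy0]
      have hu : -(a - c * y) / (d * y - b) ≠ 0 := div_ne_zero (neg_ne_zero.2 hy0) hney
      rw [H _ hu]
      have e1 : -1 / (-(a - c * y) / (d * y - b)) = (d * y - b) / (a - c * y) := by field_simp
      have e2 : ((|(-(a - c * y) / (d * y - b))| : ℝ) : ℂ) ^ (-2 * lam) =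
          ((|a - c * y| : ℝ) : ℂ) ^ (-2 * lam) * (((|d * y - b| : ℝ) : ℂ) ^ (-2 * lam))⁻¹ := by
        rw [div_eq_mul_inv, ofReal_abs_cpow_mul, ofReal_abs_cpow_inv, abs_neg]
      have e3 : sgnPow ℓ (-(a - c * y) / (d * y - b)) * (if c < 0 then p else q) =
          if 0 < a - c * y then p else q := by
        rcases lt_or_gt_of_ne hc with h0 | h0
        · have hd : d * y - b < 0 := by nlinarith
          rcases lt_or_gt_of_ne hy0 with h1 | h1
          · have : ¬ 0 < -(a - c * y) / (d * y - b) :=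
              not_lt.2 (div_neg_of_pos_of_neg (by linarith) hd).le
            simp only [sgnPow, if_neg this, if_pos h0, if_neg h1.not_gt, hneg h0]
          · have : 0 < -(a - c * y) / (d * y - b) := div_pos_of_neg_of_neg (by linarith) hd
            simp only [sgnPow, if_pos this, if_pos h0, if_pos h1, one_mul]
        · have hd : 0 < d * y - b := by
            by_contra h2
            nlinarith
          rcases lt_or_gt_of_ne hy0 with h1 | h1
          · have : 0 < -(a - c * y) / (d * y - b) := div_pos (by linarith) hd
            simp only [sgnPow, if_pos this, if_neg h0.not_gt, if_neg h1.not_gt, one_mul]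
          · have : ¬ 0 < -(a - c * y) / (d * y - b) :=
              not_lt.2 (div_neg_of_neg_of_pos (by linarith) hd).le
            simp only [sgnPow, if_neg this, if_neg h0.not_gt, if_pos h1, hpos h0]
      rw [← e3]
      simp only [rawInf]
      rw [e1, e2]
      have := abs_cpow_ne_zero hney (-2 * lam)
      generalize ((|d * y - b| : ℝ) : ℂ) ^ (-2 * lam) = w at *
      field_simp
  · have hev : ∀ᶠ y in nhds x, 0 < (a - c * x) * (a - c * y) :=
      (contDiff_const.mul hl).continuous.continuousAt.eventually
        (lt_mem_nhds (mul_self_pos.2 hx))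
    have hsm : ContDiffAt ℝ ∞ (fun y : ℝ => ((|a - c * y| : ℝ) : ℂ) ^ (-2 * lam) *
        f ((d * y - b) / (a - c * y)) * (if 0 < a - c * x then p else q)) x :=
      ((ContDiffAt.comp (g := fun y : ℝ => ((|y| : ℝ) : ℂ) ^ (-2 * lam)) x
          (contDiffAt_abs_cpow (-2 * lam) hx) hl.contDiffAt).mul
        (ContDiffAt.comp (g := f) x hf.contDiffAt
          (hm.contDiffAt.div hl.contDiffAt hx))).mul contDiffAt_const
    refine hsm.congr_of_eventuallyEq ?_
    filter_upwards [hev] with y hy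
    have hy0 : a - c * y ≠ 0 := fun h0 => by simp [h0] at hy
    have e : (0 < a - c * y) ↔ (0 < a - c * x) := by
      constructor
      · intro h1; by_contra h2; nlinarith
      · intro h1; by_contra h2; nlinarith
    simp only [moebiusForm, if_neg hy0, e]

theorem rawInf_moebiusForm {lam : ℂ} {ℓ : ℤ} {f : ℝ → ℂ} {v : ℂ} {a b c d : ℝ} {p q : ℂ}
    (det : a * d - b * c = 1) (hpos : 0 < c → p = I ^ ℓ * q) (hneg : c < 0 → q = I ^ ℓ * p) :
    ∃ p' q' : ℂ, (0 < -a → p' = I ^ ℓ * q') ∧ (-a < 0 → q' = I ^ ℓ * p') ∧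
      ∀ x, x ≠ 0 → moebiusForm lam f v c d (-a) (-b) p' q' x =
        rawInf lam ℓ (moebiusForm lam f v a b c d p q) x := by
  obtain ⟨p', q', h1, h2, h3, h4⟩ : ∃ p' q' : ℂ, (0 < -a → p' = I ^ ℓ * q') ∧
      (-a < 0 → q' = I ^ ℓ * p') ∧
      (∀ x : ℝ, x ≠ 0 → a * x + c ≠ 0 → (if 0 < a * x + c then p' else q') =
        sgnPow ℓ x * (if 0 < (a * x + c) / x then p else q)) ∧
      (∀ x : ℝ, x ≠ 0 → a * x + c = 0 → (if -a < 0 then p' else q') =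
        sgnPow ℓ x * (if c < 0 then p else q)) := by
    refine ⟨if 0 < c then p else if c < 0 then (if 0 < a then p else I ^ ℓ * q) else
        (if 0 < a then p else I ^ ℓ * q),
      if c < 0 then q else if 0 < c then (if a < 0 then q else I ^ ℓ * p) else
        (if a < 0 then q else I ^ ℓ * p), ?_, ?_, ?_, ?_⟩
    · intro ha
      have ha' : a < 0 := by linarith
      rcases lt_trichotomy c 0 with h | h | h
      · simp [h, h.not_gt, ha'.not_gt]
      · simp [h, ha', ha'.not_gt]
      · simp [h, h.not_gt, ha', hpos h]
    · intro ha
      have ha' : 0 < a := by linarith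
      rcases lt_trichotomy c 0 with h | h | h
      · simp [h, h.not_gt, ha', hneg h]
      · simp [h, ha', ha'.not_gt]
      · simp [h, h.not_gt, ha'.not_gt]
    · intro x hx hxc
      rcases lt_or_gt_of_ne hx with x0 | x0 <;> rcases lt_or_gt_of_ne hxc with y0 | y0
      · have t : 0 < (a * x + c) / x := div_pos_of_neg_of_neg y0 x0
        simp only [sgnPow, if_neg x0.not_gt, if_pos t, if_neg y0.not_gt]
        rcases lt_trichotomy c 0 with h | h | h
        · simp [h, hneg h]
        · have : ¬ a < 0 := by intro; nlinarith
          simp [h, this]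
        · have : ¬ a < 0 := by intro; nlinarith
          simp [h, h.not_gt, this]
      · have t : ¬ 0 < (a * x + c) / x := not_lt.2 (div_neg_of_pos_of_neg y0 x0).le
        simp only [sgnPow, if_neg x0.not_gt, if_neg t, if_pos y0]
        rcases lt_trichotomy c 0 with h | h | h
        · have : ¬ 0 < a := by intro; nlinarith
          simp [h, h.not_gt, this]
        · have : ¬ 0 < a := by intro; nlinarith
          simp [h, this]
        · simp [h, hpos h]
      · have t : ¬ 0 < (a * x + c) / x := not_lt.2 (div_neg_of_neg_of_pos y0 x0).le
        simp only [sgnPow, if_pos x0, if_neg t, if_neg y0.not_gt, one_mul]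
        rcases lt_trichotomy c 0 with h | h | h
        · simp [h]
        · have : a < 0 := by by_contra; nlinarith
          simp [h, this]
        · have : a < 0 := by by_contra; nlinarith
          simp [h, h.not_gt, this]
      · have t : 0 < (a * x + c) / x := div_pos y0 x0
        simp only [sgnPow, if_pos x0, if_pos t, if_pos y0, one_mul]
        rcases lt_trichotomy c 0 with h | h | h
        · have : 0 < a := by by_contra; nlinarith
          simp [h, h.not_gt, this]
        · have : 0 < a := by by_contra; nlinarith
          simp [h, this]
        · simp [h]
    · intro x hx hxc
      have hc0 : c ≠ 0 := by
        rintro rfl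
        have : a = 0 := by simpa [hx] using hxc
        simp [this] at det
      rcases lt_or_gt_of_ne hx with x0 | x0 <;> rcases lt_or_gt_of_ne hc0 with h | h
      · have : a < 0 := by by_contra; nlinarith
        simp [sgnPow, x0.not_gt, h, this.not_gt, hneg h]
      · have : 0 < a := by by_contra; nlinarith
        simp [sgnPow, x0.not_gt, h, h.not_gt, this, hpos h]
      · have : 0 < a := by by_contra; nlinarith
        simp [sgnPow, x0, h, h.not_gt, this]
      · have : a < 0 := by by_contra; nlinarith
        simp [sgnPow, x0, h, h.not_gt, this.not_gt, this]
  refine ⟨p', q', h1, h2, fun x hx => ?_⟩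
  have e0 : c - -a * x = a * x + c := by ring
  have e1 : a - c * (-1 / x) = (a * x + c) / x := by field_simp; ring
  by_cases hxc : a * x + c = 0
  · have k := h4 x hx hxc
    simp only [moebiusForm, rawInf, e0, e1, hxc, zero_div, if_true]
    rw [k]
    have e2 : c = (-a) * x := by linarith
    have e3 : ((|c| : ℝ) : ℂ) ^ (2 * lam) =
        ((|(-a)| : ℝ) : ℂ) ^ (2 * lam) * ((|x| : ℝ) : ℂ) ^ (2 * lam) := by
      rw [e2, ofReal_abs_cpow_mul]
    have e4 := abs_cpow_ne_zero hx (2 * lam)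
    rw [e3, neg_mul, cpow_neg]
    field_simp
  · have k := h3 x hx hxc
    have hq : (a * x + c) / x ≠ 0 := div_ne_zero hxc hx
    simp only [moebiusForm, rawInf, e0, e1, if_neg hxc, if_neg hq]
    rw [k]
    have e2 : (d * (-1 / x) - b) / ((a * x + c) / x) = (-b * x - d) / (a * x + c) := by
      field_simp; ring
    have e3 : ((|(a * x + c) / x| : ℝ) : ℂ) ^ (-2 * lam) =
        ((|a * x + c| : ℝ) : ℂ) ^ (-2 * lam) * (((|x| : ℝ) : ℂ) ^ (-2 * lam))⁻¹ := by
      rw [div_eq_mul_inv, ofReal_abs_cpow_mul, ofReal_abs_cpow_inv]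
    have e4 := abs_cpow_ne_zero hx (-2 * lam)
    rw [e2, e3]
    generalize ((|x| : ℝ) : ℂ) ^ (-2 * lam) = w at *
    field_simp

namespace LineModel

variable {lam : ℂ} {ℓ : ℤ}

/-- The function `π_{λ,ℓ}([g, ξ]) f` for `g = (a b; c d)`. -/
def actFun (G : Cover) (f : LineModel lam ℓ) (x : ℝ) : ℂ :=
  let a := G.mat 0 0
  let b := G.mat 0 1
  let c := G.mat 1 0
  let d := G.mat 1 1
  let ξ := G.root
  if -c * x + a = 0 then
    ((|c| : ℝ) : ℂ) ^ (2 * lam) * f.atInfty * (if c < 0 then ξ ^ (-ℓ) else (I * ξ) ^ (-ℓ))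
  else
    ((|-c * x + a| : ℝ) : ℂ) ^ (-2 * lam) * f ((d * x - b) / (-c * x + a)) *
      (if 0 < -c * x + a then ξ ^ (-ℓ)
        else if 0 ≤ c then (I * ξ) ^ (-ℓ) else (-I * ξ) ^ (-ℓ))

theorem actFun_eq (G : Cover) (f : LineModel lam ℓ) :
    actFun G f = moebiusForm lam f (f.infFun 0) (G.mat 0 0) (G.mat 0 1) (G.mat 1 0) (G.mat 1 1)
      (G.root ^ (-ℓ)) (if 0 ≤ G.mat 1 0 then (I * G.root) ^ (-ℓ) else (-I * G.root) ^ (-ℓ)) := by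
  funext x
  have e : -G.mat 1 0 * x + G.mat 0 0 = G.mat 0 0 - G.mat 1 0 * x := by ring
  simp only [actFun, moebiusForm, e]
  split_ifs with h1 h2 h3 <;> first | rfl | (exfalso; linarith)

theorem actFun_mem (G : Cover) (f : LineModel lam ℓ) : actFun G f ∈ lineSubmodule lam ℓ := by
  rw [actFun_eq]
  set a := G.mat 0 0
  set b := G.mat 0 1
  set c := G.mat 1 0
  set d := G.mat 1 1
  have det : a * d - b * c = 1 := by
    have := G.mat.2
    rw [Matrix.det_fin_two] at this
    exact this
  have det' : c * (-b) - d * (-a) = 1 := by linear_combination det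
  have hI : (I : ℂ) ^ ℓ ≠ 0 := zpow_ne_zero _ I_ne_zero
  have hpos : 0 < c → G.root ^ (-ℓ) =
      I ^ ℓ * (if 0 ≤ c then (I * G.root) ^ (-ℓ) else (-I * G.root) ^ (-ℓ)) := by
    intro h
    rw [if_pos h.le, mul_zpow, zpow_neg I]
    field_simp
  have hneg : c < 0 → (if 0 ≤ c then (I * G.root) ^ (-ℓ) else (-I * G.root) ^ (-ℓ)) =
      I ^ ℓ * G.root ^ (-ℓ) := by
    intro h
    have : (-I : ℂ) = I⁻¹ := by simp
    rw [if_neg h.not_ge, mul_zpow, this, inv_zpow, zpow_neg I, inv_inv]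
  refine ⟨contDiff_moebiusForm f.contDiff f.infFun_contDiff (fun x hx => f.infFun_eq hx) det
    hpos hneg, ?_⟩
  obtain ⟨p', q', h1, h2, h3⟩ := rawInf_moebiusForm (lam := lam) (f := f) (v := f.infFun 0)
    det hpos hneg
  exact ⟨_, contDiff_moebiusForm f.contDiff f.infFun_contDiff (fun x hx => f.infFun_eq hx) det'
    h1 h2, h3⟩

/-- The principal series representation: the operator `π_{λ,ℓ}(g̃)` on the line model. -/
def act (G : Cover) : LineModel lam ℓ →ₗ[ℂ] LineModel lam ℓ where
  toFun f := ⟨actFun G f, actFun_mem G f⟩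
  map_add' f g := by
    refine DFunLike.ext _ _ fun x => ?_
    change actFun G (f + g) x = actFun G f x + actFun G g x
    have : (f + g).atInfty = f.atInfty + g.atInfty := by
      change (f + g).infFun 0 = _
      rw [infFun_add]; rfl
    simp only [actFun, this, add_apply]
    split_ifs <;> ring
  map_smul' k f := by
    refine DFunLike.ext _ _ fun x => ?_
    change actFun G (k • f) x = k * actFun G f x
    have : (k • f).atInfty = k * f.atInfty := by
      change (k • f).infFun 0 = _
      rw [infFun_smul]; rfl
    simp only [actFun, this, smul_apply]
    split_ifs <;> ring

end LineModel
end FerrarSuzuki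

namespace FerrarSuzuki

open Complex

/-- The differential operator `D_λ = (1 + x²) d/dx + 2 λ x`. -/
def diffFun (lam : ℂ) (f : ℝ → ℂ) (x : ℝ) : ℂ := (1 + (x : ℂ) ^ 2) * deriv f x + 2 * lam * x * f x

theorem contDiff_diffFun (lam : ℂ) {f : ℝ → ℂ} (hf : ContDiff ℝ ∞ f) :
    ContDiff ℝ ∞ (diffFun lam f) := by
  have h1 : ContDiff ℝ ∞ (deriv f) := (contDiff_infty_iff_deriv.1 hf).2
  have h2 : ContDiff ℝ ∞ (fun x : ℝ => (x : ℂ)) := ofRealCLM.contDiff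
  exact ((contDiff_const.add (h2.pow 2)).mul h1).add ((contDiff_const.mul h2).mul hf)

theorem hasDerivAt_abs_cpow (s : ℂ) {x : ℝ} (hx : x ≠ 0) :
    HasDerivAt (fun y : ℝ => ((|y| : ℝ) : ℂ) ^ s) (((|x| : ℝ) : ℂ) ^ s * (((x⁻¹ : ℝ) : ℂ) * s)) x := by
  have key : ∀ y : ℝ, y ≠ 0 → ((|y| : ℝ) : ℂ) ^ s = Complex.exp (((Real.log y : ℝ) : ℂ) * s) := by
    intro y hy
    have : ((|y| : ℝ) : ℂ) ≠ 0 := by simpa using hy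
    rw [cpow_def_of_ne_zero this, ← ofReal_log (abs_nonneg y), Real.log_abs]
  have h1 := (((Real.hasDerivAt_log hx).ofReal_comp).mul_const s).cexp
  rw [key x hx]
  refine h1.congr_of_eventuallyEq ?_
  filter_upwards [isOpen_ne.mem_nhds hx] with y hy
  exact key y hy

theorem diffFun_rawInf (lam : ℂ) (ℓ : ℤ) {f h : ℝ → ℂ} (hf : ContDiff ℝ ∞ f)
    (H : ∀ x, x ≠ 0 → h x = rawInf lam ℓ f x) {x : ℝ} (hx : x ≠ 0) :
    diffFun lam h x = rawInf lam ℓ (diffFun lam f) x := by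
  have hd : HasDerivAt f (deriv f (-1 / x)) (-1 / x) :=
    ((hf.differentiable (by simp)) _).hasDerivAt
  have hi : HasDerivAt (fun y : ℝ => -1 / y) ((x ^ 2)⁻¹) x := by
    have := (hasDerivAt_inv hx).neg
    simp only [neg_neg] at this
    refine this.congr_of_eventuallyEq (Filter.Eventually.of_forall fun y => ?_)
    simp [neg_div]
  have hc := hd.scomp x hi
  have h1 := ((hasDerivAt_abs_cpow (-2 * lam) hx).const_mul (sgnPow ℓ x)).mul hc
  have h2 := h1.congr_of_eventuallyEq (f₁ := h) (by
    have hev : ∀ᶠ y in nhds x, 0 < x * y :=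
      (continuous_const.mul continuous_id).continuousAt.eventually
        (lt_mem_nhds (mul_self_pos.2 hx))
    filter_upwards [hev] with y hy
    have hy0 : y ≠ 0 := fun h0 => by simp [h0] at hy
    have e : sgnPow ℓ y = sgnPow ℓ x := by
      have : (0 < y) ↔ (0 < x) := by
        constructor
        · intro h1; by_contra h2; nlinarith
        · intro h1; by_contra h2; nlinarith
      simp only [sgnPow, this]
    rw [H y hy0]
    simp only [rawInf, e, Pi.mul_apply, Function.comp])
  simp only [diffFun, rawInf]
  rw [h2.deriv, H x hx]
  simp only [rawInf, Function.comp, real_smul]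
  have hxc : (x : ℂ) ≠ 0 := by exact_mod_cast hx
  push_cast
  generalize ((|x| : ℝ) : ℂ) ^ (-2 * lam) = w
  field_simp
  ring

namespace LineModel

variable {lam : ℂ} {ℓ : ℤ}

/-- `D_λ` as an operator on the line model. -/
def diff : Module.End ℂ (LineModel lam ℓ) where
  toFun f := ⟨diffFun lam f, contDiff_diffFun lam f.contDiff, diffFun lam f.infFun,
    contDiff_diffFun lam f.infFun_contDiff,
    fun _ hx => diffFun_rawInf lam ℓ f.contDiff (fun _ hy => f.infFun_eq hy) hx⟩
  map_add' f g := by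
    refine DFunLike.ext _ _ fun x => ?_
    change diffFun lam (fun y => f y + g y) x = diffFun lam f x + diffFun lam g x
    have hf := f.contDiff.differentiable (by simp) x
    have hg := g.contDiff.differentiable (by simp) x
    have : deriv (fun y => f y + g y) x = deriv f x + deriv g x := deriv_add hf hg
    simp only [diffFun, this]
    ring
  map_smul' c f := by
    refine DFunLike.ext _ _ fun x => ?_
    change diffFun lam (fun y => c * f y) x = c * diffFun lam f x
    have hf := f.contDiff.differentiable (by simp) x
    have : deriv (fun y => c * f y) x = c * deriv f x := deriv_const_mul c hf
    simp only [diffFun, this]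
    ring

theorem exists_bound (f : LineModel lam ℓ) :
    ∃ C : ℝ, ∀ x : ℝ, (1 + x ^ 2) ^ lam.re * ‖f x‖ ≤ C := by
  have hw : Continuous (fun x : ℝ => (1 + x ^ 2) ^ lam.re) :=
    (continuous_const.add (continuous_id.pow 2)).rpow_const
      (fun x => Or.inl (ne_of_gt (by have := sq_nonneg x; simp; positivity)))
  obtain ⟨C1, h1⟩ := (isCompact_Icc (a := (-1 : ℝ)) (b := 1)).bddAbove_image
    (hw.mul f.contDiff.continuous.norm).continuousOn
  obtain ⟨C2, h2⟩ := (isCompact_Icc (a := (-1 : ℝ)) (b := 1)).bddAbove_image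
    (hw.mul f.infFun_contDiff.continuous.norm).continuousOn
  refine ⟨max C1 C2, fun x => ?_⟩
  by_cases hx : x ∈ Set.Icc (-1 : ℝ) 1
  · exact le_max_of_le_left (h1 ⟨x, hx, rfl⟩)
  · refine le_max_of_le_right ?_
    have hx1 : 1 < |x| := by
      by_contra h
      exact hx (abs_le.1 (not_lt.1 h))
    have hx0 : x ≠ 0 := by rintro rfl; simp at hx1; linarith
    have hu0 : -1 / x ≠ 0 := div_ne_zero (by norm_num) hx0
    have hu : -1 / x ∈ Set.Icc (-1 : ℝ) 1 := by
      rw [Set.mem_Icc, ← abs_le, abs_div, abs_neg, abs_one, div_le_one (by linarith)]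
      exact hx1.le
    have h3 := h2 ⟨-1 / x, hu, rfl⟩
    refine le_trans (le_of_eq ?_) h3
    simp only [Pi.mul_apply]
    rw [f.infFun_eq hu0]
    simp only [rawInf]
    have e1 : -1 / (-1 / x) = x := by field_simp
    have e2 : ‖sgnPow ℓ (-1 / x)‖ = 1 := by
      unfold sgnPow
      split_ifs <;> simp
    have hup : 0 < |(-1 / x)| := abs_pos.2 hu0
    have e3 : ‖((|(-1 / x)| : ℝ) : ℂ) ^ (-2 * lam)‖ = |x| ^ (2 * lam.re) := by
      rw [norm_cpow_eq_rpow_re_of_pos hup]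
      have : (-2 * lam).re = -(2 * lam.re) := by simp
      rw [this, abs_div, abs_neg, abs_one, one_div, Real.inv_rpow (abs_nonneg x),
        Real.rpow_neg (abs_nonneg x), inv_inv]
    rw [e1, norm_mul, norm_mul, e2, e3, one_mul, ← mul_assoc]
    congr 1
    rw [Real.rpow_mul (abs_nonneg x)]
    have e4 : |x| ^ (2 : ℝ) = x ^ 2 := by norm_num
    rw [e4, ← Real.mul_rpow (by positivity) (by positivity)]
    congr 1
    field_simp
    ring

/-- The expression under the supremum in the seminorm `ν_{n,λ}`. -/
def nuTerm (n : ℕ) (f : LineModel lam ℓ) (x : ℝ) : ℝ :=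
  (1 + x ^ 2) ^ lam.re * ∑ j ∈ Finset.range (n + 1), ‖(diff ^ j) f x‖

theorem bddAbove_nuTerm (n : ℕ) (f : LineModel lam ℓ) : BddAbove (Set.range (nuTerm n f)) := by
  choose C hC using fun j : ℕ => exists_bound ((diff ^ j) f)
  refine ⟨∑ j ∈ Finset.range (n + 1), C j, ?_⟩
  rintro _ ⟨x, rfl⟩
  rw [nuTerm, Finset.mul_sum]
  exact Finset.sum_le_sum fun j _ => hC j x

/-- The seminorm `ν_{n,λ}(f) = sup_x (1 + x²) ^ (Re λ) ∑_{j ≤ n} |(D_λ^j f)(x)|`. -/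
def nu (n : ℕ) : Seminorm ℂ (LineModel lam ℓ) :=
  Seminorm.of (fun f => ⨆ x : ℝ, nuTerm n f x)
    (fun f g => by
      refine ciSup_le fun x => ?_
      refine le_trans ?_ (add_le_add (le_ciSup (bddAbove_nuTerm n f) x)
        (le_ciSup (bddAbove_nuTerm n g) x))
      simp only [nuTerm]
      rw [← mul_add, ← Finset.sum_add_distrib]
      refine mul_le_mul_of_nonneg_left (Finset.sum_le_sum fun j _ => ?_) (by positivity)
      rw [map_add, add_apply]
      exact norm_add_le _ _)
    (fun c f => by
      rw [Real.mul_iSup_of_nonneg (norm_nonneg c)]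
      congr 1
      funext x
      simp only [nuTerm, map_smul, smul_apply, norm_mul]
      rw [← Finset.mul_sum]
      ring)

/-- The Fréchet topology on the line model, defined by the seminorms `ν_{n,λ}`. -/
instance : TopologicalSpace (LineModel lam ℓ) :=
  (SeminormFamily.moduleFilterBasis (𝕜 := ℂ) (fun n : ℕ => nu (lam := lam) (ℓ := ℓ) n)).topology'

end LineModel

open MeasureTheory

/-- A distribution is a continuous linear functional on the line model. -/
abbrev Distrib (lam : ℂ) (ℓ : ℤ) : Type := LineModel lam ℓ →L[ℂ] ℂ

/-- The contragredient action `(π*(g̃) T)(f) = T(π(g̃⁻¹) f)`. -/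
def dualAct {lam : ℂ} {ℓ : ℤ} (G : Cover) (T : Distrib lam ℓ) (f : LineModel lam ℓ) : ℂ :=
  T (LineModel.act G⁻¹ f)

/-- `T` is automorphic for the set (in practice: group) `Γ` with character `χ`. -/
def IsAutomorphic {lam : ℂ} {ℓ : ℤ} (Γ : Set Cover) (χ : Cover → ℂ) (T : Distrib lam ℓ) : Prop :=
  ∀ γ ∈ Γ, ∀ f : LineModel lam ℓ, dualAct γ T f = χ γ * T f

/-! ### Local zeta functions and the Fourier transform -/

/-- The meromorphic continuation, to the half plane `Re s > -n`, of `∫_0^1 x ^ (s-1) f(ε x) dx`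
(`ε = ±1`), obtained by splitting off the Taylor polynomial of degree `n - 1` of `f` at `0`. -/
def zetaNear (f : ℝ → ℂ) (ε : ℝ) (n : ℕ) (s : ℂ) : ℂ :=
  (∑ k ∈ Finset.range n, (ε : ℂ) ^ k * iteratedDeriv k f 0 / (k.factorial : ℂ) * (1 / (s + k))) +
    ∫ x in (0 : ℝ)..1, (x : ℂ) ^ (s - 1) * (f (ε * x) -
      ∑ k ∈ Finset.range n, (ε : ℂ) ^ k * iteratedDeriv k f 0 / (k.factorial : ℂ) * (x : ℂ) ^ k)

namespace LineModel

variable {lam : ℂ} {ℓ : ℤ}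

/-- The meromorphic continuation in `s` of the local zeta function
`Φ_+(f; s) = ∫_0^∞ x ^ (s-1) f(x) dx`. The integral over `(1, ∞)` is turned into
`i ^ (-ℓ) ∫_0^1 x ^ (2λ-s-1) f_∞(-x) dx` by `x ↦ 1/x`; any `n > max (-Re s) (Re s - 2 Re λ)`
gives the same value. -/
def zetaPlus (f : LineModel lam ℓ) (s : ℂ) : ℂ :=
  let n := ⌊|s.re| + 2 * |lam.re|⌋₊ + 1
  zetaNear f 1 n s + I ^ (-ℓ) * zetaNear f.inf (-1) n (2 * lam - s)

/-- The meromorphic continuation in `s` of the local zeta function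
`Φ_-(f; s) = ∫_0^∞ x ^ (s-1) f(-x) dx`. -/
def zetaMinus (f : LineModel lam ℓ) (s : ℂ) : ℂ :=
  let n := ⌊|s.re| + 2 * |lam.re|⌋₊ + 1
  zetaNear f (-1) n s + zetaNear f.inf 1 n (2 * lam - s)

/-- The generalized Fourier transform `ℱ f`. For `t ≠ 0` it is
`(-1/(2πit)) ^ m ∫ f^(m)(x) e^{2πixt} dx` with a positive `m > 1 - 2 Re λ`, and the regularized value
at `t = 0` is `Φ_+(f; 1) + Φ_-(f; 1)`. -/
def fourier (f : LineModel lam ℓ) (t : ℝ) : ℂ :=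
  if t = 0 then f.zetaPlus 1 + f.zetaMinus 1
  else
    let m := ⌊1 - 2 * lam.re⌋₊ + 1
    (-1 / (2 * Real.pi * I * t)) ^ m *
      ∫ x : ℝ, iteratedDeriv m f x * exp (2 * Real.pi * I * x * t)

end LineModel

/-! ### Arithmetic groups and characters -/

/-- The quadratic residue symbol `(c/d)` for odd `d` (possibly negative), in Shimura's convention:
`(c/d) = (c/|d|)`, with an extra sign `-1` when both `c` and `d` are negative; `(0/±1) = 1`. -/
def quadSymbol (c d : ℤ) : ℤ := (if c < 0 ∧ d < 0 then -1 else 1) * jacobiSym c d.natAbs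

/-- `ε_d`, equal to `1` if `d ≡ 1 mod 4` and to `i` if `d ≡ 3 mod 4`. -/
def epsilon (d : ℤ) : ℂ := if d % 4 = 1 then 1 else I

/-- The matrix in `SL(2, ℝ)` of an element of `SL(2, ℤ)`. -/
def toReal (γ : SL(2, ℤ)) : SL(2, ℝ) := Matrix.SpecialLinearGroup.map (Int.castRingHom ℝ) γ

/-- The lift `Γ̃₀(N)` of `Γ₀(N)`: all `[γ, ±1]` if `ℓ` is even, and all
`γ* = [γ, ε_d⁻¹ (c/d)]` if `ℓ` is odd (used only for `4 ∣ N`). -/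
def Gamma0Cover (N : ℕ) (ℓ : ℤ) : Set Cover :=
  {G | ∃ γ ∈ CongruenceSubgroup.Gamma0 N, G.mat = toReal γ ∧
    if Even ℓ then
      (∀ z, G.fn z = autFactor (toReal γ) z ^ (1 / 2 : ℂ)) ∨
        (∀ z, G.fn z = -autFactor (toReal γ) z ^ (1 / 2 : ℂ))
    else ∀ z, G.fn z = (epsilon (γ 1 1))⁻¹ * (quadSymbol (γ 1 0) (γ 1 1) : ℂ) *
      autFactor (toReal γ) z ^ (1 / 2 : ℂ)}

/-- The character `[γ, ξ] ↦ χ(d)` of `Γ̃₀(N)` induced by a Dirichlet character `χ` mod `N`, where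
`d` is the lower right entry of the integral matrix `γ`. -/
def inducedChar {N : ℕ} (χ : DirichletCharacter ℂ N) (G : Cover) : ℂ :=
  χ ((⌊G.mat 1 1⌋ : ℤ) : ZMod N)

/-- `ñ(x) = [(1 x; 0 1), 1]`. -/
def upperUnip (x : ℝ) : Cover :=
  Cover.lift ⟨!![1, x; 0, 1], by simp [Matrix.det_fin_two]⟩ 1 (one_pow 4)

/-- The lift `[(1 0; x 1), 1]` of a lower unipotent matrix. -/
def lowerUnip (x : ℝ) : Cover :=
  Cover.lift ⟨!![1, 0; x, 1], by simp [Matrix.det_fin_two]⟩ 1 (one_pow 4)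

/-- The group `Δ̃(N)` generated by `ñ(1)` and the lift of `(1 0; N 1)`. -/
def DeltaCover (N : ℕ) : Subgroup Cover := Subgroup.closure {upperUnip 1, lowerUnip N}

/-- A sequence `ℤ → ℂ` of polynomial growth. -/
def PolyGrowth (α : ℤ → ℂ) : Prop := ∃ (C : ℝ) (k : ℕ), ∀ n : ℤ, ‖α n‖ ≤ C * (1 + |(n : ℝ)|) ^ k

/-- The Ferrar–Suzuki summation formula of level `N` with coefficients `α(n), α(∞), β(n), β(∞)`. -/
def SummationFormula (lam : ℂ) (ℓ : ℤ) (N : ℕ) (α : ℤ → ℂ) (αinf : ℂ) (β : ℤ → ℂ) (βinf : ℂ) :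
    Prop :=
  ∀ f : LineModel lam ℓ,
    αinf * f.atInfty + ∑' n : ℤ, α n * f.fourier n =
      βinf * f.inf.atInfty + ∑' n : ℤ, β n * f.inf.fourier ((n : ℝ) / N)

/-- An admissible set `ℙ_N` of primes: odd primes not dividing `N`, meeting every progression
`{a m + b : m ≥ 1}` with `a, b ≥ 1` coprime. -/
def IsAdmissible (N : ℕ) (P : Set ℕ) : Prop :=
  (∀ r ∈ P, r.Prime ∧ Odd r ∧ ¬ r ∣ N) ∧
    ∀ a b : ℕ, 0 < a → 0 < b → Nat.Coprime a b → ∃ m : ℕ, 0 < m ∧ a * m + b ∈ P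

/-- The Gauss sum `τ_ψ(n) = ∑_{m mod r, (m, r) = 1} ψ(m) e^{2πimn/r}`. -/
def gaussTau {r : ℕ} (ψ : DirichletCharacter ℂ r) (n : ℤ) : ℂ :=
  ∑ m ∈ (Finset.range r).filter (fun m => Nat.Coprime m r),
    ψ (m : ZMod r) * exp (2 * Real.pi * I * m * n / r)

/-- The character `ψ*(k) = conj ψ(k) · (k/r) ^ ℓ`. -/
def psiStar {r : ℕ} [Fact r.Prime] (ℓ : ℤ) (ψ : DirichletCharacter ℂ r) : DirichletCharacter ℂ r :=
  star ψ * (quadraticChar (ZMod r)).ringHomComp (Int.castRingHom ℂ) ^ ℓ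

/-- `C_{ℓ,r}`, equal to `1` if `ℓ` is even and to `ε_r ^ ℓ` if `ℓ` is odd. -/
def constC (ℓ : ℤ) (r : ℕ) : ℂ := if Even ℓ then 1 else epsilon r ^ ℓ

/-- The twist by a character `ψ` mod `r` of a summation formula of level `N`. -/
def TwistedSummationFormula (lam : ℂ) (ℓ : ℤ) {N : ℕ} (χ : DirichletCharacter ℂ N) (α : ℤ → ℂ)
    (αinf : ℂ) (β : ℤ → ℂ) (βinf : ℂ) (r : ℕ) [Fact r.Prime] (ψ : DirichletCharacter ℂ r) : Prop :=
  ∀ f : LineModel lam ℓ,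
    αinf * gaussTau ψ 0 * f.atInfty + ∑' n : ℤ, α n * gaussTau ψ n * f.fourier n =
      starRingEnd ℂ (χ (r : ZMod N)) * constC ℓ r * psiStar ℓ ψ (-(N : ZMod r)) *
        ((r : ℂ) ^ (-2 * lam) * (βinf * gaussTau (psiStar ℓ ψ) 0 * f.inf.atInfty) +
          (r : ℂ) ^ (2 * lam - 2) *
            ∑' n : ℤ, β n * gaussTau (psiStar ℓ ψ) n * f.inf.fourier ((n : ℝ) / (N * (r : ℝ) ^ 2)))

end FerrarSuzuki

end

noncomputable section

namespace FerrarSuzuki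

open Complex Filter Topology MeasureTheory
open scoped UpperHalfPlane

/-! ### Square roots near the negative real axis -/

/-! Write `T` for the left side of the summation formula and `S` for the functional with
coefficients `β` and frequencies `n / N`. Since `f_∞ = π(w) f` for the Weyl element `w`, the formula
says `T(f) = S(π(w) f)`. Translation by `t` multiplies `(ℱf)(x)` by `e^{2πitx}` and fixes `f(∞)`, so
`T` is invariant under integral translations and `S` under translations by multiples of `N`.
Conjugation by `w` turns the latter into invariance of `T` under `[(1 0; N 1), 1]`, whence `Δ̃(N)`.
Continuity follows because `(ℱf)(n)` decays faster than any power of `n`, with seminorm control,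
while `α` grows polynomially.

The analytic difficulty is the regularized value `(ℱf)(0)`, which is not an integral in general. The
operator `f ↦ x f' + 2λ f` (`eulerUp`) maps parameters `(λ, ℓ)` to `(λ + 1/2, ℓ + 2)` and multiplies
the regularized integral by `2λ - 1` (`regInt_eulerUp`). The condition on `λ` says that none of the
factors met on repeating this vanishes, so linearity, continuity, translation invariance and scaling
descend from `Re λ > 1/2`, where the integral converges absolutely (`raise_induction`).

For the equivalence, fix `r ∈ ℙ_N`. The twisted left side is `∑ ψ(u) T(π(n(u/r)) f)`. A dilation by
`r` accounts for the powers of `r` on the right, which becomes a sum over `v` with weights `ψ*(v)`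
of `T` at `π(diag(r⁻¹, r) · (1 0; Nv/r 1))⁻¹ f`. Put `v = -(Nu)⁻¹`. Orthogonality of characters mod
`r` separates the formulas for all `ψ` into one relation for each `u ≠ 0`
(`forall_twistedSummationFormula_iff`): `T` is an eigenvector of the element with matrix `((1 +
uNv)/r, u; Nv, r)`. Because `uNv ≡ -1` mod `r`, this matrix lies in `Γ₀(N)`, and the eigenvalue is
the one that automorphy demands, the theta multiplier producing `C_{ℓ,r} (u/r)^ℓ`
(`IsThetaLift.root_zpow`). So (ii) is automorphy under the elements of `Γ̃₀(N)` whose lower right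
entry is a prime of `ℙ_N`.

These suffice (`automorphic_iff_bruhatCover`). If `c ≠ 0`, right multiplication by a translation
replaces `d` by `d + ck`, which can be made a prime of `ℙ_N`; quadratic reciprocity shows that the
theta multiplier does not change. If `c = 0`, the element acts as a translation or, after right
multiplication by `[(1 0; N 1), 1]`, falls under the first case. -/

/-- Here `arg w = arg (-w) + π`, also on the negative axis, where the principal argument is `π`;
halving the angle gives `e^{iπ/2} = i`. -/
theorem cpow_half_eq_I_mul {w : ℂ} (h : 0 < w.im ∨ (w.im = 0 ∧ w.re < 0)) :
    w ^ (1 / 2 : ℂ) = I * (-w) ^ (1 / 2 : ℂ) := by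
  have hw : w ≠ 0 := by rintro rfl; simp at h
  have harg : arg w = arg (-w) + Real.pi := by
    rcases h with h | ⟨h0, h1⟩
    · rw [arg_neg_eq_arg_sub_pi_of_im_pos h]; ring
    · have e : w = ((w.re : ℝ) : ℂ) := by apply Complex.ext <;> simp [h0]
      rw [e, arg_ofReal_of_neg h1, ← ofReal_neg, arg_ofReal_of_nonneg (by linarith)]
      ring
  rw [cpow_def_of_ne_zero hw, cpow_def_of_ne_zero (neg_ne_zero.2 hw)]
  have e : log w * (1 / 2) = log (-w) * (1 / 2) + (Real.pi / 2 : ℝ) * I := by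
    simp only [log, norm_neg, harg]
    push_cast
    ring
  rw [e, Complex.exp_add]
  push_cast
  rw [Complex.exp_pi_div_two_mul_I, mul_comm]

theorem cpow_half_eq_neg_I_mul {w : ℂ} (h : w.im < 0) :
    w ^ (1 / 2 : ℂ) = -I * (-w) ^ (1 / 2 : ℂ) := by
  have h2 := cpow_half_eq_I_mul (w := -w) (Or.inl (by simpa using h))
  rw [h2, neg_neg, ← mul_assoc]
  simp

/-! ### The covering group -/

namespace Cover

theorem root_pow_four (G : Cover) : G.root ^ 4 = 1 := by
  have h := autFactor_ne_zero G.mat UpperHalfPlane.I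
  rw [root, div_pow, G.pow_four, ← cpow_nat_mul]
  norm_num
  exact h

theorem root_ne_zero (G : Cover) : G.root ≠ 0 := by
  intro h
  have := G.root_pow_four
  simp [h] at this

theorem continuous_autFactor_half (g : SL(2, ℝ)) :
    Continuous fun z : ℍ => autFactor g z ^ (1 / 2 : ℂ) := by
  have h := (lift g 1 (one_pow 4)).holo.continuous
  simpa [lift] using h

theorem autFactor_half_ne_zero (g : SL(2, ℝ)) (z : ℍ) : autFactor g z ^ (1 / 2 : ℂ) ≠ 0 := by
  rw [Ne, cpow_eq_zero_iff]
  simp [autFactor_ne_zero]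

/-- The quotient of `φ` by the principal root is continuous with values in the fourth roots of
unity, a finite and hence discrete set; the upper half plane is connected, so the quotient is
constant. -/
theorem fn_eq (G : Cover) (z : ℍ) : G.fn z = G.root * autFactor G.mat z ^ (1 / 2 : ℂ) := by
  set q : ℍ → ℂ := fun z => G.fn z / autFactor G.mat z ^ (1 / 2 : ℂ) with hq
  have hc : Continuous q := G.holo.continuous.div (continuous_autFactor_half G.mat)
    (autFactor_half_ne_zero G.mat)
  have hfin : {w : ℂ | w ^ 4 = 1}.Finite := by
    have : {w : ℂ | w ^ 4 = 1} ⊆ ((Polynomial.nthRoots 4 (1 : ℂ)).toFinset : Set ℂ) := by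
      intro w hw
      simpa [Polynomial.mem_nthRoots] using hw
    exact (Finset.finite_toSet _).subset this
  have hmaps : Set.MapsTo q Set.univ {w : ℂ | w ^ 4 = 1} := by
    intro z _
    have h := autFactor_ne_zero G.mat z
    simp only [hq, Set.mem_ofPred_eq]
    rw [div_pow, G.pow_four, ← cpow_nat_mul]
    norm_num
    exact h
  have hd : IsDiscrete {w : ℂ | w ^ 4 = 1} := hfin.isDiscrete
  have := isPreconnected_univ.constant_of_mapsTo hd hc.continuousOn hmaps
    (Set.mem_univ z) (Set.mem_univ UpperHalfPlane.I)
  have h2 : q z = G.root := this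
  rw [← h2, hq]
  simp only
  rw [div_mul_cancel₀ _ (autFactor_half_ne_zero G.mat z)]

theorem root_eq_of_fn_eq {G : Cover} {ξ : ℂ} {z : ℍ}
    (h : G.fn z = ξ * autFactor G.mat z ^ (1 / 2 : ℂ)) : G.root = ξ := by
  rw [fn_eq] at h
  exact mul_right_cancel₀ (autFactor_half_ne_zero G.mat z) h

theorem root_lift (g : SL(2, ℝ)) (ξ : ℂ) (hξ : ξ ^ 4 = 1) : (lift g ξ hξ).root = ξ :=
  root_eq_of_fn_eq (z := UpperHalfPlane.I) rfl

theorem ext_root {G H : Cover} (h : G.mat = H.mat) (hr : G.root = H.root) : G = H := by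
  ext1
  · exact h
  · funext z
    rw [fn_eq, fn_eq, h, hr]

theorem det_mat (g : SL(2, ℝ)) : g 0 0 * g 1 1 - g 0 1 * g 1 0 = 1 := by
  have := g.2
  rwa [Matrix.det_fin_two] at this

theorem inv_10 (g : SL(2, ℝ)) : g⁻¹ 1 0 = -g 1 0 := by
  rw [Matrix.SpecialLinearGroup.SL2_inv_expl]; rfl
theorem inv_11 (g : SL(2, ℝ)) : g⁻¹ 1 1 = g 0 0 := by
  rw [Matrix.SpecialLinearGroup.SL2_inv_expl]; rfl
theorem inv_00 (g : SL(2, ℝ)) : g⁻¹ 0 0 = g 1 1 := by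
  rw [Matrix.SpecialLinearGroup.SL2_inv_expl]; rfl
theorem inv_01 (g : SL(2, ℝ)) : g⁻¹ 0 1 = -g 0 1 := by
  rw [Matrix.SpecialLinearGroup.SL2_inv_expl]; rfl

theorem mul_entry (g h : SL(2, ℝ)) (i j : Fin 2) :
    (g * h) i j = g i 0 * h 0 j + g i 1 * h 1 j := by
  simp [Matrix.SpecialLinearGroup.coe_mul, Matrix.mul_apply, Fin.sum_univ_two]

theorem autFactor_inv (g : SL(2, ℝ)) (z : ℍ) :
    autFactor g⁻¹ z = -(g 1 0 : ℂ) * z + g 0 0 := by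
  simp [autFactor, inv_10, inv_11]

theorem autFactor_inv_smul (g : SL(2, ℝ)) (z : ℍ) :
    autFactor g (g⁻¹ • z) = (-(g 1 0 : ℂ) * z + g 0 0)⁻¹ := by
  have h := autFactor_mul g g⁻¹ z
  have h1 : autFactor (1 : SL(2, ℝ)) z = 1 := by simp [autFactor]
  rw [mul_inv_cancel, h1, autFactor_inv] at h
  exact eq_inv_of_mul_eq_one_left h.symm

/-- The boundary phase of `[g, ξ]⁻¹` at the real point `x`. -/
def phase (G : Cover) (x : ℝ) : ℂ :=
  if 0 < -G.mat 1 0 * x + G.mat 0 0 then G.root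
  else if 0 ≤ G.mat 1 0 then I * G.root else -I * G.root

/-- The trace on the upper half plane of the neighbourhoods of a real point. -/
def bd (x : ℝ) : Filter ℍ := comap ((↑) : ℍ → ℂ) (𝓝 (x : ℂ))

instance (x : ℝ) : (bd x).NeBot := by
  rw [bd, comap_neBot_iff]
  intro t ht
  obtain ⟨ε, hε, h⟩ := Metric.mem_nhds_iff.1 ht
  refine ⟨⟨(x : ℂ) + ((ε / 2 : ℝ) : ℂ) * I, by simp; linarith⟩, h ?_⟩
  simp only [Metric.mem_ball, dist_eq_norm, add_sub_cancel_left, norm_mul,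
    norm_I, mul_one, norm_real, Real.norm_eq_abs]
  rw [abs_of_pos (by linarith)]
  linarith

theorem tendsto_coe_bd (x : ℝ) : Tendsto ((↑) : ℍ → ℂ) (bd x) (𝓝 (x : ℂ)) := tendsto_comap

theorem tendsto_den (g : SL(2, ℝ)) (x : ℝ) :
    Tendsto (fun z : ℍ => -(g 1 0 : ℂ) * z + g 0 0) (bd x)
      (𝓝 ((-g 1 0 * x + g 0 0 : ℝ) : ℂ)) := by
  push_cast
  exact ((tendsto_coe_bd x).const_mul _).add_const _

theorem coe_inv_smul (g : SL(2, ℝ)) (z : ℍ) :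
    ((g⁻¹ • z : ℍ) : ℂ) = ((g 1 1 : ℂ) * z - g 0 1) / (-(g 1 0 : ℂ) * z + g 0 0) := by
  rw [UpperHalfPlane.coe_specialLinearGroup_apply]
  simp [inv_10, inv_11, inv_00, inv_01, sub_eq_add_neg]

theorem tendsto_inv_smul_bd (g : SL(2, ℝ)) {x : ℝ} (hx : -g 1 0 * x + g 0 0 ≠ 0) :
    Tendsto (fun z : ℍ => g⁻¹ • z) (bd x) (bd ((g 1 1 * x - g 0 1) / (-g 1 0 * x + g 0 0))) := by
  refine tendsto_comap_iff.2 ?_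
  have e : (((↑) : ℍ → ℂ) ∘ fun z : ℍ => g⁻¹ • z) =
      fun z : ℍ => ((g 1 1 : ℂ) * z - g 0 1) / (-(g 1 0 : ℂ) * z + g 0 0) := by
    funext z; exact coe_inv_smul g z
  rw [e]
  rw [ofReal_div]
  refine Tendsto.div ?_ (tendsto_den g x) (by exact_mod_cast hx)
  push_cast
  exact ((tendsto_coe_bd x).const_mul _).sub_const _

/-- This explains the sign cases in the definition of `π`. One has `φ(g⁻¹z) = ξ ((-cz +
a)⁻¹)^{1/2}`. If `-cx + a < 0`, then as `z → x` the base approaches the negative axis from above for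
`c > 0`, lies on it for `c = 0`, and approaches from below for `c < 0`; the principal root then
picks up `i`, `i` and `-i` respectively. -/
theorem tendsto_fn_bd (G : Cover) {x : ℝ} (hx : -G.mat 1 0 * x + G.mat 0 0 ≠ 0) :
    Tendsto (fun z : ℍ => G.fn (G.mat⁻¹ • z)) (bd x)
      (𝓝 (G.phase x * ((|-G.mat 1 0 * x + G.mat 0 0|⁻¹ : ℝ) : ℂ) ^ (1 / 2 : ℂ))) := by
  set r := -G.mat 1 0 * x + G.mat 0 0 with hr
  have hw : Tendsto (fun z : ℍ => (-(G.mat 1 0 : ℂ) * z + G.mat 0 0)⁻¹) (bd x)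
      (𝓝 (((r⁻¹ : ℝ)) : ℂ)) := by
    rw [ofReal_inv]
    exact (tendsto_den G.mat x).inv₀ (by exact_mod_cast hx)
  have hpow : ∀ {u : ℍ → ℂ} {t : ℝ}, 0 < t → Tendsto u (bd x) (𝓝 (t : ℂ)) →
      Tendsto (fun z => u z ^ (1 / 2 : ℂ)) (bd x) (𝓝 ((t : ℂ) ^ (1 / 2 : ℂ))) := by
    intro u t ht hu
    have : ContinuousAt (fun w : ℂ => w ^ (1 / 2 : ℂ)) (t : ℂ) :=
      continuousAt_cpow_const (Or.inl (by simpa using ht))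
    exact this.tendsto.comp hu
  rcases lt_or_gt_of_ne hx with h | h
  · have h1 := hpow (by rw [inv_pos, abs_pos]; exact hx : 0 < |r|⁻¹) (u := fun z : ℍ =>
      -(-(G.mat 1 0 : ℂ) * z + G.mat 0 0)⁻¹) (by
        have : |r|⁻¹ = -r⁻¹ := by rw [abs_of_neg h, inv_neg]
        rw [this, ofReal_neg]; exact hw.neg)
    have him : ∀ z : ℍ, ((-(G.mat 1 0 : ℂ) * z + G.mat 0 0)⁻¹).im =
        G.mat 1 0 * z.im / normSq (-(G.mat 1 0 : ℂ) * z + G.mat 0 0) := by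
      intro z; simp [inv_im]
    have hns : ∀ z : ℍ, 0 < normSq (-(G.mat 1 0 : ℂ) * z + G.mat 0 0) := by
      intro z
      rw [Complex.normSq_pos, ← autFactor_inv]
      exact autFactor_ne_zero _ _
    have hph : G.phase x = if 0 ≤ G.mat 1 0 then I * G.root else -I * G.root := by
      rw [phase, if_neg h.not_gt]
    rw [hph]
    split_ifs with hc
    · refine (h1.const_mul (I * G.root)).congr fun z => ?_
      rw [fn_eq, autFactor_inv_smul, cpow_half_eq_I_mul (w := (-(G.mat 1 0 : ℂ) * z + G.mat 0 0)⁻¹)]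
      · ring
      · rcases hc.eq_or_lt with h0 | h0
        · right
          rw [him, ← h0]
          have : G.mat 0 0 < 0 := by rw [hr, ← h0] at h; simpa using h
          refine ⟨by simp, ?_⟩
          simpa using inv_lt_zero.2 this
        · left
          rw [him]
          exact div_pos (mul_pos h0 z.im_pos) (hns z)
    · refine (h1.const_mul (-I * G.root)).congr fun z => ?_
      rw [fn_eq, autFactor_inv_smul,
        cpow_half_eq_neg_I_mul (w := (-(G.mat 1 0 : ℂ) * z + G.mat 0 0)⁻¹)]
      · ring
      · rw [him]
        exact div_neg_of_neg_of_pos (mul_neg_of_neg_of_pos (not_le.1 hc) z.im_pos) (hns z)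
  · have h1 := hpow (inv_pos.2 h) hw
    rw [abs_of_pos h, phase, if_pos h]
    refine (h1.const_mul G.root).congr fun z => ?_
    rw [fn_eq, autFactor_inv_smul]

theorem den_mul (g h : SL(2, ℝ)) {x : ℝ} (hx : -g 1 0 * x + g 0 0 ≠ 0) :
    -(g * h) 1 0 * x + (g * h) 0 0 = (-g 1 0 * x + g 0 0) *
      (-h 1 0 * ((g 1 1 * x - g 0 1) / (-g 1 0 * x + g 0 0)) + h 0 0) := by
  rw [mul_add, mul_left_comm, mul_div_cancel₀ _ hx]
  simp only [mul_entry]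
  ring

/-- The product rule for the functions `φ`, evaluated at inverse images of `z`, passes to the limit
`z → x`. Absolute values are multiplicative and cancel, so the cocycle identity for the phases needs
no case distinction on signs. -/
theorem phase_mul (G H : Cover) {x : ℝ} (hx : -G.mat 1 0 * x + G.mat 0 0 ≠ 0)
    (hy : -H.mat 1 0 * ((G.mat 1 1 * x - G.mat 0 1) / (-G.mat 1 0 * x + G.mat 0 0)) + H.mat 0 0 ≠ 0) :
    (G * H).phase x =
      G.phase x * H.phase ((G.mat 1 1 * x - G.mat 0 1) / (-G.mat 1 0 * x + G.mat 0 0)) := by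
  set y := (G.mat 1 1 * x - G.mat 0 1) / (-G.mat 1 0 * x + G.mat 0 0) with hyd
  have hxy := den_mul G.mat H.mat hx
  rw [← hyd, ← mul_mat] at hxy
  have hne : -(G * H).mat 1 0 * x + (G * H).mat 0 0 ≠ 0 := by
    rw [hxy]; exact mul_ne_zero hx hy
  have h1 := tendsto_fn_bd (G * H) hne
  have h2 := (tendsto_fn_bd G hx).mul ((tendsto_fn_bd H hy).comp (tendsto_inv_smul_bd G.mat hx))
  have h3 := tendsto_nhds_unique h1 (h2.congr fun z => by simp [mul_smul])
  rw [hxy, abs_mul, mul_inv, ofReal_mul, mul_cpow_ofReal_nonneg (by positivity) (by positivity)] at h3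
  have e1 : ((|-G.mat 1 0 * x + G.mat 0 0|⁻¹ : ℝ) : ℂ) ^ (1 / 2 : ℂ) ≠ 0 := by
    rw [← abs_inv]; exact abs_cpow_ne_zero (inv_ne_zero hx) _
  have e2 : ((|-H.mat 1 0 * y + H.mat 0 0|⁻¹ : ℝ) : ℂ) ^ (1 / 2 : ℂ) ≠ 0 := by
    rw [← abs_inv]; exact abs_cpow_ne_zero (inv_ne_zero hy) _
  refine mul_right_cancel₀ (mul_ne_zero e1 e2) ?_
  rw [h3]; ring

end Cover

@[simp] theorem upperUnip_mat_zero_zero (t : ℝ) : (upperUnip t).mat 0 0 = 1 := rfl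
@[simp] theorem upperUnip_mat_zero_one (t : ℝ) : (upperUnip t).mat 0 1 = t := rfl
@[simp] theorem upperUnip_mat_one_zero (t : ℝ) : (upperUnip t).mat 1 0 = 0 := rfl
@[simp] theorem upperUnip_mat_one_one (t : ℝ) : (upperUnip t).mat 1 1 = 1 := rfl
@[simp] theorem upperUnip_root (t : ℝ) : (upperUnip t).root = 1 := Cover.root_lift _ _ _
@[simp] theorem lowerUnip_mat_zero_zero (t : ℝ) : (lowerUnip t).mat 0 0 = 1 := rfl
@[simp] theorem lowerUnip_mat_zero_one (t : ℝ) : (lowerUnip t).mat 0 1 = 0 := rfl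
@[simp] theorem lowerUnip_mat_one_zero (t : ℝ) : (lowerUnip t).mat 1 0 = t := rfl
@[simp] theorem lowerUnip_mat_one_one (t : ℝ) : (lowerUnip t).mat 1 1 = 1 := rfl
@[simp] theorem lowerUnip_root (t : ℝ) : (lowerUnip t).root = 1 := Cover.root_lift _ _ _

/-- The diagonal element `[diag(t⁻¹, t), 1]`. -/
def diagCover (t : ℝ) (ht : 0 < t) : Cover :=
  Cover.lift ⟨!![t⁻¹, 0; 0, t], by simp [Matrix.det_fin_two, ht.ne']⟩ 1 (one_pow 4)

@[simp] theorem diagCover_mat_zero_zero (t : ℝ) (ht : 0 < t) : (diagCover t ht).mat 0 0 = t⁻¹ := rfl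
@[simp] theorem diagCover_mat_zero_one (t : ℝ) (ht : 0 < t) : (diagCover t ht).mat 0 1 = 0 := rfl
@[simp] theorem diagCover_mat_one_zero (t : ℝ) (ht : 0 < t) : (diagCover t ht).mat 1 0 = 0 := rfl
@[simp] theorem diagCover_mat_one_one (t : ℝ) (ht : 0 < t) : (diagCover t ht).mat 1 1 = t := rfl
@[simp] theorem diagCover_root (t : ℝ) (ht : 0 < t) : (diagCover t ht).root = 1 :=
  Cover.root_lift _ _ _

/-- The Weyl element `[(0 1; -1 0), 1]`. -/
def weyl : Cover := Cover.lift ⟨!![0, 1; -1, 0], by simp [Matrix.det_fin_two]⟩ 1 (one_pow 4)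

@[simp] theorem weyl_mat_zero_zero : weyl.mat 0 0 = 0 := rfl
@[simp] theorem weyl_mat_zero_one : weyl.mat 0 1 = 1 := rfl
@[simp] theorem weyl_mat_one_zero : weyl.mat 1 0 = -1 := rfl
@[simp] theorem weyl_mat_one_one : weyl.mat 1 1 = 0 := rfl
@[simp] theorem weyl_root : weyl.root = 1 := Cover.root_lift _ _ _

/-! ### The principal series representation -/

namespace LineModel

variable {lam : ℂ} {ℓ : ℤ}

theorem act_apply (G : Cover) (f : LineModel lam ℓ) {x : ℝ} (hx : -G.mat 1 0 * x + G.mat 0 0 ≠ 0) :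
    act G f x = ((|-G.mat 1 0 * x + G.mat 0 0| : ℝ) : ℂ) ^ (-2 * lam) *
      f ((G.mat 1 1 * x - G.mat 0 1) / (-G.mat 1 0 * x + G.mat 0 0)) * G.phase x ^ (-ℓ) := by
  change actFun G f x = _
  simp only [actFun, if_neg hx, Cover.phase]
  split_ifs <;> rfl

theorem continuous (f : LineModel lam ℓ) : Continuous f := f.contDiff.continuous

theorem ext_of_finite {f g : LineModel lam ℓ} {s : Set ℝ} (hs : s.Finite)
    (h : ∀ x, x ∉ s → f x = g x) : f = g := by
  refine DFunLike.coe_injective (Continuous.ext_on (hs.countable.dense_compl ℝ) f.continuous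
    g.continuous fun x hx => h x hx)

theorem finite_den (g : SL(2, ℝ)) : {x : ℝ | -g 1 0 * x + g 0 0 = 0}.Finite := by
  refine Set.Subsingleton.finite fun x hx y hy => ?_
  simp only [Set.mem_ofPred_eq] at hx hy
  have hd := Cover.det_mat g
  have hc : g 1 0 ≠ 0 := by
    intro h0
    have h1 : g 0 0 = 0 := by simpa [h0] using hx
    simp [h0, h1] at hd
  exact mul_left_cancel₀ hc (by linarith)

/-- Off the finitely many poles this is the cocycle property of `phase` together with
multiplicativity of the denominators. At the poles it follows by continuity, so the branch of
`actFun` using `f(∞)` never has to be computed. -/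
theorem act_mul (G H : Cover) (f : LineModel lam ℓ) : act (G * H) f = act G (act H f) := by
  refine ext_of_finite ((finite_den G.mat).union (finite_den (G * H).mat)) fun x hx => ?_
  simp only [Set.mem_union, Set.mem_ofPred_eq, not_or] at hx
  obtain ⟨hx, hxy⟩ := hx
  have e := Cover.den_mul G.mat H.mat hx
  have hy : -H.mat 1 0 * ((G.mat 1 1 * x - G.mat 0 1) / (-G.mat 1 0 * x + G.mat 0 0)) +
      H.mat 0 0 ≠ 0 := by
    intro h0
    rw [h0, mul_zero] at e
    exact hxy e
  rw [act_apply _ _ hxy, act_apply _ _ hx, act_apply _ _ hy, Cover.phase_mul G H hx hy]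
  rw [Cover.mul_mat, e, ofReal_abs_cpow_mul, mul_zpow]
  have e2 : ((G.mat * H.mat) 1 1 * x - (G.mat * H.mat) 0 1) /
      ((-G.mat 1 0 * x + G.mat 0 0) * (-H.mat 1 0 *
        ((G.mat 1 1 * x - G.mat 0 1) / (-G.mat 1 0 * x + G.mat 0 0)) + H.mat 0 0)) =
      (H.mat 1 1 * ((G.mat 1 1 * x - G.mat 0 1) / (-G.mat 1 0 * x + G.mat 0 0)) - H.mat 0 1) /
      (-H.mat 1 0 * ((G.mat 1 1 * x - G.mat 0 1) / (-G.mat 1 0 * x + G.mat 0 0)) + H.mat 0 0) := by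
    rw [← div_div]
    congr 1
    rw [div_eq_iff hx, sub_mul, mul_assoc, div_mul_cancel₀ _ hx]
    simp only [Cover.mul_entry]
    ring
  rw [e2]
  ring

theorem act_of_mat_one {G : Cover} (h : G.mat = 1) (f : LineModel lam ℓ) :
    act G f = G.root ^ (-ℓ) • f := by
  refine DFunLike.ext _ _ fun x => ?_
  have hx : -G.mat 1 0 * x + G.mat 0 0 ≠ 0 := by simp [h]
  rw [act_apply _ _ hx]
  simp [h, Cover.phase, mul_comm]

theorem root_one : (1 : Cover).root = 1 :=
  Cover.root_eq_of_fn_eq (z := UpperHalfPlane.I) (by simp [autFactor])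

theorem act_one (f : LineModel lam ℓ) : act 1 f = f := by
  rw [act_of_mat_one rfl, root_one]; simp

theorem act_act_inv (G : Cover) (f : LineModel lam ℓ) : act G (act G⁻¹ f) = f := by
  rw [← act_mul, mul_inv_cancel, act_one]

theorem act_inv_act (G : Cover) (f : LineModel lam ℓ) : act G⁻¹ (act G f) = f := by
  rw [← act_mul, inv_mul_cancel, act_one]

theorem act_upperUnip (t : ℝ) (f : LineModel lam ℓ) (x : ℝ) :
    act (upperUnip t) f x = f (x - t) := by
  have hx : -(upperUnip t).mat 1 0 * x + (upperUnip t).mat 0 0 ≠ 0 := by simp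
  rw [act_apply _ _ hx]
  simp [Cover.phase]

theorem act_diagCover (t : ℝ) (ht : 0 < t) (f : LineModel lam ℓ) (x : ℝ) :
    act (diagCover t ht) f x = (t : ℂ) ^ (2 * lam) * f (t ^ 2 * x) := by
  have hx : -(diagCover t ht).mat 1 0 * x + (diagCover t ht).mat 0 0 ≠ 0 := by
    simp [ht.ne']
  rw [act_apply _ _ hx]
  have h1 : (diagCover t ht).phase x = 1 := by
    simp [Cover.phase, ht]
  have h2 : ((|t⁻¹| : ℝ) : ℂ) ^ (-2 * lam) = (t : ℂ) ^ (2 * lam) := by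
    rw [ofReal_abs_cpow_inv, neg_mul, cpow_neg, inv_inv, abs_of_pos ht]
  rw [h1]
  simp only [diagCover_mat_zero_zero, diagCover_mat_zero_one, diagCover_mat_one_zero,
    diagCover_mat_one_one, neg_zero, zero_mul, zero_add, sub_zero, one_zpow, mul_one]
  rw [h2]
  congr 2
  field_simp

theorem inf_apply (f : LineModel lam ℓ) {x : ℝ} (hx : x ≠ 0) :
    f.inf x = sgnPow ℓ x * ((|x| : ℝ) : ℂ) ^ (-2 * lam) * f (-1 / x) := f.infFun_eq hx

/-- Makes the summation formula a relation between two functionals linked by a group element. -/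
theorem act_weyl (f : LineModel lam ℓ) : act weyl f = f.inf := by
  refine ext_of_finite (Set.finite_singleton 0) fun x hx => ?_
  have hx : x ≠ 0 := by simpa using hx
  have hx' : -weyl.mat 1 0 * x + weyl.mat 0 0 ≠ 0 := by simp [hx]
  rw [act_apply _ _ hx', inf_apply f hx]
  have h1 : weyl.phase x ^ (-ℓ) = sgnPow ℓ x := by
    have : (-1 : ℝ) < 0 := by norm_num
    have h3 : (-I : ℂ) = I⁻¹ := by simp
    simp only [Cover.phase, weyl_mat_one_zero, weyl_mat_zero_zero, weyl_root, sgnPow]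
    by_cases h0 : 0 < x
    · simp [h0]
    · rw [if_neg (by simpa using h0), if_neg this.not_ge, if_neg h0, h3]
      simp [-inv_I]
  rw [h1]
  simp only [weyl_mat_zero_zero, weyl_mat_zero_one, weyl_mat_one_zero, weyl_mat_one_one]
  simp only [neg_neg, one_mul, add_zero, zero_mul, zero_sub]
  ring

/-- The left side is the value at `0` of the action of `weyl * upperUnip t`. The denominator of this
element vanishes there, so the branch of `actFun` at a pole applies; with `c = -1` and root `1` it
returns `f(∞)`. -/
theorem atInfty_upperUnip (t : ℝ) (f : LineModel lam ℓ) :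
    (act (upperUnip t) f).atInfty = f.atInfty := by
  have e : (act (upperUnip t) f).inf = act (weyl * upperUnip t) f := by
    rw [act_mul, act_weyl]
  rw [atInfty, e]
  change actFun _ f 0 = _
  have h0 : -(weyl * upperUnip t).mat 1 0 * 0 + (weyl * upperUnip t).mat 0 0 = 0 := by
    simp [Cover.mul_entry, -Matrix.SpecialLinearGroup.coe_mul]
  have h1 : (weyl * upperUnip t).mat 1 0 = -1 := by
    simp [Cover.mul_entry, -Matrix.SpecialLinearGroup.coe_mul]
  have h2 : (weyl * upperUnip t).root = 1 := by
    refine Cover.root_eq_of_fn_eq (z := UpperHalfPlane.I) ?_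
    rw [Cover.mul_fn, Cover.fn_eq, Cover.fn_eq, Cover.mul_mat, autFactor_mul]
    have h3 : autFactor (upperUnip t).mat UpperHalfPlane.I = 1 := by simp [autFactor]
    rw [h3]
    simp
  simp only [actFun]
  rw [if_pos h0, h1, h2]
  simp

theorem atInfty_diagCover (t : ℝ) (ht : 0 < t) (f : LineModel lam ℓ) :
    (act (diagCover t ht) f).atInfty = (t : ℂ) ^ (-2 * lam) * f.atInfty := by
  have key : (act (diagCover t ht) f).infFun =
      fun x => (t : ℂ) ^ (-2 * lam) * f.inf (x / t ^ 2) := by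
    refine infFun_unique _ (continuous_const.mul (f.inf.continuous.comp
      (continuous_id.div_const _))) fun x hx => ?_
    have h1 : x / t ^ 2 ≠ 0 := by positivity
    rw [inf_apply _ h1]
    simp only [rawInf]
    rw [act_diagCover]
    have e1 : sgnPow ℓ (x / t ^ 2) = sgnPow ℓ x := by
      have : 0 < x / t ^ 2 ↔ 0 < x := by
        rw [div_pos_iff_of_pos_right (by positivity)]
      simp only [sgnPow, this]
    have e2 : t ^ 2 * (-1 / x) = -1 / (x / t ^ 2) := by field_simp
    have e3 : ((|x / t ^ 2| : ℝ) : ℂ) ^ (-2 * lam) =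
        ((|x| : ℝ) : ℂ) ^ (-2 * lam) * ((t : ℂ) ^ (2 * lam)) ^ 2 := by
      rw [div_eq_mul_inv, ofReal_abs_cpow_mul, ofReal_abs_cpow_inv]
      congr 1
      rw [sq t, ofReal_abs_cpow_mul, abs_of_pos ht, neg_mul, cpow_neg]
      field_simp
    have e4 : (t : ℂ) ^ (-2 * lam) * ((t : ℂ) ^ (2 * lam)) ^ 2 = (t : ℂ) ^ (2 * lam) := by
      have : (t : ℂ) ^ (2 * lam) ≠ 0 := by
        have := abs_cpow_ne_zero ht.ne' (2 * lam)
        rwa [abs_of_pos ht] at this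
      rw [neg_mul, cpow_neg]
      field_simp
    rw [e1, e2, e3]
    linear_combination ((sgnPow ℓ x * ((|x| : ℝ) : ℂ) ^ (-2 * lam) * f (-1 / (x / t ^ 2)))) * e4
  change (act (diagCover t ht) f).infFun 0 = _
  rw [key]
  simp [atInfty]

theorem atInfty_add (f g : LineModel lam ℓ) : (f + g).atInfty = f.atInfty + g.atInfty := by
  change (f + g).infFun 0 = _
  rw [infFun_add]; rfl

theorem atInfty_smul (c : ℂ) (f : LineModel lam ℓ) : (c • f).atInfty = c * f.atInfty := by
  change (c • f).infFun 0 = _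
  rw [infFun_smul]; rfl

end LineModel

/-! ### Decay of derivatives in terms of the seminorms. -/

/-- Leibniz rule; the coefficients of `D_λ` have degree at most two, so three terms survive. The
truncated index `j - 1` at `j = 0` is harmless because of the factor `j`. -/
theorem iteratedDeriv_diffFun (lam : ℂ) {f : ℝ → ℂ} (hf : ContDiff ℝ ∞ f) (j : ℕ) (x : ℝ) :
    iteratedDeriv j (diffFun lam f) x = (1 + (x : ℂ) ^ 2) * iteratedDeriv (j + 1) f x +
      2 * (j + lam) * x * iteratedDeriv j f x +
      j * (j - 1 + 2 * lam) * iteratedDeriv (j - 1) f x := by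
  induction j generalizing x with
  | zero => simp [diffFun, iteratedDeriv_one]
  | succ j ih =>
    have hd : ∀ k, HasDerivAt (iteratedDeriv k f) (iteratedDeriv (k + 1) f x) x := by
      intro k
      rw [iteratedDeriv_succ]
      exact ((hf.differentiable_iteratedDeriv k (by exact_mod_cast ENat.natCast_lt_top k)) x).hasDerivAt
    rw [iteratedDeriv_succ, show iteratedDeriv j (diffFun lam f) = _ from funext ih]
    have hx : HasDerivAt (fun y : ℝ => (y : ℂ)) 1 x := ofRealCLM.hasDerivAt
    have h1 : HasDerivAt (fun y : ℝ => 1 + (y : ℂ) ^ 2) (2 * (x : ℂ)) x := by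
      simpa using (hx.pow 2).const_add (1 : ℂ)
    have h3 : HasDerivAt (fun y : ℝ => (j : ℂ) * (j - 1 + 2 * lam) * iteratedDeriv (j - 1) f y)
        ((j : ℂ) * (j - 1 + 2 * lam) * iteratedDeriv j f x) x := by
      rcases Nat.eq_zero_or_pos j with rfl | hj
      · simpa using hasDerivAt_const x (0 : ℂ)
      · have := (hd (j - 1)).const_mul ((j : ℂ) * (j - 1 + 2 * lam))
        rwa [Nat.sub_add_cancel hj] at this
    have h := ((h1.mul (hd (j + 1))).add ((hx.const_mul (2 * ((j : ℂ) + lam))).mul (hd j))).add h3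
    refine Eq.trans (HasDerivAt.deriv (h.congr_of_eventuallyEq
      (Eventually.of_forall fun y => ?_))) ?_
    · simp
    · simp only [Nat.add_sub_cancel]
      push_cast
      ring

namespace LineModel

variable {lam : ℂ} {ℓ : ℤ}

theorem le_nu {n j : ℕ} (hj : j ≤ n) (f : LineModel lam ℓ) (x : ℝ) :
    (1 + x ^ 2) ^ lam.re * ‖(diff ^ j) f x‖ ≤ nu n f := by
  refine le_trans ?_ (le_ciSup (bddAbove_nuTerm n f) x)
  rw [nuTerm]
  refine mul_le_mul_of_nonneg_left ?_ (by positivity)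
  exact Finset.single_le_sum (f := fun j => ‖(diff ^ j) f x‖) (fun _ _ => norm_nonneg _)
    (Finset.mem_range.2 (by omega))

theorem nu_le_of_forall (n : ℕ) (f : LineModel lam ℓ) {C : ℝ}
    (h : ∀ j ≤ n, ∀ x : ℝ, (1 + x ^ 2) ^ lam.re * ‖(diff ^ j) f x‖ ≤ C) :
    nu n f ≤ (n + 1) * C := by
  refine ciSup_le fun x => ?_
  rw [nuTerm, Finset.mul_sum]
  refine (Finset.sum_le_card_nsmul _ _ C fun j hj => h j ?_ x).trans ?_
  · have := Finset.mem_range.1 hj; omega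
  · simp

theorem nu_mono {m n : ℕ} (h : m ≤ n) (f : LineModel lam ℓ) : nu m f ≤ nu n f := by
  refine ciSup_le fun x => le_trans ?_ (le_ciSup (bddAbove_nuTerm n f) x)
  refine mul_le_mul_of_nonneg_left ?_ (by positivity)
  refine Finset.sum_le_sum_of_subset_of_nonneg ?_ fun _ _ _ => norm_nonneg _
  exact Finset.range_mono (by omega)

theorem nu_diff_le (n : ℕ) (f : LineModel lam ℓ) : nu n (diff f) ≤ nu (n + 1) f := by
  refine ciSup_le fun x => le_trans ?_ (le_ciSup (bddAbove_nuTerm (n + 1) f) x)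
  refine mul_le_mul_of_nonneg_left ?_ (by positivity)
  rw [Finset.sum_range_succ' _ (n + 1)]
  simp only [pow_succ, Module.End.mul_apply]
  exact le_add_of_nonneg_right (norm_nonneg _)

theorem nu_nonneg (n : ℕ) (f : LineModel lam ℓ) : 0 ≤ nu n f := apply_nonneg _ _

/-- Each derivative gains a factor `(1 + x²)^{-1/2}`. Solve the Leibniz formula for `(1 + x²)
f^{(j+1)}`: the term `(D_λ f)^{(j)}` is handled by induction applied to `D_λ f`, the factor `x` of
`f^{(j)}` costs at most `(1 + x²)^{1/2}`, and `f^{(j-1)}` has a bound of lower weight, which is why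
the induction is strong. -/
theorem norm_iteratedDeriv_le (lam : ℂ) (ℓ : ℤ) (j : ℕ) : ∃ C : ℝ, 0 ≤ C ∧
    ∀ (f : LineModel lam ℓ) (x : ℝ),
      (1 + x ^ 2) ^ (lam.re + j / 2) * ‖iteratedDeriv j f x‖ ≤ C * nu j f := by
  induction j using Nat.strong_induction_on with
  | _ j ih =>
  rcases j with _ | j
  · refine ⟨1, zero_le_one, fun f x => ?_⟩
    simpa using le_nu (le_refl 0) f x
  obtain ⟨C0, hC0, h0⟩ := ih j (by omega)
  obtain ⟨C1, hC1, h1⟩ := ih (j - 1) (by omega)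
  set A : ℝ := ‖2 * ((j : ℂ) + lam)‖
  set B : ℝ := ‖(j : ℂ) * (j - 1 + 2 * lam)‖
  have hA : 0 ≤ A := norm_nonneg _
  have hB : 0 ≤ B := norm_nonneg _
  refine ⟨C0 + A * C0 + B * C1, by positivity, fun f x => ?_⟩
  have hw : 0 < 1 + x ^ 2 := by positivity
  have hw1 : 1 ≤ 1 + x ^ 2 := by nlinarith [sq_nonneg x]
  have key := iteratedDeriv_diffFun lam f.contDiff j x
  set W : ℝ := (1 + x ^ 2) ^ (lam.re + j / 2) with hW
  have hWpos : 0 < W := by positivity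
  have hsq : (1 + x ^ 2 : ℝ) ^ (-(1 / 2) : ℝ) ≤ 1 :=
    Real.rpow_le_one_of_one_le_of_nonpos hw1 (by norm_num)
  have hx : (1 + x ^ 2 : ℝ) ^ (-(1 / 2) : ℝ) * |x| ≤ 1 := by
    rw [Real.rpow_neg hw.le, ← Real.sqrt_eq_rpow, inv_mul_le_one₀ (Real.sqrt_pos.2 hw)]
    exact Real.abs_le_sqrt (by linarith)
  -- The increase of the exponent by `1/2` is written as `-1/2 + 1`: the full power multiplies
  -- `f^{(j+1)}` as in the Leibniz formula, and the power `-1/2` absorbs `|x|`.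
  have hsplit : (1 + x ^ 2) ^ (lam.re + ((j + 1 : ℕ) : ℝ) / 2) =
      W * (1 + x ^ 2) ^ (-(1 / 2) : ℝ) * (1 + x ^ 2) := by
    rw [hW, ← Real.rpow_add hw, ← Real.rpow_add_one hw.ne']
    congr 1
    push_cast
    ring
  have hd : ‖iteratedDeriv j (diffFun lam f) x‖ * W ≤ C0 * nu (j + 1) f := by
    rw [mul_comm]
    exact (h0 (diff f) x).trans (mul_le_mul_of_nonneg_left (nu_diff_le j f) hC0)
  have he : W * ‖iteratedDeriv j f x‖ ≤ C0 * nu (j + 1) f :=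
    (h0 f x).trans (mul_le_mul_of_nonneg_left (nu_mono (by omega) f) hC0)
  have hg : B * (W * (1 + x ^ 2) ^ (-(1 / 2) : ℝ) * ‖iteratedDeriv (j - 1) f x‖) ≤
      B * (C1 * nu (j + 1) f) := by
    rcases Nat.eq_zero_or_pos j with rfl | hj
    · simp [B]
    · refine mul_le_mul_of_nonneg_left ?_ hB
      refine le_trans (le_of_eq ?_) ((h1 f x).trans
        (mul_le_mul_of_nonneg_left (nu_mono (by omega) f) hC1))
      rw [hW, ← Real.rpow_add hw]
      congr 2
      rw [Nat.cast_sub hj]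
      push_cast
      ring
  have e : (1 + x ^ 2) * ‖iteratedDeriv (j + 1) f x‖ ≤ ‖iteratedDeriv j (diffFun lam f) x‖ +
      A * |x| * ‖iteratedDeriv j f x‖ + B * ‖iteratedDeriv (j - 1) f x‖ := by
    have e1 : (1 + (x : ℂ) ^ 2) * iteratedDeriv (j + 1) f x =
        iteratedDeriv j (diffFun lam f) x - 2 * (j + lam) * x * iteratedDeriv j f x -
          j * (j - 1 + 2 * lam) * iteratedDeriv (j - 1) f x := by rw [key]; ring
    have e2 : (1 + x ^ 2) = ‖(1 + (x : ℂ) ^ 2)‖ := by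
      rw [← ofReal_pow, ← ofReal_one, ← ofReal_add, norm_real, Real.norm_of_nonneg hw.le]
    rw [e2, ← norm_mul, e1]
    refine (norm_sub_le _ _).trans (add_le_add ((norm_sub_le _ _).trans (le_of_eq ?_)) (le_of_eq ?_))
    · simp only [norm_mul, norm_real, Real.norm_eq_abs, A]
    · simp only [norm_mul, B]
  set s : ℝ := (1 + x ^ 2) ^ (-(1 / 2) : ℝ) with hs
  have hs0 : 0 < s := by positivity
  calc (1 + x ^ 2) ^ (lam.re + ((j + 1 : ℕ) : ℝ) / 2) * ‖iteratedDeriv (j + 1) f x‖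
      = W * s * ((1 + x ^ 2) * ‖iteratedDeriv (j + 1) f x‖) := by rw [hsplit]; ring
    _ ≤ W * s * (‖iteratedDeriv j (diffFun lam f) x‖ +
      A * |x| * ‖iteratedDeriv j f x‖ + B * ‖iteratedDeriv (j - 1) f x‖) :=
        mul_le_mul_of_nonneg_left e (by positivity)
    _ = s * (‖iteratedDeriv j (diffFun lam f) x‖ * W) +
      A * (s * |x|) * (W * ‖iteratedDeriv j f x‖) +
      B * (W * s * ‖iteratedDeriv (j - 1) f x‖) := by ring
    _ ≤ 1 * (C0 * nu (j + 1) f) + A * 1 * (C0 * nu (j + 1) f) + B * (C1 * nu (j + 1) f) := by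
        have := nu_nonneg (j + 1) f
        gcongr
    _ = (C0 + A * C0 + B * C1) * nu (j + 1) f := by ring

theorem withSeminorms : WithSeminorms (fun n : ℕ => nu (lam := lam) (ℓ := ℓ) n) := ⟨rfl⟩

theorem continuous_of_bound (L : LineModel lam ℓ →ₗ[ℂ] ℂ) (M : ℕ) (C : ℝ)
    (h : ∀ f, ‖L f‖ ≤ C * nu M f) : Continuous L := by
  refine (withSeminorms (lam := lam) (ℓ := ℓ)).continuous_normedSpace_rng (𝕝 := ℂ) (𝕝₂ := ℂ) ℂ L
    ⟨{M}, Real.toNNReal C, fun f => ?_⟩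
  refine (h f).trans ?_
  simp only [Finset.sup_singleton]
  exact mul_le_mul_of_nonneg_right (Real.le_coe_toNNReal C) (nu_nonneg M f)

end LineModel

/-! ### The regularized Mellin integral near `0` -/

/-- The remainder of the Taylor expansion at `0` with `n` terms. -/
def taylorRem (G : ℝ → ℂ) (n : ℕ) (x : ℝ) : ℂ :=
  G x - ∑ k ∈ Finset.range n, iteratedDeriv k G 0 / (k.factorial : ℂ) * (x : ℂ) ^ k

theorem zetaNear_one (G : ℝ → ℂ) (n : ℕ) (s : ℂ) :
    zetaNear G 1 n s =
      (∑ k ∈ Finset.range n, iteratedDeriv k G 0 / (k.factorial : ℂ) * (1 / (s + k))) +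
        ∫ x in (0 : ℝ)..1, (x : ℂ) ^ (s - 1) * taylorRem G n x := by
  simp [zetaNear, taylorRem]

/-- Moves the sign `ε` into the function, so that only `ε = 1` has to be studied. -/
theorem zetaNear_eq_comp {g : ℝ → ℂ} (hg : ContDiff ℝ ∞ g) (ε : ℝ) (n : ℕ) (s : ℂ) :
    zetaNear g ε n s = zetaNear (fun x => g (ε * x)) 1 n s := by
  have e : ∀ k, iteratedDeriv k (fun x => g (ε * x)) 0 = (ε : ℂ) ^ k * iteratedDeriv k g 0 := by
    intro k
    have := congrFun (iteratedDeriv_comp_const_smul (n := k)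
      (hg.of_le (by exact_mod_cast le_top)) ε) 0
    simpa using this
  simp [zetaNear, e]

/-- Differentiation shifts the Taylor coefficients. Both the bound of order `x ^ n` and the
integration by parts rest on this. -/
theorem hasDerivAt_taylorRem {G : ℝ → ℂ} (hG : ContDiff ℝ ∞ G) (n : ℕ) (x : ℝ) :
    HasDerivAt (taylorRem G (n + 1)) (taylorRem (deriv G) n x) x := by
  have h1 : HasDerivAt G (deriv G x) x := (hG.differentiable (by simp) x).hasDerivAt
  have hx : HasDerivAt (fun y : ℝ => (y : ℂ)) 1 x := ofRealCLM.hasDerivAt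
  have h2 : HasDerivAt (fun y : ℝ => ∑ k ∈ Finset.range (n + 1),
      iteratedDeriv k G 0 / (k.factorial : ℂ) * (y : ℂ) ^ k)
      (∑ k ∈ Finset.range (n + 1), iteratedDeriv k G 0 / (k.factorial : ℂ) *
        (k * (x : ℂ) ^ (k - 1))) x := by
    refine HasDerivAt.fun_sum fun k _ => ?_
    have := (hx.pow k).const_mul (iteratedDeriv k G 0 / (k.factorial : ℂ))
    simpa using this
  have h3 := h1.sub h2
  refine h3.congr_deriv ?_
  rw [taylorRem, Finset.sum_range_succ']
  simp only [Nat.cast_zero, zero_mul, mul_zero, add_zero, Nat.add_sub_cancel]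
  congr 1
  refine Finset.sum_congr rfl fun k _ => ?_
  rw [iteratedDeriv_succ', Nat.factorial_succ]
  have : ((k : ℂ) + 1) ≠ 0 := by exact_mod_cast Nat.succ_ne_zero k
  have h4 : (k.factorial : ℂ) ≠ 0 := by exact_mod_cast Nat.factorial_ne_zero k
  push_cast
  field_simp

theorem continuous_taylorRem {G : ℝ → ℂ} (hG : Continuous G) (n : ℕ) :
    Continuous (taylorRem G n) := by
  unfold taylorRem
  fun_prop

theorem contDiff_deriv {G : ℝ → ℂ} (hG : ContDiff ℝ ∞ G) : ContDiff ℝ ∞ (deriv G) :=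
  (contDiff_infty_iff_deriv.1 hG).2

theorem taylorRem_zero (G : ℝ → ℂ) (n : ℕ) : taylorRem G (n + 1) 0 = 0 := by
  rw [taylorRem, Finset.sum_range_succ']
  simp

theorem norm_taylorRem_le {G : ℝ → ℂ} (hG : ContDiff ℝ ∞ G) (n : ℕ) :
    ∃ C : ℝ, 0 ≤ C ∧ ∀ x ∈ Set.Icc (0 : ℝ) 1, ‖taylorRem G n x‖ ≤ C * x ^ n := by
  induction n generalizing G with
  | zero =>
    obtain ⟨C, hC⟩ := (isCompact_Icc (a := (0 : ℝ)) (b := 1)).exists_bound_of_continuousOn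
      (continuous_taylorRem hG.continuous 0).continuousOn
    exact ⟨C, (norm_nonneg _).trans (hC 0 (by simp)), fun x hx => by simpa using hC x hx⟩
  | succ n ih =>
    obtain ⟨C, hC0, hC⟩ := ih (contDiff_deriv hG)
    refine ⟨C, hC0, fun x hx => ?_⟩
    have h := (convex_Icc (0 : ℝ) x).norm_image_sub_le_of_norm_hasDerivWithin_le
      (f := taylorRem G (n + 1)) (f' := taylorRem (deriv G) n) (C := C * x ^ n)
      (fun y _ => (hasDerivAt_taylorRem hG n y).hasDerivWithinAt)
      (fun y hy => (hC y ⟨hy.1, hy.2.trans hx.2⟩).trans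
        (mul_le_mul_of_nonneg_left (pow_le_pow_left₀ hy.1 hy.2 n) hC0))
      (Set.left_mem_Icc.2 hx.1) (Set.right_mem_Icc.2 hx.1)
    rw [taylorRem_zero, sub_zero, sub_zero, Real.norm_of_nonneg hx.1] at h
    rw [pow_succ, ← mul_assoc]
    exact h

theorem norm_cpow_mul_taylorRem_le {G : ℝ → ℂ} {n : ℕ} {C : ℝ}
    (hC : ∀ x ∈ Set.Icc (0 : ℝ) 1, ‖taylorRem G n x‖ ≤ C * x ^ n) (s : ℂ) {x : ℝ}
    (hx : x ∈ Set.Ioc (0 : ℝ) 1) :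
    ‖(x : ℂ) ^ s * taylorRem G n x‖ ≤ C * x ^ (s.re + n) := by
  rw [norm_mul, norm_cpow_eq_rpow_re_of_pos hx.1, Real.rpow_add hx.1, Real.rpow_natCast]
  calc x ^ s.re * ‖taylorRem G n x‖ ≤ x ^ s.re * (C * x ^ n) :=
        mul_le_mul_of_nonneg_left (hC x ⟨hx.1.le, hx.2⟩) (Real.rpow_nonneg hx.1.le _)
    _ = _ := by ring

theorem intervalIntegrable_taylorRem {G : ℝ → ℂ} (hG : ContDiff ℝ ∞ G) {n : ℕ} {s : ℂ}
    (hs : -(n : ℝ) < s.re) :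
    IntervalIntegrable (fun x : ℝ => (x : ℂ) ^ (s - 1) * taylorRem G n x) volume 0 1 := by
  obtain ⟨C, hC0, hC⟩ := norm_taylorRem_le hG n
  have h1 : IntervalIntegrable (fun x : ℝ => C * x ^ ((s - 1).re + n)) volume 0 1 :=
    (intervalIntegral.intervalIntegrable_rpow' (by simp; linarith)).const_mul C
  rw [intervalIntegrable_iff_integrableOn_Ioc_of_le zero_le_one] at h1 ⊢
  refine h1.mono' ?_ ?_
  · refine ContinuousOn.aestronglyMeasurable ?_ measurableSet_Ioc
    refine ContinuousOn.mul (fun x hx => ?_) (continuous_taylorRem hG.continuous n).continuousOn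
    exact (continuousAt_ofReal_cpow_const x (s - 1) (Or.inr hx.1.ne')).continuousWithinAt
  · refine (ae_restrict_iff' measurableSet_Ioc).2 (Eventually.of_forall fun x hx => ?_)
    exact norm_cpow_mul_taylorRem_le hC _ hx

/-- Subtracting one more Taylor term under the integral costs its coefficient times `∫ x^{s-1+n} =
1/(s+n)`, which is the term added to the finite sum. Hence the continuation does not depend on the
order of the expansion. -/
theorem zetaNear_succ_eq {G : ℝ → ℂ} (hG : ContDiff ℝ ∞ G) {n : ℕ} {s : ℂ}
    (hs : -(n : ℝ) < s.re) : zetaNear G 1 (n + 1) s = zetaNear G 1 n s := by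
  rw [zetaNear_one, zetaNear_one, Finset.sum_range_succ, add_assoc]
  congr 1
  have hi := intervalIntegrable_taylorRem hG hs
  have hsn : (-1 : ℝ) < (s - 1 + n).re := by simp; linarith
  have hj : IntervalIntegrable (fun x : ℝ => iteratedDeriv n G 0 / (n.factorial : ℂ) *
      (x : ℂ) ^ (s - 1 + n)) volume 0 1 :=
    (intervalIntegral.intervalIntegrable_cpow' hsn).const_mul _
  have hne : s + n ≠ 0 := by
    intro h
    have := congrArg re h
    simp at this
    linarith
  have e : ∫ x in (0 : ℝ)..1, (x : ℂ) ^ (s - 1) * taylorRem G (n + 1) x =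
      ∫ x in (0 : ℝ)..1, ((x : ℂ) ^ (s - 1) * taylorRem G n x -
        iteratedDeriv n G 0 / (n.factorial : ℂ) * (x : ℂ) ^ (s - 1 + n)) := by
    refine intervalIntegral.integral_congr_ae (Eventually.of_forall fun x hx => ?_)
    rw [Set.uIoc_of_le zero_le_one] at hx
    have hx0 : (x : ℂ) ≠ 0 := by exact_mod_cast hx.1.ne'
    rw [cpow_add _ _ hx0, cpow_natCast]
    simp only [taylorRem, Finset.sum_range_succ]
    ring
  rw [e, intervalIntegral.integral_sub hi hj, intervalIntegral.integral_const_mul,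
    integral_cpow (Or.inl hsn)]
  have e2 : s - 1 + n + 1 = s + n := by ring
  rw [e2, ofReal_one, one_cpow, ofReal_zero, zero_cpow hne]
  ring

theorem zetaNear_eq_of_le {G : ℝ → ℂ} (hG : ContDiff ℝ ∞ G) {m n : ℕ} (hmn : m ≤ n) {s : ℂ}
    (hs : -(m : ℝ) < s.re) : zetaNear G 1 n s = zetaNear G 1 m s := by
  induction n, hmn using Nat.le_induction with
  | base => rfl
  | succ n hmn ih =>
    rw [zetaNear_succ_eq hG, ih]
    have : (m : ℝ) ≤ n := by exact_mod_cast hmn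
    linarith

theorem zetaNear_congr {G : ℝ → ℂ} (hG : ContDiff ℝ ∞ G) {m n : ℕ} {s : ℂ}
    (hm : -(m : ℝ) < s.re) (hn : -(n : ℝ) < s.re) : zetaNear G 1 m s = zetaNear G 1 n s := by
  rcases le_total m n with h | h
  · exact (zetaNear_eq_of_le hG h hm).symm
  · exact zetaNear_eq_of_le hG h hn

theorem zetaNear_eq_integral {G : ℝ → ℂ} (hG : ContDiff ℝ ∞ G) (n : ℕ) {s : ℂ} (hs : 0 < s.re) :
    zetaNear G 1 n s = ∫ x in (0 : ℝ)..1, (x : ℂ) ^ (s - 1) * G x := by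
  rw [zetaNear_eq_of_le hG (Nat.zero_le n) (by simpa using hs), zetaNear_one]
  simp [taylorRem]

/-- Integration by parts in the regularized Mellin integral. -/
theorem zetaNear_deriv {G : ℝ → ℂ} (hG : ContDiff ℝ ∞ G) {n : ℕ} {s : ℂ}
    (hs : -((n : ℝ) + 1) < s.re) (hne : ∀ k : ℕ, s + k ≠ 0) :
    s * zetaNear G 1 (n + 1) s = G 1 - zetaNear (deriv G) 1 n (s + 1) := by
  have hs0 : s ≠ 0 := by simpa using hne 0
  obtain ⟨C, hC0, hC⟩ := norm_taylorRem_le hG (n + 1)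
  have hi := intervalIntegrable_taylorRem (n := n + 1) hG (s := s) (by push_cast; linarith)
  have hj := intervalIntegrable_taylorRem (n := n) (contDiff_deriv hG) (s := s + 1)
    (by simp; linarith)
  -- Only the endpoint `0` is in doubt. There the product is of size `x^{Re s + n + 1}` with
  -- positive exponent, and the remainder vanishes at `0` whatever `0 ^ s` is.
  have hcont : ContinuousOn (fun x : ℝ => (x : ℂ) ^ s * taylorRem G (n + 1) x)
      (Set.Icc 0 1) := by
    intro x hx
    rcases hx.1.eq_or_lt with h0 | h0
    · subst h0
      have hpos : 0 < s.re + ((n + 1 : ℕ) : ℝ) := by push_cast; linarith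
      have h1 : Tendsto (fun x : ℝ => C * x ^ (s.re + ((n + 1 : ℕ) : ℝ)))
          (𝓝[Set.Icc 0 1] 0) (𝓝 0) := by
        have : Continuous (fun x : ℝ => C * x ^ (s.re + ((n + 1 : ℕ) : ℝ))) :=
          continuous_const.mul (Real.continuous_rpow_const hpos.le)
        have h2 := this.tendsto 0
        rw [Real.zero_rpow hpos.ne', mul_zero] at h2
        exact h2.mono_left nhdsWithin_le_nhds
      rw [ContinuousWithinAt, taylorRem_zero, mul_zero]
      refine squeeze_zero_norm' ?_ h1
      filter_upwards [self_mem_nhdsWithin] with y hy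
      rcases hy.1.eq_or_lt with h0 | h0
      · subst h0
        rw [Real.zero_rpow hpos.ne']
        simp [taylorRem_zero]
      · exact norm_cpow_mul_taylorRem_le hC s ⟨h0, hy.2⟩
    · exact ((continuousAt_ofReal_cpow_const x s (Or.inr h0.ne')).mul
        (continuous_taylorRem hG.continuous _).continuousAt).continuousWithinAt
  have hder : ∀ x ∈ Set.Ioo (0 : ℝ) 1, HasDerivAt (fun x : ℝ => (x : ℂ) ^ s * taylorRem G (n + 1) x)
      (s * ((x : ℂ) ^ (s - 1) * taylorRem G (n + 1) x) +
        (x : ℂ) ^ (s + 1 - 1) * taylorRem (deriv G) n x) x := by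
    intro x hx
    have h1 : HasDerivAt (fun y : ℝ => (y : ℂ) ^ s) (s * (x : ℂ) ^ (s - 1)) x := by
      have := ((hasDerivAt_id (x : ℂ)).cpow_const (c := s) (Or.inl (by simpa using hx.1))).comp_ofReal
      simpa using this
    refine (h1.mul (hasDerivAt_taylorRem hG n x)).congr_deriv ?_
    rw [add_sub_cancel_right]
    ring
  have hFTC := intervalIntegral.integral_eq_sub_of_hasDerivAt_of_le zero_le_one hcont hder
    ((hi.const_mul s).add hj)
  rw [intervalIntegral.integral_add (hi.const_mul s) hj, intervalIntegral.integral_const_mul] at hFTC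
  rw [zetaNear_one, zetaNear_one, mul_add]
  have h0 : taylorRem G (n + 1) 0 = 0 := taylorRem_zero G n
  simp only [ofReal_one, one_cpow, one_mul, h0, mul_zero, sub_zero] at hFTC
  have h1 : taylorRem G (n + 1) 1 = G 1 - ∑ k ∈ Finset.range (n + 1),
      iteratedDeriv k G 0 / (k.factorial : ℂ) := by simp [taylorRem]
  rw [h1] at hFTC
  -- Termwise this is `s/(s+k) = 1 - k/(s+k)` with `k/k! = 1/(k-1)!`. The sum of the ones is the
  -- Taylor polynomial at `1` that the boundary term subtracts from `G 1`.
  have hsum : s * ∑ k ∈ Finset.range (n + 1), iteratedDeriv k G 0 / (k.factorial : ℂ) * (1 / (s + k)) =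
      ∑ k ∈ Finset.range (n + 1), iteratedDeriv k G 0 / (k.factorial : ℂ) -
      ∑ k ∈ Finset.range n, iteratedDeriv k (deriv G) 0 / (k.factorial : ℂ) * (1 / (s + 1 + k)) := by
    rw [Finset.sum_range_succ', Finset.sum_range_succ', mul_add, Finset.mul_sum]
    have : ∀ k ∈ Finset.range n,
        s * (iteratedDeriv (k + 1) G 0 / ((k + 1).factorial : ℂ) * (1 / (s + (k + 1 : ℕ)))) =
        iteratedDeriv (k + 1) G 0 / ((k + 1).factorial : ℂ) -
          iteratedDeriv k (deriv G) 0 / (k.factorial : ℂ) * (1 / (s + 1 + k)) := by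
      intro k _
      rw [iteratedDeriv_succ', Nat.factorial_succ]
      have h2 : ((k : ℂ) + 1) ≠ 0 := by exact_mod_cast Nat.succ_ne_zero k
      have h4 : (k.factorial : ℂ) ≠ 0 := by exact_mod_cast Nat.factorial_ne_zero k
      have h5 : s + ((k + 1 : ℕ) : ℂ) ≠ 0 := hne (k + 1)
      have h6 : s + 1 + (k : ℂ) ≠ 0 := by
        have := h5; push_cast at this; rwa [add_assoc, add_comm (1 : ℂ)]
      have h7 : s + ((k + 1 : ℕ) : ℂ) = s + 1 + k := by push_cast; ring
      rw [h7]
      push_cast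
      field_simp
      ring
    rw [Finset.sum_congr rfl this, Finset.sum_sub_distrib]
    simp only [iteratedDeriv_zero, Nat.factorial_zero, Nat.cast_one, div_one, Nat.cast_zero,
      add_zero]
    rw [mul_left_comm, mul_one_div_cancel hs0]
    ring
  rw [hsum]
  linear_combination hFTC

/-! ### Raising operators -/

/-- Raising `λ` by `1/2` contributes `|x|⁻¹`, and raising `ℓ` by `2` contributes the sign of `x`, as
`i² = -1`. Together they give `x⁻¹`, which is smooth away from `0` without sign cases; this dictates
the shift of both parameters. -/
theorem sgnPow_mul_abs_cpow_raise (lam : ℂ) (ℓ : ℤ) {x : ℝ} (hx : x ≠ 0) :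
    sgnPow (ℓ + 2) x * ((|x| : ℝ) : ℂ) ^ (-2 * (lam + 1 / 2)) * x =
      sgnPow ℓ x * ((|x| : ℝ) : ℂ) ^ (-2 * lam) := by
  have hx0 : ((|x| : ℝ) : ℂ) ≠ 0 := by simpa using hx
  have hxc : (x : ℂ) ≠ 0 := by exact_mod_cast hx
  have e : (-2 * (lam + 1 / 2) : ℂ) = -2 * lam - 1 := by ring
  rw [e, cpow_sub _ _ hx0, cpow_one]
  rcases lt_or_gt_of_ne hx with h | h
  · rw [abs_of_neg h] at *
    simp only [sgnPow, if_neg h.not_gt, zpow_add₀ I_ne_zero]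
    push_cast
    have : (I : ℂ) ^ (2 : ℤ) = -1 := by
      rw [show (2 : ℤ) = ((2 : ℕ) : ℤ) from rfl, zpow_natCast, I_sq]
    rw [this]
    field_simp
  · rw [abs_of_pos h] at *
    simp only [sgnPow, if_pos h]
    field_simp

namespace LineModel

variable {lam : ℂ} {ℓ : ℤ}

theorem hasDerivAt (f : LineModel lam ℓ) (x : ℝ) : HasDerivAt f (deriv f x) x :=
  ((f.contDiff.differentiable (by simp)) x).hasDerivAt

theorem rawInf_raise (lam : ℂ) (ℓ : ℤ) (g : ℝ → ℂ) {x : ℝ} (hx : x ≠ 0) :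
    x * rawInf (lam + 1 / 2) (ℓ + 2) g x = rawInf lam ℓ g x := by
  simp only [rawInf]
  rw [← sgnPow_mul_abs_cpow_raise lam ℓ hx]
  ring

/-- `D_λ` commutes with `f ↦ f_∞`. Solving that relation for `f'(-1/x)` and cancelling `1 + x²`
gives the formula. -/
theorem rawInf_deriv (f : LineModel lam ℓ) {x : ℝ} (hx : x ≠ 0) :
    rawInf lam ℓ (deriv f) x = x * (x * deriv f.inf x + 2 * lam * f.inf x) := by
  have h := diffFun_rawInf lam ℓ f.contDiff (h := f.inf) (fun y hy => f.infFun_eq hy) hx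
  have hf : f.inf x = rawInf lam ℓ f x := f.infFun_eq hx
  have hxc : (x : ℂ) ≠ 0 := by exact_mod_cast hx
  have hw : (1 + (x : ℂ) ^ 2) ≠ 0 := by
    rw [← ofReal_pow, ← ofReal_one, ← ofReal_add]
    exact_mod_cast (by positivity : (1 + x ^ 2 : ℝ) ≠ 0)
  simp only [diffFun, rawInf] at h hf
  rw [hf] at h
  rw [hf, rawInf]
  have ht : (x : ℂ) * ((-1 / x : ℝ) : ℂ) + 1 = 0 := by push_cast; field_simp; ring
  generalize ((-1 / x : ℝ) : ℂ) = t at *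
  generalize deriv f (-1 / x) = q at *
  refine mul_left_cancel₀ hw ?_
  linear_combination (-(x : ℂ) ^ 2) * h + sgnPow ℓ x * ((|x| : ℝ) : ℂ) ^ (-2 * lam) *
    (q * (1 - x * t) - 2 * lam * x * f (-1 / x)) * ht

/-- Differentiation, as an operator raising the parameters of the line model. -/
def derivUp : LineModel lam ℓ →ₗ[ℂ] LineModel (lam + 1 / 2) (ℓ + 2) where
  toFun f := ⟨deriv f, contDiff_deriv f.contDiff, fun x => x * deriv f.inf x + 2 * lam * f.inf x,
    (ofRealCLM.contDiff.mul (contDiff_deriv f.inf.contDiff)).add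
      (contDiff_const.mul f.inf.contDiff), fun x hx => by
      have hxc : (x : ℂ) ≠ 0 := by exact_mod_cast hx
      refine mul_left_cancel₀ hxc ?_
      rw [rawInf_raise _ _ _ hx, rawInf_deriv f hx]⟩
  map_add' f g := DFunLike.ext _ _ fun x => ((f.hasDerivAt x).add (g.hasDerivAt x)).deriv
  map_smul' c f := DFunLike.ext _ _ fun x => ((f.hasDerivAt x).const_mul c).deriv

@[simp] theorem derivUp_apply (f : LineModel lam ℓ) (x : ℝ) : derivUp f x = deriv f x := rfl

/-- The operator `x d/dx + 2 λ`, raising the parameters of the line model. -/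
def eulerUp : LineModel lam ℓ →ₗ[ℂ] LineModel (lam + 1 / 2) (ℓ + 2) where
  toFun f := ⟨fun x => x * deriv f x + 2 * lam * f x,
    (ofRealCLM.contDiff.mul (contDiff_deriv f.contDiff)).add (contDiff_const.mul f.contDiff),
    fun x => -deriv f.inf x, (contDiff_deriv f.inf.contDiff).neg, fun x hx => by
      have hxc : (x : ℂ) ≠ 0 := by exact_mod_cast hx
      refine mul_left_cancel₀ hxc ?_
      rw [rawInf_raise _ _ _ hx]
      have h1 := rawInf_deriv f hx
      have h2 : f.inf x = rawInf lam ℓ f x := f.infFun_eq hx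
      simp only [rawInf] at h1 h2 ⊢
      have ht : (x : ℂ) * ((-1 / x : ℝ) : ℂ) + 1 = 0 := by push_cast; field_simp; ring
      linear_combination (-((-1 / x : ℝ) : ℂ)) * h1 -
        (x * deriv f.inf x + 2 * lam * f.inf x) * ht + 2 * lam * h2⟩
  map_add' f g := DFunLike.ext _ _ fun x => by
    have h : deriv (f + g : LineModel lam ℓ) x = deriv f x + deriv g x :=
      ((f.hasDerivAt x).add (g.hasDerivAt x)).deriv
    change x * deriv (f + g : LineModel lam ℓ) x + 2 * lam * (f x + g x) =
      (x * deriv f x + 2 * lam * f x) + (x * deriv g x + 2 * lam * g x)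
    rw [h]; ring
  map_smul' c f := DFunLike.ext _ _ fun x => by
    have h : deriv (c • f : LineModel lam ℓ) x = c * deriv f x :=
      ((f.hasDerivAt x).const_mul c).deriv
    change x * deriv (c • f : LineModel lam ℓ) x + 2 * lam * (c * f x) =
      c * (x * deriv f x + 2 * lam * f x)
    rw [h]; ring

@[simp] theorem eulerUp_apply (f : LineModel lam ℓ) (x : ℝ) :
    eulerUp f x = x * deriv f x + 2 * lam * f x := rfl

/-- Under `f ↦ f_∞` the Euler operator corresponds to minus the derivative. The part of the
regularized integral near infinity is thereby accessible to `zetaNear_deriv`. -/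
theorem inf_eulerUp (f : LineModel lam ℓ) (x : ℝ) : (eulerUp f).inf x = -deriv f.inf x := by
  have h := infFun_unique (eulerUp f) (h := fun x => -deriv f.inf x)
    (contDiff_deriv f.inf.contDiff).neg.continuous (fun x hx => ?_)
  · exact congrFun h x
  · have hxc : (x : ℂ) ≠ 0 := by exact_mod_cast hx
    refine mul_left_cancel₀ hxc ?_
    rw [rawInf_raise _ _ _ hx]
    have h1 := rawInf_deriv f hx
    have h2 : f.inf x = rawInf lam ℓ f x := f.infFun_eq hx
    simp only [rawInf, eulerUp_apply] at h1 h2 ⊢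
    have ht : (x : ℂ) * ((-1 / x : ℝ) : ℂ) + 1 = 0 := by push_cast; field_simp; ring
    linear_combination (-((-1 / x : ℝ) : ℂ)) * h1 -
      (x * deriv f.inf x + 2 * lam * f.inf x) * ht + 2 * lam * h2

/-- The regularized integral `(ℱf)(0)`. -/
def regInt (f : LineModel lam ℓ) : ℂ := f.zetaPlus 1 + f.zetaMinus 1

theorem inf_neg_one (f : LineModel lam ℓ) : f.inf (-1) = I ^ ℓ * f 1 := by
  rw [inf_apply f (by norm_num)]
  have : ¬ (0 : ℝ) < -1 := by norm_num
  simp [sgnPow, this]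

theorem inf_one (f : LineModel lam ℓ) : f.inf 1 = f (-1) := by
  rw [inf_apply f (by norm_num)]
  simp [sgnPow]

/-- At `s = 1` the part near `0` converges and needs no Taylor correction; the part near infinity
may use any sufficient order `n` in place of the one fixed in the definition. -/
theorem zetaPlus_one_eq (f : LineModel lam ℓ) {n : ℕ} (hn : -(n : ℝ) < 2 * lam.re - 1) :
    f.zetaPlus 1 = (∫ x in (0 : ℝ)..1, f x) +
      I ^ (-ℓ) * zetaNear (fun x => f.inf (-x)) 1 n (2 * lam - 1) := by
  have h0 := Nat.lt_floor_add_one (|(1 : ℂ).re| + 2 * |lam.re|)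
  simp only [one_re, abs_one] at h0
  have h1 := neg_abs_le lam.re
  have hc : ContDiff ℝ ∞ (fun x => f.inf ((-1) * x)) :=
    f.inf.contDiff.comp (contDiff_const.mul contDiff_id)
  rw [zetaPlus]
  simp only [one_re, abs_one]
  rw [zetaNear_eq_integral f.contDiff _ (by simp), zetaNear_eq_comp f.inf.contDiff,
    zetaNear_congr hc (n := n) (by push_cast; simp; linarith) (by simpa using hn)]
  simp

theorem zetaMinus_one_eq (f : LineModel lam ℓ) {n : ℕ} (hn : -(n : ℝ) < 2 * lam.re - 1) :
    f.zetaMinus 1 = (∫ x in (0 : ℝ)..1, f (-x)) + zetaNear f.inf 1 n (2 * lam - 1) := by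
  have h0 := Nat.lt_floor_add_one (|(1 : ℂ).re| + 2 * |lam.re|)
  simp only [one_re, abs_one] at h0
  have h1 := neg_abs_le lam.re
  have hc : ContDiff ℝ ∞ (fun x => f ((-1) * x)) :=
    f.contDiff.comp (contDiff_const.mul contDiff_id)
  rw [zetaMinus]
  simp only [one_re, abs_one]
  rw [zetaNear_eq_comp f.contDiff, zetaNear_eq_integral hc _ (by simp),
    zetaNear_congr f.inf.contDiff (n := n) (by push_cast; simp; linarith) (by simpa using hn)]
  simp

end LineModel

/-! ### The regularized integral: recursion in `λ` and the convergent range. -/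

theorem integral_euler {F : ℝ → ℂ} (hF : ContDiff ℝ ∞ F) (c : ℂ) :
    ∫ x in (0 : ℝ)..1, ((x : ℂ) * deriv F x + c * F x) =
      F 1 + (c - 1) * ∫ x in (0 : ℝ)..1, F x := by
  have hd : Continuous (deriv F) := (contDiff_deriv hF).continuous
  have hF0 := hF.continuous
  have h1 : ∫ x in (0 : ℝ)..1, ((x : ℂ) * deriv F x + F x) = (1 : ℝ) * F 1 - (0 : ℝ) * F 0 := by
    refine intervalIntegral.integral_eq_sub_of_hasDerivAt (f := fun x : ℝ => (x : ℂ) * F x)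
      (fun x _ => ?_) (Continuous.intervalIntegrable (by fun_prop) _ _)
    have hx : HasDerivAt (fun y : ℝ => (y : ℂ)) 1 x := ofRealCLM.hasDerivAt
    refine (hx.mul (hF.differentiable (by simp) x).hasDerivAt).congr_deriv ?_
    ring
  have h2 : ∫ x in (0 : ℝ)..1, ((x : ℂ) * deriv F x + c * F x) =
      ∫ x in (0 : ℝ)..1, (((x : ℂ) * deriv F x + F x) + (c - 1) * F x) := by
    congr 1; funext x; ring
  rw [h2, intervalIntegral.integral_add (Continuous.intervalIntegrable (by fun_prop) _ _)
    (Continuous.intervalIntegrable (by fun_prop) _ _), h1, intervalIntegral.integral_const_mul]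
  simp

namespace LineModel

variable {lam : ℂ} {ℓ : ℤ}

/-- Formally `∫ (x f' + 2λ f) = (2λ - 1) ∫ f`. Integration by parts on `[-1, 1]` leaves `f(1) +
f(-1)`. The parts near infinity are regularized integrals of `f_∞`, for which `zetaNear_deriv` at
`2λ - 1` leaves `-i^{-ℓ} f_∞(-1) - f_∞(1)`; this cancels the former because `f_∞(-1) = i^ℓ f(1)` and
`f_∞(1) = f(-1)`. -/
theorem regInt_eulerUp (h : ∀ k : ℕ, 2 * lam - 1 + k ≠ 0) (f : LineModel lam ℓ) :
    (eulerUp f).regInt = (2 * lam - 1) * f.regInt := by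
  obtain ⟨n, hn⟩ := exists_nat_gt (-(2 * lam.re))
  have e1 : (2 * (lam + 1 / 2) - 1 : ℂ) = 2 * lam - 1 + 1 := by ring
  have hn1 : -((n + 1 : ℕ) : ℝ) < 2 * lam.re - 1 := by push_cast; linarith
  have hn2 : -(n : ℝ) < 2 * (lam + 1 / 2).re - 1 := by simp; linarith
  rw [regInt, regInt, zetaPlus_one_eq f hn1, zetaMinus_one_eq f hn1, zetaPlus_one_eq _ hn2,
    zetaMinus_one_eq _ hn2, e1]
  have hcn : ContDiff ℝ ∞ (fun x : ℝ => f.inf (-x)) := f.inf.contDiff.comp contDiff_neg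
  have hcf : ContDiff ℝ ∞ (fun x : ℝ => f (-x)) := f.contDiff.comp contDiff_neg
  have hs : -((n : ℝ) + 1) < (2 * lam - 1).re := by simp; linarith
  have a1 := zetaNear_deriv hcn hs h
  have a2 := zetaNear_deriv f.inf.contDiff hs h
  have b1 : (fun x : ℝ => (eulerUp f).inf (-x)) = deriv (fun x : ℝ => f.inf (-x)) := by
    funext x
    rw [inf_eulerUp, deriv_comp_neg]
  have b2 : ((eulerUp f).inf : ℝ → ℂ) = fun x => -deriv f.inf x := funext (inf_eulerUp f)
  have b3 : zetaNear (fun x => -deriv f.inf x) 1 n (2 * lam - 1 + 1) =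
      -zetaNear (deriv f.inf) 1 n (2 * lam - 1 + 1) := by
    have := fun k => iteratedDeriv_fun_neg k (deriv f.inf) (0 : ℝ)
    simp only [zetaNear, this]
    rw [neg_add, ← Finset.sum_neg_distrib, ← intervalIntegral.integral_neg]
    congr 1
    · refine Finset.sum_congr rfl fun k _ => by ring
    · congr 1
      funext x
      have : ∀ g : ℕ → ℂ, ∑ k ∈ Finset.range n, ((1 : ℝ) : ℂ) ^ k * -g k / (k.factorial : ℂ) *
          (x : ℂ) ^ k = -∑ k ∈ Finset.range n, ((1 : ℝ) : ℂ) ^ k * g k / (k.factorial : ℂ) *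
          (x : ℂ) ^ k := by
        intro g
        rw [← Finset.sum_neg_distrib]
        exact Finset.sum_congr rfl fun k _ => by ring
      rw [this]
      ring
  have c1 : ∫ x in (0 : ℝ)..1, eulerUp f x = f 1 + (2 * lam - 1) * ∫ x in (0 : ℝ)..1, f x :=
    integral_euler f.contDiff (2 * lam)
  have c2 : ∫ x in (0 : ℝ)..1, eulerUp f (-x) =
      f (-1) + (2 * lam - 1) * ∫ x in (0 : ℝ)..1, f (-x) := by
    rw [← integral_euler hcf (2 * lam)]
    congr 1
    funext x
    rw [eulerUp_apply, deriv_comp_neg]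
    push_cast
    ring
  have d : (I : ℂ) ^ (-(ℓ + 2)) = -I ^ (-ℓ) := by
    rw [neg_add, zpow_add₀ I_ne_zero]
    have : (I : ℂ) ^ (-2 : ℤ) = -1 := by
      rw [zpow_neg, show (2 : ℤ) = ((2 : ℕ) : ℤ) from rfl, zpow_natCast, I_sq]; norm_num
    rw [this]; ring
  have e2 : (I : ℂ) ^ (-ℓ) * f.inf (-1) = f 1 := by
    rw [inf_neg_one, ← mul_assoc, ← zpow_add₀ I_ne_zero]; simp
  have e3 := inf_one f
  rw [b1, b2, b3, c1, c2, d]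
  linear_combination (-I ^ (-ℓ)) * a1 - a2 - e2 - e3

theorem integrable_of_one_half_lt (hlam : 1 / 2 < lam.re) (f : LineModel lam ℓ) :
    Integrable f := by
  obtain ⟨C, hC⟩ := exists_bound f
  have h : Integrable (fun x : ℝ => C * (1 + ‖x‖ ^ 2) ^ (-(2 * lam.re) / 2)) :=
    (integrable_rpow_neg_one_add_norm_sq (by simp; linarith)).const_mul C
  refine h.mono' f.continuous.aestronglyMeasurable (Eventually.of_forall fun x => ?_)
  have hw : 0 < 1 + x ^ 2 := by positivity
  have e : -(2 * lam.re) / 2 = -lam.re := by ring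
  rw [e, Real.rpow_neg (by positivity), Real.norm_eq_abs, sq_abs, ← div_eq_mul_inv,
    le_div_iff₀ (by positivity), mul_comm]
  exact hC x

theorem setIntegral_Ioi_one {f : ℝ → ℂ} :
    ∫ x in Set.Ioi (1 : ℝ), f x = ∫ x in (0 : ℝ)..1, ((x : ℂ) ^ 2)⁻¹ * f x⁻¹ := by
  have himg : (fun x : ℝ => x⁻¹) '' Set.Ioo 0 1 = Set.Ioi 1 := by
    ext y
    constructor
    · rintro ⟨x, hx, rfl⟩
      exact (one_lt_inv₀ hx.1).2 hx.2
    · intro hy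
      have hy' : (1 : ℝ) < y := hy
      exact ⟨y⁻¹, ⟨by positivity, inv_lt_one_of_one_lt₀ hy'⟩, inv_inv y⟩
  rw [← himg, integral_image_eq_integral_abs_deriv_smul measurableSet_Ioo
    (f' := fun x => -(x ^ 2)⁻¹) (fun x hx => (hasDerivAt_inv hx.1.ne').hasDerivWithinAt)
    (fun x _ y _ h => inv_injective h),
    intervalIntegral.integral_of_le zero_le_one, integral_Ioc_eq_integral_Ioo]
  refine integral_congr_ae (Eventually.of_forall fun x => ?_)
  simp

/-- For `Re λ > 1/2` all pieces converge, and `x ↦ 1/x` carries the Mellin integrals of `f_∞` at `2λ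
- 1` back to integrals of `f(±x)` over `(1, ∞)`. -/
theorem regInt_eq_integral (hlam : 1 / 2 < lam.re) (f : LineModel lam ℓ) :
    f.regInt = ∫ x, f x := by
  have hi := integrable_of_one_half_lt hlam f
  have hin : Integrable (fun x => f (-x)) := hi.comp_neg
  have h0 : -((0 : ℕ) : ℝ) < 2 * lam.re - 1 := by simp; linarith
  have hs : 0 < (2 * lam - 1).re := by simp; linarith
  have hcn : ContDiff ℝ ∞ (fun x : ℝ => f.inf (-x)) := f.inf.contDiff.comp contDiff_neg
  have key : ∀ x : ℝ, x ∈ Set.Ioo (0 : ℝ) 1 → (x : ℂ) ^ (2 * lam - 1 - 1) * (x : ℂ) ^ (-2 * lam) =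
      ((x : ℂ) ^ 2)⁻¹ := by
    intro x hx
    have hx0 : (x : ℂ) ≠ 0 := by exact_mod_cast hx.1.ne'
    rw [← cpow_add _ _ hx0]
    have : (2 * lam - 1 - 1 + -2 * lam : ℂ) = -(2 : ℕ) := by push_cast; ring
    rw [this, cpow_neg, cpow_natCast]
  rw [regInt, zetaPlus_one_eq f h0, zetaMinus_one_eq f h0, zetaNear_eq_integral hcn _ hs,
    zetaNear_eq_integral f.inf.contDiff _ hs]
  have e1 : I ^ (-ℓ) * ∫ x in (0 : ℝ)..1, (x : ℂ) ^ (2 * lam - 1 - 1) * f.inf (-x) =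
      ∫ x in Set.Ioi (1 : ℝ), f x := by
    rw [setIntegral_Ioi_one, ← intervalIntegral.integral_const_mul,
      intervalIntegral.integral_of_le zero_le_one, intervalIntegral.integral_of_le zero_le_one,
      integral_Ioc_eq_integral_Ioo, integral_Ioc_eq_integral_Ioo]
    refine setIntegral_congr_fun measurableSet_Ioo fun x hx => ?_
    have hx1 : ¬ 0 < -x := by linarith [hx.1]
    rw [inf_apply f (neg_ne_zero.2 hx.1.ne'), ← key x hx, abs_neg, abs_of_pos hx.1, sgnPow,
      if_neg hx1]
    have : -1 / -x = x⁻¹ := by rw [neg_div_neg_eq, one_div]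
    have h3 : (I : ℂ) ^ (-ℓ) * I ^ ℓ = 1 := by rw [← zpow_add₀ I_ne_zero]; simp
    rw [this]
    linear_combination ((x : ℂ) ^ (2 * lam - 1 - 1) * (x : ℂ) ^ (-2 * lam) * f x⁻¹) * h3
  have e2 : ∫ x in (0 : ℝ)..1, (x : ℂ) ^ (2 * lam - 1 - 1) * f.inf x =
      ∫ x in Set.Ioi (1 : ℝ), f (-x) := by
    rw [setIntegral_Ioi_one,
      intervalIntegral.integral_of_le zero_le_one, intervalIntegral.integral_of_le zero_le_one,
      integral_Ioc_eq_integral_Ioo, integral_Ioc_eq_integral_Ioo]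
    refine setIntegral_congr_fun measurableSet_Ioo fun x hx => ?_
    rw [inf_apply f hx.1.ne', ← key x hx, abs_of_pos hx.1, sgnPow, if_pos hx.1]
    have : -1 / x = -x⁻¹ := by rw [neg_div, one_div]
    rw [this]
    ring
  have e3 : ∀ g : ℝ → ℂ, Integrable g → (∫ x in (0 : ℝ)..1, g x) + ∫ x in Set.Ioi (1 : ℝ), g x =
      ∫ x in Set.Ioi (0 : ℝ), g x := fun g hg =>
    intervalIntegral.integral_interval_add_Ioi hg.integrableOn hg.integrableOn
  rw [e1, e2, e3 _ hi, e3 _ hin, integral_comp_neg_Ioi, neg_zero, add_comm]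
  exact intervalIntegral.integral_Iic_add_Ioi hi.integrableOn hi.integrableOn

end LineModel

/-! ### Induction along `λ ↦ λ + 1/2` and the bounds it needs. -/

namespace LineModel

variable {lam : ℂ} {ℓ : ℤ}

/-- Induction along the raising of the parameters, starting from the range of absolute
convergence. -/
theorem raise_induction {P : ℂ → ℤ → Prop} (base : ∀ (lam : ℂ) (ℓ : ℤ), 1 / 2 < lam.re → P lam ℓ)
    (step : ∀ (lam : ℂ) (ℓ : ℤ), (∀ k : ℕ, 2 * lam - 1 + k ≠ 0) → P (lam + 1 / 2) (ℓ + 2) → P lam ℓ)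
    (lam : ℂ) (ℓ : ℤ) (h : ∀ k : ℕ, 2 * lam - 1 + k ≠ 0) : P lam ℓ := by
  -- Each step raises `2 Re λ` by one, so `n` steps lead into the range `Re λ > 1/2`. The
  -- nonvanishing condition at `λ + 1/2` is the one at `λ` with `k` replaced by `k + 1`.
  obtain ⟨n, hn⟩ := exists_nat_gt (1 - 2 * lam.re)
  induction n generalizing lam ℓ with
  | zero => exact base lam ℓ (by simp at hn; linarith)
  | succ n ih =>
    refine step lam ℓ h (ih _ _ (fun k hk => h (k + 1) ?_) ?_)
    · push_cast
      linear_combination hk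
    · push_cast at hn
      simp
      linarith

theorem norm_iteratedDeriv_le_rpow (lam : ℂ) (ℓ : ℤ) (m : ℕ) : ∃ C : ℝ, 0 ≤ C ∧
    ∀ (f : LineModel lam ℓ) (x : ℝ),
      ‖iteratedDeriv m f x‖ ≤ C * nu m f * (1 + ‖x‖ ^ 2) ^ (-(2 * lam.re + m) / 2) := by
  obtain ⟨C, hC, h⟩ := norm_iteratedDeriv_le lam ℓ m
  refine ⟨C, hC, fun f x => ?_⟩
  have hw : 0 < 1 + x ^ 2 := by positivity
  have e : -(2 * lam.re + m) / 2 = -(lam.re + m / 2) := by ring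
  rw [e, Real.rpow_neg (by positivity), Real.norm_eq_abs, sq_abs, ← div_eq_mul_inv,
    le_div_iff₀ (by positivity), mul_comm]
  exact h f x

theorem continuous_iteratedDeriv (f : LineModel lam ℓ) (m : ℕ) : Continuous (iteratedDeriv m f) :=
  f.contDiff.continuous_iteratedDeriv m (by exact_mod_cast le_top)

theorem integrable_iteratedDeriv {m : ℕ} (hm : 1 < 2 * lam.re + m) (f : LineModel lam ℓ) :
    Integrable (iteratedDeriv m f) := by
  obtain ⟨C, hC, h⟩ := norm_iteratedDeriv_le_rpow lam ℓ m
  exact ((integrable_rpow_neg_one_add_norm_sq (E := ℝ) (μ := volume) (r := 2 * lam.re + m)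
    (by simpa using hm)).const_mul (C * nu m f)).mono'
    (continuous_iteratedDeriv f m).aestronglyMeasurable (Eventually.of_forall (h f))

theorem integral_norm_iteratedDeriv_le (lam : ℂ) (ℓ : ℤ) {m : ℕ} (hm : 1 < 2 * lam.re + m) :
    ∃ C : ℝ, 0 ≤ C ∧ ∀ f : LineModel lam ℓ, ∫ x, ‖iteratedDeriv m f x‖ ≤ C * nu m f := by
  obtain ⟨C, hC, h⟩ := norm_iteratedDeriv_le_rpow lam ℓ m
  have hi := integrable_rpow_neg_one_add_norm_sq (E := ℝ) (μ := volume) (r := 2 * lam.re + m)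
    (by simpa using hm)
  refine ⟨C * ∫ x : ℝ, (1 + ‖x‖ ^ 2) ^ (-(2 * lam.re + m) / 2),
    mul_nonneg hC (integral_nonneg fun x => by positivity), fun f => ?_⟩
  refine (integral_mono (integrable_iteratedDeriv hm f).norm (hi.const_mul (C * nu m f))
    (h f)).trans (le_of_eq ?_)
  rw [integral_const_mul]
  ring

/-- `eulerUp f` lives at `λ + 1/2`, so its seminorms involve `D_{λ+1/2}`, while those of `f` involve
`D_λ`. After multiplication by `1 + x²`, `eulerUp f` becomes `x · D_λ f + 2λ f`, and applying
`D_{λ+1/2}` preserves the shape `x u + v`, with `(u, v)` replaced by `(D_λ u - v, D_λ v + u)`. -/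
theorem diff_pow_eulerUp (lam : ℂ) (ℓ : ℤ) (j : ℕ) : ∃ C : ℝ, 0 ≤ C ∧ ∀ f : LineModel lam ℓ,
    ∃ u v : LineModel lam ℓ,
      (∀ x : ℝ, (1 + (x : ℂ) ^ 2) * (diff ^ j) (eulerUp f) x = x * u x + v x) ∧
      ∀ m, nu m u ≤ C * nu (m + j + 1) f ∧ nu m v ≤ C * nu (m + j + 1) f := by
  induction j with
  | zero =>
    refine ⟨1 + ‖2 * lam‖, by positivity, fun f => ⟨diff f, (2 * lam) • f, fun x => ?_, fun m => ?_⟩⟩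
    · change (1 + (x : ℂ) ^ 2) * (x * deriv f x + 2 * lam * f x) = x * diffFun lam f x + 2 * lam * f x
      rw [diffFun]
      ring
    · have h0 := nu_nonneg (m + 1) f
      have h2 := norm_nonneg (2 * lam)
      constructor
      · refine (nu_diff_le m f).trans ?_
        nlinarith
      · rw [map_smul_eq_mul]
        have := nu_mono (Nat.le_succ m) f
        nlinarith
  | succ j ih =>
    obtain ⟨C, hC, h⟩ := ih
    refine ⟨2 * C, by positivity, fun f => ?_⟩
    obtain ⟨u, v, huv, hm⟩ := h f
    refine ⟨diff u - v, diff v + u, fun x => ?_, fun m => ⟨?_, ?_⟩⟩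
    · have hw : ∀ x : ℝ, (1 + (x : ℂ) ^ 2) ≠ 0 := by
        intro x
        rw [← ofReal_pow, ← ofReal_one, ← ofReal_add]
        exact_mod_cast (by positivity : (1 + x ^ 2 : ℝ) ≠ 0)
      set g := (diff ^ j) (eulerUp f) with hg
      have hx : HasDerivAt (fun y : ℝ => (y : ℂ)) 1 x := ofRealCLM.hasDerivAt
      have h1 : HasDerivAt (fun y : ℝ => 1 + (y : ℂ) ^ 2) (2 * (x : ℂ)) x := by
        simpa using (hx.pow 2).const_add (1 : ℂ)
      have h2 := h1.mul (g.hasDerivAt x)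
      have h3 := (hx.mul (u.hasDerivAt x)).add (v.hasDerivAt x)
      have h4 := h2.unique (h3.congr_of_eventuallyEq (Eventually.of_forall fun y => huv y))
      rw [pow_succ' diff, Module.End.mul_apply, ← hg]
      change (1 + (x : ℂ) ^ 2) * diffFun (lam + 1 / 2) g x =
        x * (diffFun lam u x - v x) + (diffFun lam v x + u x)
      simp only [diffFun]
      linear_combination (1 + (x : ℂ) ^ 2) * h4 + (2 * lam - 1) * x * huv x
    · refine (map_sub_le_add _ _ _).trans ?_
      have a1 := (nu_diff_le m u).trans (hm (m + 1)).1
      have a2 := (hm m).2.trans (mul_le_mul_of_nonneg_left (nu_mono (show m + j + 1 ≤ m + (j + 1) + 1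
        by omega) f) hC)
      rw [show m + 1 + j + 1 = m + (j + 1) + 1 by omega] at a1
      linarith
    · refine (map_add_le_add _ _ _).trans ?_
      have a1 := (nu_diff_le m v).trans (hm (m + 1)).2
      have a2 := (hm m).1.trans (mul_le_mul_of_nonneg_left (nu_mono (show m + j + 1 ≤ m + (j + 1) + 1
        by omega) f) hC)
      rw [show m + 1 + j + 1 = m + (j + 1) + 1 by omega] at a1
      linarith

/-- The weight at `λ + 1/2` equals `(1 + x²)^{Re λ} (1 + x²)^{-1/2} (1 + x²)`. The last factor
brings in `x u + v`, and the middle one absorbs `|x|`. Seminorm bounds can thus descend along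
`raise_induction`. -/
theorem nu_eulerUp_le (lam : ℂ) (ℓ : ℤ) (M : ℕ) : ∃ C : ℝ, 0 ≤ C ∧ ∀ f : LineModel lam ℓ,
    nu M (eulerUp f) ≤ C * nu (M + 1) f := by
  choose C hC h using diff_pow_eulerUp lam ℓ
  set K : ℝ := ∑ j ∈ Finset.range (M + 1), C j
  have hK : 0 ≤ K := Finset.sum_nonneg fun j _ => hC j
  refine ⟨(M + 1) * (2 * K), by positivity, fun f => ?_⟩
  rw [mul_assoc]
  refine nu_le_of_forall M _ fun j hj x => ?_
  obtain ⟨u, v, huv, hm⟩ := h j f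
  have hw : 0 < 1 + x ^ 2 := by positivity
  have hw1 : 1 ≤ 1 + x ^ 2 := by nlinarith [sq_nonneg x]
  have hCK : C j * nu (0 + j + 1) f ≤ K * nu (M + 1) f :=
    mul_le_mul (Finset.single_le_sum (fun j _ => hC j) (Finset.mem_range.2 (by omega)))
      (nu_mono (by omega) f) (nu_nonneg _ _) hK
  have hu := ((le_nu (le_refl 0) u x).trans (hm 0).1).trans hCK
  have hv := ((le_nu (le_refl 0) v x).trans (hm 0).2).trans hCK
  simp only [pow_zero, Module.End.one_apply] at hu hv
  have hsq : (1 + x ^ 2 : ℝ) ^ (-(1 / 2) : ℝ) ≤ 1 :=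
    Real.rpow_le_one_of_one_le_of_nonpos hw1 (by norm_num)
  have hx : (1 + x ^ 2 : ℝ) ^ (-(1 / 2) : ℝ) * |x| ≤ 1 := by
    rw [Real.rpow_neg hw.le, ← Real.sqrt_eq_rpow, inv_mul_le_one₀ (Real.sqrt_pos.2 hw)]
    exact Real.abs_le_sqrt (by linarith)
  have e2 : (1 + x ^ 2) = ‖(1 + (x : ℂ) ^ 2)‖ := by
    rw [← ofReal_pow, ← ofReal_one, ← ofReal_add, norm_real, Real.norm_of_nonneg hw.le]
  have e3 : (1 + x ^ 2) * ‖(diff ^ j) (eulerUp f) x‖ ≤ |x| * ‖u x‖ + ‖v x‖ := by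
    rw [e2, ← norm_mul, huv]
    refine (norm_add_le _ _).trans (le_of_eq ?_)
    rw [norm_mul, norm_real, Real.norm_eq_abs]
  have e4 : (1 + x ^ 2) ^ (lam + 1 / 2).re =
      (1 + x ^ 2) ^ lam.re * (1 + x ^ 2) ^ (-(1 / 2) : ℝ) * (1 + x ^ 2) := by
    rw [← Real.rpow_add hw, ← Real.rpow_add_one hw.ne']
    congr 1
    simp
    ring
  set W := (1 + x ^ 2) ^ lam.re
  set s := (1 + x ^ 2) ^ (-(1 / 2) : ℝ)
  have hW : 0 < W := by positivity
  have hs : 0 < s := by positivity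
  rw [e4]
  calc W * s * (1 + x ^ 2) * ‖(diff ^ j) (eulerUp f) x‖
      = W * s * ((1 + x ^ 2) * ‖(diff ^ j) (eulerUp f) x‖) := by ring
    _ ≤ W * s * (|x| * ‖u x‖ + ‖v x‖) := mul_le_mul_of_nonneg_left e3 (by positivity)
    _ = (s * |x|) * (W * ‖u x‖) + s * (W * ‖v x‖) := by ring
    _ ≤ 1 * (K * nu (M + 1) f) + 1 * (K * nu (M + 1) f) := by
        have := nu_nonneg (M + 1) f
        gcongr
    _ = 2 * K * nu (M + 1) f := by ring

/-! ### The regularized integral -/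

/-- The recursion by which each property of the regularized integral passes from `λ + 1/2` to `λ`;
the case `k = 0` of the hypothesis permits the division. -/
theorem eulerUp_inj_regInt (h : ∀ k : ℕ, 2 * lam - 1 + k ≠ 0) (f : LineModel lam ℓ) :
    f.regInt = (2 * lam - 1)⁻¹ * (eulerUp f).regInt := by
  have h0 : 2 * lam - 1 ≠ 0 := by simpa using h 0
  rw [regInt_eulerUp h, inv_mul_cancel_left₀ h0]

theorem regInt_add (h : ∀ k : ℕ, 2 * lam - 1 + k ≠ 0) (f g : LineModel lam ℓ) :
    (f + g).regInt = f.regInt + g.regInt := by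
  refine raise_induction (P := fun lam ℓ => ∀ f g : LineModel lam ℓ,
    (f + g).regInt = f.regInt + g.regInt) (fun lam ℓ hl f g => ?_) (fun lam ℓ h ih f g => ?_)
    lam ℓ h f g
  · simp only [regInt_eq_integral hl]
    exact integral_add (integrable_of_one_half_lt hl f) (integrable_of_one_half_lt hl g)
  · rw [eulerUp_inj_regInt h, map_add, ih, eulerUp_inj_regInt h f, eulerUp_inj_regInt h g, mul_add]

theorem regInt_smul (h : ∀ k : ℕ, 2 * lam - 1 + k ≠ 0) (c : ℂ) (f : LineModel lam ℓ) :
    (c • f).regInt = c * f.regInt := by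
  refine raise_induction (P := fun lam ℓ => ∀ f : LineModel lam ℓ,
    (c • f).regInt = c * f.regInt) (fun lam ℓ hl f => ?_) (fun lam ℓ h ih f => ?_)
    lam ℓ h f
  · simp only [regInt_eq_integral hl]
    exact integral_const_mul c _
  · rw [eulerUp_inj_regInt h, map_smul, ih, eulerUp_inj_regInt h f]
    ring

/-- For large `Re λ` this is the integral of the derivative of an integrable function. It descends
because the Euler operator and differentiation commute once the parameters are adjusted. It is
needed for translation invariance. -/
theorem regInt_derivUp (h : ∀ k : ℕ, 2 * lam - 1 + k ≠ 0) (f : LineModel lam ℓ) :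
    (derivUp f).regInt = 0 := by
  refine raise_induction (P := fun lam ℓ => ∀ f : LineModel lam ℓ,
    (derivUp f).regInt = 0) (fun lam ℓ hl f => ?_) (fun lam ℓ h ih f => ?_)
    lam ℓ h f
  · have hl' : 1 / 2 < (lam + 1 / 2).re := by simp; linarith
    rw [regInt_eq_integral hl']
    exact integral_eq_zero_of_hasDerivAt_of_integrable f.hasDerivAt
      (integrable_of_one_half_lt hl' (derivUp f)) (integrable_of_one_half_lt hl f)
  · have h' : ∀ k : ℕ, 2 * (lam + 1 / 2) - 1 + k ≠ 0 := fun k hk => h (k + 1) (by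
      push_cast
      linear_combination hk)
    have e : eulerUp (derivUp f) = derivUp (eulerUp f) := by
      refine DFunLike.ext _ _ fun x => ?_
      have hx : HasDerivAt (fun y : ℝ => (y : ℂ)) 1 x := ofRealCLM.hasDerivAt
      have h1 : HasDerivAt (eulerUp f) _ x :=
        (hx.mul ((derivUp f).hasDerivAt x)).add ((f.hasDerivAt x).const_mul (2 * lam))
      rw [derivUp_apply, h1.deriv, eulerUp_apply, derivUp_apply]
      ring
    rw [eulerUp_inj_regInt h', e, ih, mul_zero]

/-- The Euler operator does not commute with translation by `t`: the defect is `t` times a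
translated derivative. Its regularized integral vanishes by the induction hypothesis and
`regInt_derivUp`. -/
theorem regInt_upperUnip (h : ∀ k : ℕ, 2 * lam - 1 + k ≠ 0) (t : ℝ) (f : LineModel lam ℓ) :
    (act (upperUnip t) f).regInt = f.regInt := by
  refine raise_induction (P := fun lam ℓ => ∀ f : LineModel lam ℓ,
    (act (upperUnip t) f).regInt = f.regInt) (fun lam ℓ hl f => ?_) (fun lam ℓ h ih f => ?_)
    lam ℓ h f
  · rw [regInt_eq_integral hl, regInt_eq_integral hl]
    simp only [act_upperUnip]
    exact integral_sub_right_eq_self f t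
  · have h' : ∀ k : ℕ, 2 * (lam + 1 / 2) - 1 + k ≠ 0 := fun k hk => h (k + 1) (by
      push_cast
      linear_combination hk)
    have e : eulerUp (act (upperUnip t) f) =
        act (upperUnip t) (eulerUp f) + (t : ℂ) • act (upperUnip t) (derivUp f) := by
      refine DFunLike.ext _ _ fun x => ?_
      have e1 : (act (upperUnip t) f : ℝ → ℂ) = fun x => f (x - t) := funext (act_upperUnip t f)
      have e2 : deriv (act (upperUnip t) f) x = deriv f (x - t) := by
        rw [e1, deriv_comp_sub_const]
      rw [eulerUp_apply, e2, add_apply, smul_apply, act_upperUnip, act_upperUnip, act_upperUnip,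
        eulerUp_apply, derivUp_apply]
      push_cast
      ring
    rw [eulerUp_inj_regInt h, e, regInt_add h', regInt_smul h', ih, ih, regInt_derivUp h,
      eulerUp_inj_regInt h f]
    ring

/-- `x d/dx` commutes with dilations; the factor `t⁻¹` in the commutation rule only compensates the
normalization `t^{2λ}`, which becomes `t^{2λ+1}` at `λ + 1/2`. -/
theorem regInt_diagCover (h : ∀ k : ℕ, 2 * lam - 1 + k ≠ 0) (t : ℝ) (ht : 0 < t)
    (f : LineModel lam ℓ) :
    (act (diagCover t ht) f).regInt = (t : ℂ) ^ (2 * lam - 2) * f.regInt := by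
  have ht0 : (t : ℂ) ≠ 0 := by exact_mod_cast ht.ne'
  refine raise_induction (P := fun lam ℓ => ∀ f : LineModel lam ℓ,
    (act (diagCover t ht) f).regInt = (t : ℂ) ^ (2 * lam - 2) * f.regInt)
    (fun lam ℓ hl f => ?_) (fun lam ℓ h ih f => ?_) lam ℓ h f
  · rw [regInt_eq_integral hl, regInt_eq_integral hl]
    simp only [act_diagCover]
    rw [integral_const_mul, Measure.integral_comp_mul_left f (t ^ 2), abs_of_pos (by positivity),
      cpow_sub _ _ ht0]
    have : (t : ℂ) ^ (2 : ℂ) = t ^ 2 := by norm_cast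
    rw [this]
    simp
    ring
  · have h' : ∀ k : ℕ, 2 * (lam + 1 / 2) - 1 + k ≠ 0 := fun k hk => h (k + 1) (by
      push_cast
      linear_combination hk)
    have e0 : (t : ℂ) ^ (2 * (lam + 1 / 2)) = (t : ℂ) ^ (2 * lam) * t := by
      rw [mul_add, cpow_add _ _ ht0]
      simp
    have e : eulerUp (act (diagCover t ht) f) = (t : ℂ)⁻¹ • act (diagCover t ht) (eulerUp f) := by
      refine DFunLike.ext _ _ fun x => ?_
      have e1 : HasDerivAt (act (diagCover t ht) f)
          ((t : ℂ) ^ (2 * lam) * (deriv f (t ^ 2 * x) * t ^ 2)) x := by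
        have h1 : HasDerivAt (fun y : ℝ => t ^ 2 * y) (t ^ 2) x := by
          simpa using (hasDerivAt_id x).const_mul (t ^ 2)
        have h2 := ((f.hasDerivAt (t ^ 2 * x)).scomp x h1).const_mul ((t : ℂ) ^ (2 * lam))
        have h3 : (act (diagCover t ht) f : ℝ → ℂ) =
          fun x => (t : ℂ) ^ (2 * lam) * f (t ^ 2 * x) := funext (act_diagCover t ht f)
        rw [h3]
        refine h2.congr_deriv ?_
        rw [real_smul]
        push_cast
        ring
      rw [eulerUp_apply, e1.deriv, smul_apply, act_diagCover, act_diagCover, eulerUp_apply, e0]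
      push_cast
      field_simp
    rw [eulerUp_inj_regInt h, e, regInt_smul h', ih, eulerUp_inj_regInt h f, cpow_sub _ _ ht0,
      cpow_sub _ _ ht0, e0]
    field_simp

theorem norm_regInt_le (h : ∀ k : ℕ, 2 * lam - 1 + k ≠ 0) :
    ∃ (C : ℝ) (M : ℕ), 0 ≤ C ∧ ∀ f : LineModel lam ℓ, ‖f.regInt‖ ≤ C * nu M f := by
  refine raise_induction (P := fun lam ℓ => ∃ (C : ℝ) (M : ℕ), 0 ≤ C ∧
    ∀ f : LineModel lam ℓ, ‖f.regInt‖ ≤ C * nu M f)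
    (fun lam ℓ hl => ?_) (fun lam ℓ h ih => ?_) lam ℓ h
  · obtain ⟨C, hC, hf⟩ := integral_norm_iteratedDeriv_le lam ℓ (m := 0) (by simp; linarith)
    refine ⟨C, 0, hC, fun f => ?_⟩
    rw [regInt_eq_integral hl]
    exact (norm_integral_le_integral_norm _).trans (by simpa using hf f)
  · obtain ⟨C, M, hC, hf⟩ := ih
    obtain ⟨K, hK, hg⟩ := nu_eulerUp_le lam ℓ M
    refine ⟨‖(2 * lam - 1)⁻¹‖ * (C * K), M + 1, by positivity, fun f => ?_⟩
    rw [eulerUp_inj_regInt h, norm_mul, mul_assoc]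
    refine mul_le_mul_of_nonneg_left ((hf _).trans ?_) (norm_nonneg _)
    rw [mul_assoc]
    exact mul_le_mul_of_nonneg_left (hg f) hC

end LineModel

namespace LineModel

variable {lam : ℂ} {ℓ : ℤ}

/-! ### The generalized Fourier transform -/

theorem fourier_zero (f : LineModel lam ℓ) : f.fourier 0 = f.regInt := by
  simp [fourier, regInt]

theorem norm_exp_two_pi (x t : ℝ) : ‖exp (2 * Real.pi * I * x * t)‖ = 1 := by
  have : (2 * Real.pi * I * x * t : ℂ) = ((2 * Real.pi * x * t : ℝ) : ℂ) * I := by push_cast; ring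
  rw [this, norm_exp_ofReal_mul_I]

theorem integrable_mul_exp {g : ℝ → ℂ} (hg : Integrable g) (t : ℝ) :
    Integrable fun x : ℝ => g x * exp (2 * Real.pi * I * x * t) := by
  refine hg.mono (hg.aestronglyMeasurable.mul
    (Continuous.aestronglyMeasurable (by fun_prop))) (Eventually.of_forall fun x => ?_)
  rw [norm_mul, norm_exp_two_pi, mul_one]

/-- The formula for `(ℱf)(t)` with `m` derivatives. -/
def fourierAux (f : LineModel lam ℓ) (m : ℕ) (t : ℝ) : ℂ :=
  (-1 / (2 * Real.pi * I * t)) ^ m * ∫ x : ℝ, iteratedDeriv m f x * exp (2 * Real.pi * I * x * t)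

theorem fourierAux_succ {m : ℕ} (hm : 1 < 2 * lam.re + m) (f : LineModel lam ℓ) {t : ℝ}
    (ht : t ≠ 0) : f.fourierAux (m + 1) t = f.fourierAux m t := by
  have htc : (2 * Real.pi * I * t : ℂ) ≠ 0 := by
    simp [Real.pi_ne_zero, ht]
  have h1 := integrable_mul_exp (integrable_iteratedDeriv hm f) t
  have h2 := integrable_mul_exp (integrable_iteratedDeriv (m := m + 1) (by push_cast; linarith) f) t
  have hd : ∀ x : ℝ, HasDerivAt (fun x : ℝ => iteratedDeriv m f x * exp (2 * Real.pi * I * x * t))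
      (iteratedDeriv (m + 1) f x * exp (2 * Real.pi * I * x * t) +
        (2 * Real.pi * I * t) * (iteratedDeriv m f x * exp (2 * Real.pi * I * x * t))) x := by
    intro x
    have a1 : HasDerivAt (iteratedDeriv m f) (iteratedDeriv (m + 1) f x) x := by
      rw [iteratedDeriv_succ]
      exact ((f.contDiff.differentiable_iteratedDeriv m
        (by exact_mod_cast ENat.natCast_lt_top m)) x).hasDerivAt
    have hx : HasDerivAt (fun y : ℝ => (y : ℂ)) 1 x := ofRealCLM.hasDerivAt
    have a2 := (((hx.const_mul (2 * Real.pi * I)).mul_const (t : ℂ))).cexp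
    refine (a1.mul a2).congr_deriv ?_
    ring
  have h3 := integral_eq_zero_of_hasDerivAt_of_integrable hd (h2.add (h1.const_mul _)) h1
  rw [integral_add h2 (h1.const_mul _), integral_const_mul] at h3
  rw [fourierAux, fourierAux, eq_neg_of_add_eq_zero_left h3, pow_succ]
  have h4 : -1 / (2 * Real.pi * I * t : ℂ) * (2 * Real.pi * I * t) = -1 := div_mul_cancel₀ _ htc
  linear_combination (-((-1 / (2 * Real.pi * I * t : ℂ)) ^ m *
    ∫ x : ℝ, iteratedDeriv m f x * exp (2 * Real.pi * I * x * t))) * h4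

/-- The number of derivatives used in the definition of the Fourier transform. -/
def minOrder (lam : ℂ) : ℕ := ⌊1 - 2 * lam.re⌋₊ + 1

theorem one_lt_of_minOrder_le {m : ℕ} (hm : minOrder lam ≤ m) : 1 < 2 * lam.re + m := by
  have h := Nat.lt_floor_add_one (1 - 2 * lam.re)
  have h2 : (minOrder lam : ℝ) ≤ m := by exact_mod_cast hm
  rw [minOrder] at h2
  push_cast at h2
  linarith

/-- The number of derivatives may be increased at will, by integration by parts without boundary
terms. This yields decay of any polynomial order in `t`. -/
theorem fourier_eq {m : ℕ} (hm : minOrder lam ≤ m) (f : LineModel lam ℓ) {t : ℝ} (ht : t ≠ 0) :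
    f.fourier t = f.fourierAux m t := by
  induction m, hm using Nat.le_induction with
  | base => simp [fourier, fourierAux, minOrder, ht]
  | succ m hm ih => rw [ih, fourierAux_succ (one_lt_of_minOrder_le hm) f ht]

theorem fourier_add (h : ∀ k : ℕ, 2 * lam - 1 + k ≠ 0) (f g : LineModel lam ℓ) (t : ℝ) :
    (f + g).fourier t = f.fourier t + g.fourier t := by
  by_cases ht : t = 0
  · rw [ht, fourier_zero, fourier_zero, fourier_zero, regInt_add h]
  · have hm := one_lt_of_minOrder_le (lam := lam) (le_refl _)
    rw [fourier_eq le_rfl _ ht, fourier_eq le_rfl _ ht, fourier_eq le_rfl _ ht]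
    simp only [fourierAux]
    rw [← mul_add, ← integral_add (integrable_mul_exp (integrable_iteratedDeriv hm f) t)
      (integrable_mul_exp (integrable_iteratedDeriv hm g) t)]
    congr 2
    funext x
    have e : iteratedDeriv (minOrder lam) (f + g : LineModel lam ℓ) x =
        iteratedDeriv (minOrder lam) f x + iteratedDeriv (minOrder lam) g x :=
      iteratedDeriv_add ((f.contDiff.of_le (by exact_mod_cast le_top)).contDiffAt)
        ((g.contDiff.of_le (by exact_mod_cast le_top)).contDiffAt)
    rw [e, add_mul]

theorem fourier_smul (h : ∀ k : ℕ, 2 * lam - 1 + k ≠ 0) (c : ℂ) (f : LineModel lam ℓ) (t : ℝ) :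
    (c • f).fourier t = c * f.fourier t := by
  by_cases ht : t = 0
  · rw [ht, fourier_zero, fourier_zero, regInt_smul h]
  · rw [fourier_eq le_rfl _ ht, fourier_eq le_rfl _ ht]
    simp only [fourierAux]
    rw [mul_left_comm c, ← integral_const_mul c]
    congr 2
    funext x
    have e : iteratedDeriv (minOrder lam) (c • f : LineModel lam ℓ) x =
        c * iteratedDeriv (minOrder lam) f x := iteratedDeriv_const_smul_field c f
    rw [e, mul_assoc]

theorem fourier_upperUnip (h : ∀ k : ℕ, 2 * lam - 1 + k ≠ 0) (s : ℝ) (f : LineModel lam ℓ)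
    (t : ℝ) : (act (upperUnip s) f).fourier t = exp (2 * Real.pi * I * s * t) * f.fourier t := by
  by_cases ht : t = 0
  · rw [ht, fourier_zero, fourier_zero, regInt_upperUnip h]
    simp
  · rw [fourier_eq le_rfl _ ht, fourier_eq le_rfl _ ht]
    simp only [fourierAux]
    rw [mul_left_comm (exp _), ← integral_const_mul (exp _)]
    congr 1
    have e : iteratedDeriv (minOrder lam) (act (upperUnip s) f) =
        fun x => iteratedDeriv (minOrder lam) f (x - s) := by
      rw [show (act (upperUnip s) f : ℝ → ℂ) = fun x => f (x - s) from funext (act_upperUnip s f),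
        iteratedDeriv_comp_sub_const]
    rw [e, ← integral_sub_right_eq_self (fun x : ℝ => exp (2 * Real.pi * I * s * t) *
      (iteratedDeriv (minOrder lam) f x * exp (2 * Real.pi * I * x * t))) s]
    congr 1
    funext x
    rw [mul_left_comm, ← Complex.exp_add]
    congr 2
    push_cast
    ring

theorem fourier_diagCover (h : ∀ k : ℕ, 2 * lam - 1 + k ≠ 0) (r : ℝ) (hr : 0 < r)
    (f : LineModel lam ℓ) (t : ℝ) :
    (act (diagCover r hr) f).fourier t = (r : ℂ) ^ (2 * lam - 2) * f.fourier (t / r ^ 2) := by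
  by_cases ht : t = 0
  · rw [ht, zero_div, fourier_zero, fourier_zero, regInt_diagCover h]
  · have ht' : t / r ^ 2 ≠ 0 := by positivity
    have hrc : (r : ℂ) ≠ 0 := by exact_mod_cast hr.ne'
    have htc : (t : ℂ) ≠ 0 := by exact_mod_cast ht
    rw [fourier_eq le_rfl _ ht, fourier_eq le_rfl _ ht']
    simp only [fourierAux]
    set m := minOrder lam with hm
    have e : iteratedDeriv m (act (diagCover r hr) f) =
        fun x => (r : ℂ) ^ (2 * lam) * ((r : ℂ) ^ (2 * m) * iteratedDeriv m f (r ^ 2 * x)) := by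
      rw [show (act (diagCover r hr) f : ℝ → ℂ) = (r : ℂ) ^ (2 * lam) • fun x => f (r ^ 2 * x) from
        funext (act_diagCover r hr f)]
      funext x
      have : iteratedDeriv m (fun x => f (r ^ 2 * x)) x =
          ((r ^ 2) ^ m : ℝ) • iteratedDeriv m f (r ^ 2 * x) :=
        congrFun (iteratedDeriv_comp_const_smul (n := m)
          (f.contDiff.of_le (by exact_mod_cast le_top)) (r ^ 2)) x
      rw [iteratedDeriv_const_smul_field, this, real_smul, smul_eq_mul, pow_mul]
      push_cast
      ring
    have e1 : ∀ x : ℝ, iteratedDeriv m (act (diagCover r hr) f) x * exp (2 * Real.pi * I * x * t) =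
        ((r : ℂ) ^ (2 * lam) * (r : ℂ) ^ (2 * m)) *
          ((fun y : ℝ => iteratedDeriv m f y * exp (2 * Real.pi * I * y * (t / r ^ 2 : ℝ)))
            (r ^ 2 * x)) := by
      intro x
      have : (2 * Real.pi * I * x * t : ℂ) =
          2 * Real.pi * I * (r ^ 2 * x : ℝ) * (t / r ^ 2 : ℝ) := by
        push_cast
        field_simp
      rw [e, this]
      ring
    rw [integral_congr_ae (Eventually.of_forall e1), integral_const_mul,
      Measure.integral_comp_mul_left
        (fun y : ℝ => iteratedDeriv m f y * exp (2 * Real.pi * I * y * (t / r ^ 2 : ℝ))) (r ^ 2), abs_of_pos (by positivity),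
      cpow_sub _ _ hrc, real_smul]
    have e2 : (r : ℂ) ^ (2 : ℂ) = r ^ 2 := by norm_cast
    have e3 : (-1 / (2 * Real.pi * I * (t / r ^ 2 : ℝ)) : ℂ) ^ m =
        (-1 / (2 * Real.pi * I * t)) ^ m * (r : ℂ) ^ (2 * m) := by
      rw [pow_mul, ← mul_pow]
      congr 1
      push_cast
      field_simp
    rw [e2, e3]
    push_cast
    field_simp

theorem norm_fourier_le (lam : ℂ) (ℓ : ℤ) {m : ℕ} (hm : minOrder lam ≤ m) : ∃ C : ℝ, 0 ≤ C ∧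
    ∀ (f : LineModel lam ℓ) (t : ℝ), t ≠ 0 → ‖f.fourier t‖ ≤ C * nu m f * (|t| ^ m)⁻¹ := by
  obtain ⟨C, hC, h⟩ := integral_norm_iteratedDeriv_le lam ℓ (one_lt_of_minOrder_le hm)
  refine ⟨(2 * Real.pi)⁻¹ ^ m * C, by positivity, fun f t ht => ?_⟩
  rw [fourier_eq hm f ht, fourierAux, norm_mul, norm_pow]
  have e : ‖(-1 / (2 * Real.pi * I * t) : ℂ)‖ = (2 * Real.pi)⁻¹ * |t|⁻¹ := by
    simp [abs_of_pos Real.pi_pos]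
    ring
  rw [e, mul_pow, inv_pow |t|]
  have h2 : ‖∫ x : ℝ, iteratedDeriv m f x * exp (2 * Real.pi * I * x * t)‖ ≤ C * nu m f := by
    refine (norm_integral_le_integral_norm _).trans (le_trans (le_of_eq ?_) (h f))
    congr 1
    funext x
    rw [norm_mul, norm_exp_two_pi, mul_one]
  calc (2 * Real.pi)⁻¹ ^ m * (|t| ^ m)⁻¹ * _ ≤ (2 * Real.pi)⁻¹ ^ m * (|t| ^ m)⁻¹ * (C * nu m f) :=
        mul_le_mul_of_nonneg_left h2 (by positivity)
    _ = _ := by ring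

/-- The weight is compatible with inversion: `(1 + y²)^{Re λ} |f_∞(y)|` equals the weighted size of
`f` at `-1/y`. Let `y → 0`. -/
theorem norm_atInfty_le (f : LineModel lam ℓ) : ‖f.atInfty‖ ≤ nu 0 f := by
  have hc : Continuous fun y : ℝ => (1 + y ^ 2) ^ lam.re * ‖f.inf y‖ := by
    refine Continuous.mul ?_ f.inf.continuous.norm
    exact (continuous_const.add (continuous_id.pow 2)).rpow_const
      (fun x => Or.inl (ne_of_gt (by have := sq_nonneg x; simp; positivity)))
  have h0 : Tendsto (fun y : ℝ => (1 + y ^ 2) ^ lam.re * ‖f.inf y‖) (𝓝[≠] 0) (𝓝 ‖f.atInfty‖) := by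
    have := (hc.tendsto 0).mono_left (nhdsWithin_le_nhds (s := {0}ᶜ))
    simpa [atInfty] using this
  refine le_of_tendsto h0 ?_
  filter_upwards [self_mem_nhdsWithin] with y hy
  have hy0 : y ≠ 0 := hy
  refine le_trans (le_of_eq ?_) (le_nu (le_refl 0) f (-1 / y))
  have e2 : ‖sgnPow ℓ y‖ = 1 := by
    unfold sgnPow
    split_ifs <;> simp
  have hyp : 0 < |y| := abs_pos.2 hy0
  rw [inf_apply f hy0, norm_mul, norm_mul, e2, one_mul, norm_cpow_eq_rpow_re_of_pos hyp]
  have e3 : (-2 * lam).re = -(2 * lam.re) := by simp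
  have e4 : |y| ^ (2 : ℝ) = y ^ 2 := by norm_num
  rw [e3, Real.rpow_neg (abs_nonneg _), Real.rpow_mul (abs_nonneg _), e4, ← mul_assoc,
    ← div_eq_mul_inv, ← Real.div_rpow (by positivity) (by positivity), pow_zero,
    Module.End.one_apply]
  congr 2
  field_simp
  ring

end LineModel

/-! ### The two sides of the summation formula as distributions. -/

theorem summable_inv_one_add_abs_sq : Summable fun n : ℤ => ((1 + |(n : ℝ)|) ^ 2)⁻¹ := by
  have h := (Real.summable_one_div_int_pow (p := 2)).2 (by norm_num)
  refine Summable.of_norm_bounded_eventually h ?_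
  filter_upwards [(Set.finite_singleton (0 : ℤ)).compl_mem_cofinite] with n hn
  have hn0 : (n : ℝ) ≠ 0 := by simpa using hn
  rw [norm_inv, one_div, Real.norm_of_nonneg (by positivity)]
  refine inv_anti₀ (by positivity) ?_
  rw [← sq_abs (n : ℝ)]
  exact pow_le_pow_left₀ (abs_nonneg _) (by linarith) 2

namespace LineModel

variable {lam : ℂ} {ℓ : ℤ}

theorem norm_coeff_mul_fourier_le (h : ∀ k : ℕ, 2 * lam - 1 + k ≠ 0) {γ : ℤ → ℂ}
    (hγ : PolyGrowth γ) {c : ℝ} (hc : 0 < c) : ∃ (C : ℝ) (M : ℕ), 0 ≤ C ∧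
      ∀ (f : LineModel lam ℓ) (n : ℤ),
        ‖γ n * f.fourier (n / c)‖ ≤ C * nu M f * ((1 + |(n : ℝ)|) ^ 2)⁻¹ := by
  obtain ⟨A, k, hA⟩ := hγ
  have hA0 : 0 ≤ A := by
    have := (norm_nonneg _).trans (hA 0)
    simpa using this
  obtain ⟨C0, M0, hC0, h0⟩ := norm_regInt_le (lam := lam) (ℓ := ℓ) h
  -- Of the `m` derivatives, `minOrder lam` ensure integrability, `k` offset the growth of `γ`, and
  -- `2` make the series converge. The frequency `n = 0` is bounded separately through
  -- `norm_regInt_le`.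
  obtain ⟨C1, hC1, h1⟩ := norm_fourier_le lam ℓ (m := minOrder lam + k + 2) (by omega)
  set m := minOrder lam + k + 2 with hm
  refine ⟨A * C0 + A * (C1 * (2 * c) ^ m), max M0 m, by positivity, fun f n => ?_⟩
  have hn0 := nu_mono (le_max_left M0 m) f
  have hn1 := nu_mono (le_max_right M0 m) f
  have hnn := nu_nonneg (max M0 m) f
  have hnm := nu_nonneg m f
  rw [norm_mul]
  by_cases hn : n = 0
  · subst hn
    have a1 : ‖γ 0‖ ≤ A := by simpa using hA 0
    have a2 := (h0 f).trans (mul_le_mul_of_nonneg_left hn0 hC0)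
    simp only [Int.cast_zero, zero_div, abs_zero, add_zero, one_pow, inv_one, mul_one, fourier_zero]
    have a3 := mul_le_mul a1 a2 (norm_nonneg _) hA0
    have a4 : 0 ≤ A * (C1 * (2 * c) ^ m) * nu (max M0 m) f := by positivity
    nlinarith
  · have hnr : (n : ℝ) ≠ 0 := by exact_mod_cast hn
    have a2 := h1 f (n / c) (div_ne_zero hnr hc.ne')
    have hn1' : 1 ≤ |(n : ℝ)| := by
      have := Int.one_le_abs hn
      exact_mod_cast this
    set u := 1 + |(n : ℝ)| with hu
    have hupos : 0 < u := by positivity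
    -- The constant `2c` comes from `1 + |n| ≤ 2|n|` for `n ≠ 0`.
    have a3 : (|(n / c : ℝ)| ^ m)⁻¹ ≤ (2 * c) ^ m * (u ^ m)⁻¹ := by
      rw [← inv_pow, ← inv_pow, ← mul_pow]
      refine pow_le_pow_left₀ (by positivity) ?_ m
      rw [abs_div, abs_of_pos hc, inv_div, ← div_eq_mul_inv,
        div_le_div_iff₀ (by linarith) hupos]
      nlinarith
    have a4 : u ^ k * (u ^ m)⁻¹ ≤ (u ^ 2)⁻¹ := by
      have e : u ^ m = u ^ (minOrder lam) * u ^ k * u ^ 2 := by rw [hm, pow_add, pow_add]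
      have h1u : 1 ≤ u ^ (minOrder lam) := one_le_pow₀ (by linarith)
      have e2 : u ^ k * (u ^ m)⁻¹ = (u ^ (minOrder lam))⁻¹ * (u ^ 2)⁻¹ := by
        rw [e]
        field_simp
      rw [e2]
      exact mul_le_of_le_one_left (by positivity) (inv_le_one_of_one_le₀ h1u)
    calc ‖γ n‖ * ‖f.fourier (n / c)‖
        ≤ (A * u ^ k) * (C1 * nu m f * ((2 * c) ^ m * (u ^ m)⁻¹)) := by
          refine mul_le_mul (hA n) (a2.trans (mul_le_mul_of_nonneg_left a3 (by positivity)))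
            (norm_nonneg _) (by positivity)
      _ = A * (C1 * (2 * c) ^ m) * nu m f * (u ^ k * (u ^ m)⁻¹) := by ring
      _ ≤ A * (C1 * (2 * c) ^ m) * nu (max M0 m) f * (u ^ 2)⁻¹ := by gcongr
      _ ≤ _ := by
        refine mul_le_mul_of_nonneg_right ?_ (by positivity)
        refine mul_le_mul_of_nonneg_right ?_ hnn
        have : 0 ≤ A * C0 := by positivity
        linarith

theorem summable_coeff_mul_fourier (h : ∀ k : ℕ, 2 * lam - 1 + k ≠ 0) {γ : ℤ → ℂ}
    (hγ : PolyGrowth γ) {c : ℝ} (hc : 0 < c) (f : LineModel lam ℓ) :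
    Summable fun n : ℤ => γ n * f.fourier (n / c) := by
  obtain ⟨C, M, hC, hb⟩ := norm_coeff_mul_fourier_le (ℓ := ℓ) h hγ hc
  exact Summable.of_norm_bounded (summable_inv_one_add_abs_sq.mul_left _) (hb f)

/-- The functional `f ↦ γ(∞) f(∞) + ∑ γ(n) (ℱf)(n / c)`. -/
def sumForm (γ : ℤ → ℂ) (γinf : ℂ) (c : ℝ) (f : LineModel lam ℓ) : ℂ :=
  γinf * f.atInfty + ∑' n : ℤ, γ n * f.fourier (n / c)

/-- `sumForm` as a linear functional. -/
def sumLinear (h : ∀ k : ℕ, 2 * lam - 1 + k ≠ 0) {γ : ℤ → ℂ} (hγ : PolyGrowth γ) (γinf : ℂ)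
    {c : ℝ} (hc : 0 < c) : LineModel lam ℓ →ₗ[ℂ] ℂ where
  toFun f := sumForm γ γinf c f
  map_add' f g := by
    simp only [sumForm, atInfty_add, fourier_add h, mul_add]
    rw [(summable_coeff_mul_fourier h hγ hc f).tsum_add (summable_coeff_mul_fourier h hγ hc g)]
    ring
  map_smul' a f := by
    simp only [sumForm, atInfty_smul, fourier_smul h, RingHom.id_apply, smul_eq_mul]
    rw [mul_add, ← tsum_mul_left]
    simp only [mul_left_comm]

theorem continuous_sumLinear (h : ∀ k : ℕ, 2 * lam - 1 + k ≠ 0) {γ : ℤ → ℂ} (hγ : PolyGrowth γ)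
    (γinf : ℂ) {c : ℝ} (hc : 0 < c) : Continuous (sumLinear (ℓ := ℓ) h hγ γinf hc) := by
  obtain ⟨C, M, hC, hb⟩ := norm_coeff_mul_fourier_le (ℓ := ℓ) h hγ hc
  refine continuous_of_bound _ M (‖γinf‖ + C * ∑' n : ℤ, ((1 + |(n : ℝ)|) ^ 2)⁻¹) fun f => ?_
  have h1 := tsum_of_norm_bounded (summable_inv_one_add_abs_sq.mul_left (C * nu M f)).hasSum (hb f)
  rw [tsum_mul_left] at h1
  have h2 : ‖γinf * f.atInfty‖ ≤ ‖γinf‖ * nu M f := by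
    rw [norm_mul]
    exact mul_le_mul_of_nonneg_left ((norm_atInfty_le f).trans (nu_mono (Nat.zero_le M) f))
      (norm_nonneg _)
  refine (norm_add_le _ _).trans ((add_le_add h2 h1).trans (le_of_eq ?_))
  ring

/-- `sumForm` as a distribution. -/
def sumDistrib (h : ∀ k : ℕ, 2 * lam - 1 + k ≠ 0) {γ : ℤ → ℂ} (hγ : PolyGrowth γ) (γinf : ℂ)
    {c : ℝ} (hc : 0 < c) : Distrib lam ℓ :=
  ⟨sumLinear h hγ γinf hc, continuous_sumLinear h hγ γinf hc⟩

theorem sumDistrib_apply (h : ∀ k : ℕ, 2 * lam - 1 + k ≠ 0) {γ : ℤ → ℂ} (hγ : PolyGrowth γ)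
    (γinf : ℂ) {c : ℝ} (hc : 0 < c) (f : LineModel lam ℓ) :
    sumDistrib h hγ γinf hc f = sumForm γ γinf c f := rfl

end LineModel

/-! ### Relations in the covering group -/

namespace Cover

theorem phase_of_pos (G : Cover) {x : ℝ} (h : 0 < -G.mat 1 0 * x + G.mat 0 0) :
    G.phase x = G.root := if_pos h

/-- At a real point where both denominators are positive the phases are the roots themselves, so no
correction sign occurs. The relations below are proved by exhibiting such a point. -/
theorem root_mul_of_pos (G H : Cover) (x : ℝ) (hx : 0 < -G.mat 1 0 * x + G.mat 0 0)
    (hy : 0 < -H.mat 1 0 * ((G.mat 1 1 * x - G.mat 0 1) / (-G.mat 1 0 * x + G.mat 0 0)) +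
      H.mat 0 0) : (G * H).root = G.root * H.root := by
  have h := phase_mul G H hx.ne' hy.ne'
  rwa [phase_of_pos G hx, phase_of_pos H hy, phase_of_pos] at h
  rw [mul_mat, den_mul G.mat H.mat hx.ne']
  exact mul_pos hx hy

theorem mat_ext {g h : SL(2, ℝ)} (h00 : g 0 0 = h 0 0) (h01 : g 0 1 = h 0 1) (h10 : g 1 0 = h 1 0)
    (h11 : g 1 1 = h 1 1) : g = h := by
  ext i j
  fin_cases i <;> fin_cases j <;> assumption

theorem phase_eq_of_mat_eq {G H : Cover} (h : G.mat = H.mat) (x : ℝ) :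
    G.phase x = G.root * H.root⁻¹ * H.phase x := by
  have := H.root_ne_zero
  simp only [phase, h]
  split_ifs <;> field_simp

end Cover

theorem upperUnip_add (s t : ℝ) : upperUnip (s + t) = upperUnip s * upperUnip t := by
  refine Cover.ext_root (Cover.mat_ext ?_ ?_ ?_ ?_) ?_
  · simp [Cover.mul_entry, -Matrix.SpecialLinearGroup.coe_mul]
  · simp [Cover.mul_entry, -Matrix.SpecialLinearGroup.coe_mul, add_comm]
  · simp [Cover.mul_entry, -Matrix.SpecialLinearGroup.coe_mul]
  · simp [Cover.mul_entry, -Matrix.SpecialLinearGroup.coe_mul]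
  · rw [Cover.root_mul_of_pos _ _ 0 (by simp) (by simp)]
    simp

theorem lowerUnip_add (s t : ℝ) : lowerUnip (s + t) = lowerUnip s * lowerUnip t := by
  refine Cover.ext_root (Cover.mat_ext ?_ ?_ ?_ ?_) ?_
  · simp [Cover.mul_entry, -Matrix.SpecialLinearGroup.coe_mul]
  · simp [Cover.mul_entry, -Matrix.SpecialLinearGroup.coe_mul]
  · simp [Cover.mul_entry, -Matrix.SpecialLinearGroup.coe_mul]
  · simp [Cover.mul_entry, -Matrix.SpecialLinearGroup.coe_mul]
  · rw [Cover.root_mul_of_pos _ _ 0 (by simp) (by simp)]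
    simp

theorem weyl_mul_lowerUnip (y : ℝ) : weyl * lowerUnip y = upperUnip (-y) * weyl := by
  refine Cover.ext_root (Cover.mat_ext ?_ ?_ ?_ ?_) ?_
  · simp [Cover.mul_entry, -Matrix.SpecialLinearGroup.coe_mul]
  · simp [Cover.mul_entry, -Matrix.SpecialLinearGroup.coe_mul]
  · simp [Cover.mul_entry, -Matrix.SpecialLinearGroup.coe_mul]
  · simp [Cover.mul_entry, -Matrix.SpecialLinearGroup.coe_mul]
  · have hx : 0 < |y| + 1 := by positivity
    have h1 := neg_abs_le y
    rw [Cover.root_mul_of_pos weyl _ (|y| + 1) (by simpa using hx),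
      Cover.root_mul_of_pos _ weyl (|y| + 1) (by simp) (by simp; linarith)]
    · simp
    · simp only [lowerUnip_mat_one_zero, weyl_mat_one_one, weyl_mat_zero_one, weyl_mat_one_zero,
        weyl_mat_zero_zero, lowerUnip_mat_zero_zero]
      have e : -y * ((0 * (|y| + 1) - 1) / (- -1 * (|y| + 1) + 0)) + 1 = (y + (|y| + 1)) / (|y| + 1) := by
        field_simp
        ring
      rw [e]
      exact div_pos (by linarith) hx

/-- Follows from `diag · w · diag = w` and `weyl_mul_lowerUnip`. It carries a translated and dilated
`f_∞` back to an element acting on `f`. -/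
theorem upperUnip_mul_diagCover_mul_weyl (y r : ℝ) (hr : 0 < r) :
    upperUnip y * diagCover r hr * weyl * (diagCover r hr * lowerUnip y) = weyl := by
  have e1 : diagCover r hr * weyl * diagCover r hr = weyl := by
    refine Cover.ext_root (Cover.mat_ext ?_ ?_ ?_ ?_) ?_
    · simp [Cover.mul_entry, -Matrix.SpecialLinearGroup.coe_mul]
    · simp [Cover.mul_entry, -Matrix.SpecialLinearGroup.coe_mul, hr.ne']
    · simp [Cover.mul_entry, -Matrix.SpecialLinearGroup.coe_mul, hr.ne']
    · simp [Cover.mul_entry, -Matrix.SpecialLinearGroup.coe_mul]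
    · have h1 : (diagCover r hr * weyl).root = 1 := by
        rw [Cover.root_mul_of_pos _ _ 1 (by simpa using hr) (by simp; positivity)]
        simp
      rw [Cover.root_mul_of_pos _ _ 1, h1]
      · simp
      · simpa [Cover.mul_entry, -Matrix.SpecialLinearGroup.coe_mul] using hr
      · simpa [Cover.mul_entry, -Matrix.SpecialLinearGroup.coe_mul] using hr
  have e2 : upperUnip y * upperUnip (-y) = 1 := by
    rw [← upperUnip_add]
    refine Cover.ext_root (Cover.mat_ext ?_ ?_ ?_ ?_) ?_ <;> simp [LineModel.root_one]
  calc upperUnip y * diagCover r hr * weyl * (diagCover r hr * lowerUnip y)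
      = upperUnip y * (diagCover r hr * weyl * diagCover r hr) * lowerUnip y := by group
    _ = upperUnip y * (weyl * lowerUnip y) := by rw [e1, mul_assoc]
    _ = upperUnip y * upperUnip (-y) * weyl := by rw [weyl_mul_lowerUnip, mul_assoc]
    _ = weyl := by rw [e2, one_mul]

/-- The element `[(r⁻¹ + p q r, p r; q r, r), 1]`. -/
def bruhatCover (r : ℝ) (hr : 0 < r) (p q : ℝ) : Cover :=
  upperUnip p * (diagCover r hr * lowerUnip q)

theorem bruhatCover_mat_one_zero (r : ℝ) (hr : 0 < r) (p q : ℝ) :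
    (bruhatCover r hr p q).mat 1 0 = r * q := by
  simp [bruhatCover, Cover.mul_entry, -Matrix.SpecialLinearGroup.coe_mul]
theorem bruhatCover_mat_one_one (r : ℝ) (hr : 0 < r) (p q : ℝ) :
    (bruhatCover r hr p q).mat 1 1 = r := by
  simp [bruhatCover, Cover.mul_entry, -Matrix.SpecialLinearGroup.coe_mul]
theorem bruhatCover_mat_zero_one (r : ℝ) (hr : 0 < r) (p q : ℝ) :
    (bruhatCover r hr p q).mat 0 1 = p * r := by
  simp [bruhatCover, Cover.mul_entry, -Matrix.SpecialLinearGroup.coe_mul]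
theorem bruhatCover_mat_zero_zero (r : ℝ) (hr : 0 < r) (p q : ℝ) :
    (bruhatCover r hr p q).mat 0 0 = r⁻¹ + p * (r * q) := by
  simp [bruhatCover, Cover.mul_entry, -Matrix.SpecialLinearGroup.coe_mul]

theorem bruhatCover_root (r : ℝ) (hr : 0 < r) (p q : ℝ) : (bruhatCover r hr p q).root = 1 := by
  have h1 : (diagCover r hr * lowerUnip q).root = 1 := by
    rw [Cover.root_mul_of_pos _ _ 0 (by simpa using hr) (by simp)]
    simp
  rw [bruhatCover, Cover.root_mul_of_pos _ _ p (by simp), h1]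
  · simp
  · simpa [Cover.mul_entry, -Matrix.SpecialLinearGroup.coe_mul] using hr

theorem mat_eq_bruhatCover (G : Cover) (r : ℝ) (hr : 0 < r) (h : G.mat 1 1 = r) :
    G.mat = (bruhatCover r hr (G.mat 0 1 / r) (G.mat 1 0 / r)).mat := by
  have hd := Cover.det_mat G.mat
  rw [h] at hd
  refine Cover.mat_ext ?_ ?_ ?_ ?_
  · rw [bruhatCover_mat_zero_zero]
    field_simp
    linear_combination hd
  · rw [bruhatCover_mat_zero_one]
    field_simp
  · rw [bruhatCover_mat_one_zero]
    field_simp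
  · rw [bruhatCover_mat_one_one, h]

theorem bruhatCover_add (r : ℝ) (hr : 0 < r) (p q s t : ℝ) :
    bruhatCover r hr (s + p) (q + t) = upperUnip s * bruhatCover r hr p q * lowerUnip t := by
  simp only [bruhatCover, upperUnip_add, lowerUnip_add]
  group

namespace LineModel

variable {lam : ℂ} {ℓ : ℤ}

theorem act_eq_of_mat_eq {G H : Cover} (h : G.mat = H.mat) (f : LineModel lam ℓ) :
    act G f = (G.root * H.root⁻¹) ^ (-ℓ) • act H f := by
  refine ext_of_finite (finite_den G.mat) fun x hx => ?_
  simp only [Set.mem_ofPred_eq] at hx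
  have hx' : -H.mat 1 0 * x + H.mat 0 0 ≠ 0 := by rwa [← h]
  rw [act_apply _ _ hx, smul_apply, act_apply _ _ hx', Cover.phase_eq_of_mat_eq h, h, mul_zpow]
  ring

end LineModel

/-! ### The quadratic symbol and the theta multiplier -/

/-- By reciprocity `(a/·)` has period `4a` on odd positive integers, and `b₁ ≡ (4a - 1) b₂`.
Moreover `(a/(4a-1)) = (4a/(4a-1)) = 1`, since `4` is a square and `4a ≡ 1` mod `4a - 1`. -/
theorem jacobiSym_eq_of_add_dvd_nat {a b₁ b₂ : ℕ} (ha : a ≠ 0) (h₁ : Odd b₁) (h₂ : Odd b₂)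
    (h : 4 * a ∣ b₁ + b₂) : jacobiSym a b₁ = jacobiSym a b₂ := by
  have hpos : 1 ≤ 4 * a := by omega
  have hodd : Odd (4 * a - 1) := ⟨2 * a - 1, by omega⟩
  have : NeZero (4 * a - 1) := ⟨by omega⟩
  have : NeZero b₂ := ⟨by rintro rfl; simp at h₂⟩
  have h1 : jacobiSym a (4 * a - 1) = 1 := by
    have h4 := jacobiSym.at_four hodd
    have h5 : jacobiSym (4 * a : ℤ) (4 * a - 1) = jacobiSym 1 (4 * a - 1) := by
      refine jacobiSym.mod_left' ?_
      have : ((4 * a - 1 : ℕ) : ℤ) = 4 * a - 1 := by push_cast [hpos]; ring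
      rw [this]
      exact Int.ModEq.symm (Int.modEq_iff_dvd.2 ⟨1, by ring⟩)
    rw [jacobiSym.mul_left, h4, one_mul, jacobiSym.one_left] at h5
    exact h5
  have h2 : b₁ ≡ (4 * a - 1) * b₂ [MOD 4 * a] := by
    have e : b₁ + b₂ ≡ (4 * a - 1) * b₂ + b₂ [MOD 4 * a] := by
      have : (4 * a - 1) * b₂ + b₂ = 4 * a * b₂ := by
        obtain ⟨k, hk⟩ : ∃ k, 4 * a = k + 1 := ⟨4 * a - 1, by omega⟩
        rw [hk]
        simp
        ring
      rw [this]
      exact ((Nat.modEq_zero_iff_dvd).2 h).trans ((Nat.modEq_zero_iff_dvd).2 (dvd_mul_right _ _)).symm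
    exact Nat.ModEq.add_right_cancel' _ e
  rw [jacobiSym.mod_right' a h₁, show b₁ % (4 * a) = ((4 * a - 1) * b₂) % (4 * a) from h2,
    ← jacobiSym.mod_right' a (hodd.mul h₂), jacobiSym.mul_right, h1, one_mul]

/-- For negative `a`, split off `-1`: since `4 ∣ b₁ + b₂`, exactly one of the two is `3` mod `4`,
which produces the sign. -/
theorem jacobiSym_of_add_dvd {a : ℤ} {b₁ b₂ : ℕ} (ha : a ≠ 0) (h₁ : Odd b₁) (h₂ : Odd b₂)
    (h : 4 * a.natAbs ∣ b₁ + b₂) :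
    jacobiSym a b₁ = (if a < 0 then -1 else 1) * jacobiSym a b₂ := by
  have key := jacobiSym_eq_of_add_dvd_nat (Int.natAbs_ne_zero.2 ha) h₁ h₂ h
  rcases lt_or_gt_of_ne ha with h0 | h0
  · have e : a = -(a.natAbs : ℤ) := by omega
    rw [if_pos h0, e, jacobiSym.neg _ h₁, jacobiSym.neg _ h₂, key]
    have h4 : 4 ∣ b₁ + b₂ := (dvd_mul_right 4 _).trans h
    rcases Nat.odd_mod_four_iff.1 (Nat.odd_iff.1 h₁) with hb | hb
    · rw [ZMod.χ₄_nat_one_mod_four hb, ZMod.χ₄_nat_three_mod_four (by omega)]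
      ring
    · rw [ZMod.χ₄_nat_three_mod_four hb, ZMod.χ₄_nat_one_mod_four (by omega)]
      ring
  · have e : a = (a.natAbs : ℤ) := by omega
    rw [if_neg h0.not_gt, one_mul, e]
    exact key

/-- For `4 ∣ c` the symbol `(c/d)` depends only on `d` mod `c`, negative `d` included. The extra
sign in Shimura's convention is the one in `jacobiSym_of_add_dvd`. -/
theorem quadSymbol_eq_of_add_mul {c d k : ℤ} {r : ℕ} (hc : c ≠ 0) (h4 : 4 ∣ c) (hd : Odd d)
    (hr : d + c * k = r) : quadSymbol c d = jacobiSym c r := by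
  -- With `c = 4a`, the square factor `4` can be dropped from the symbol, so its period is `4|a| =
  -- |c|` and not `4|c|`.
  obtain ⟨a, rfl⟩ := h4
  have ha : a ≠ 0 := by rintro rfl; simp at hc
  have hrodd : Odd r := by
    have : Odd (r : ℤ) := by
      rw [← hr]
      exact hd.add_even ⟨2 * a * k, by ring⟩
    exact_mod_cast this
  have hdodd : Odd d.natAbs := Int.natAbs_odd.2 hd
  have e : ∀ b : ℕ, Odd b → jacobiSym (4 * a) b = jacobiSym a b := by
    intro b hb
    rw [jacobiSym.mul_left, jacobiSym.at_four hb, one_mul]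
  rw [quadSymbol, e _ hdodd, e _ hrodd]
  have hneg : 4 * a < 0 ↔ a < 0 := by omega
  rcases lt_or_ge d 0 with h | h
  · have hdvd : 4 * a.natAbs ∣ d.natAbs + r := by
      have h1 : ((4 * a.natAbs : ℕ) : ℤ) ∣ ((d.natAbs + r : ℕ) : ℤ) := by
        have e2 : ((d.natAbs + r : ℕ) : ℤ) = 4 * a * k := by
          push_cast
          rw [← hr, abs_of_neg h]
          ring
        rw [e2]
        push_cast
        exact Dvd.dvd.mul_right (mul_dvd_mul_left 4 ((abs_dvd a a).2 dvd_rfl)) k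
      exact_mod_cast h1
    rw [jacobiSym_of_add_dvd ha hdodd hrodd hdvd]
    simp only [hneg, h, and_true]
    split_ifs <;> simp
  · rw [if_neg (by omega), one_mul, jacobiSym.mod_right a hdodd, jacobiSym.mod_right a hrodd]
    congr 1
    have h1 : ((d.natAbs : ℕ) : ℤ) ≡ (r : ℤ) [ZMOD ((4 * a.natAbs : ℕ) : ℤ)] := by
      rw [Int.modEq_iff_dvd, ← hr]
      have e2 : d + 4 * a * k - (d.natAbs : ℤ) = 4 * a * k := by
        rw [Int.natCast_natAbs, abs_of_nonneg h]; ring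
      rw [e2]
      push_cast
      exact Dvd.dvd.mul_right (mul_dvd_mul_left 4 ((abs_dvd a a).2 dvd_rfl)) k
    exact (Int.natCast_modEq_iff.1 h1)

theorem epsilon_eq_of_emod_eq {d e : ℤ} (h : d % 4 = e % 4) : epsilon d = epsilon e := by
  simp only [epsilon, h]

theorem epsilon_ne_zero (d : ℤ) : epsilon d ≠ 0 := by
  unfold epsilon; split_ifs <;> simp

theorem epsilon_pow_four (d : ℤ) : epsilon d ^ 4 = 1 := by
  unfold epsilon; split_ifs <;> simp

theorem epsilon_sq {r : ℕ} (hr : Odd r) : epsilon r ^ 2 = ((jacobiSym (-1) r : ℤ) : ℂ) := by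
  rw [jacobiSym.at_neg_one hr]
  rcases Nat.odd_mod_four_iff.1 (Nat.odd_iff.1 hr) with h | h
  · have : ((r : ℤ) % 4) = 1 := by omega
    rw [ZMod.χ₄_nat_one_mod_four h, epsilon, if_pos this]; simp
  · have : ¬ ((r : ℤ) % 4) = 1 := by omega
    rw [ZMod.χ₄_nat_three_mod_four h, epsilon, if_neg this]; simp

/-! ### Invariance under the unipotent generators -/

namespace LineModel

variable {lam : ℂ} {ℓ : ℤ}

theorem sumForm_upperUnip (h : ∀ k : ℕ, 2 * lam - 1 + k ≠ 0) (γ : ℤ → ℂ) (γinf : ℂ) {c : ℝ}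
    (hc : 0 < c) (k : ℤ) (f : LineModel lam ℓ) :
    sumForm γ γinf c (act (upperUnip (c * k)) f) = sumForm γ γinf c f := by
  have hcc : (c : ℂ) ≠ 0 := by exact_mod_cast hc.ne'
  have e : ∀ n : ℤ, exp (2 * Real.pi * I * ((c * k : ℝ) : ℂ) * ((n / c : ℝ) : ℂ)) = 1 := by
    intro n
    rw [exp_eq_one_iff]
    refine ⟨k * n, ?_⟩
    push_cast
    field_simp
  simp only [sumForm, atInfty_upperUnip, fourier_upperUnip h, e, one_mul]

/-- Translation by `c xᵢ` multiplies the `n`-th term by `e^{2πi xᵢ n}`. For `xᵢ = m/r` and weights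
`ψ(m)` the inner sums are Gauss sums, so a twisted formula is a combination of translates. -/
theorem sum_mul_sumForm_upperUnip (h : ∀ k : ℕ, 2 * lam - 1 + k ≠ 0) {γ : ℤ → ℂ}
    (hγ : PolyGrowth γ) (γinf : ℂ) {c : ℝ} (hc : 0 < c) {ι : Type*} (s : Finset ι) (w : ι → ℂ)
    (x : ι → ℝ) (f : LineModel lam ℓ) :
    ∑ i ∈ s, w i * sumForm γ γinf c (act (upperUnip (c * x i)) f) =
      γinf * (∑ i ∈ s, w i) * f.atInfty +
        ∑' n : ℤ, γ n * (∑ i ∈ s, w i * exp (2 * Real.pi * I * x i * n)) * f.fourier (n / c) := by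
  have hcc : (c : ℂ) ≠ 0 := by exact_mod_cast hc.ne'
  have e : ∀ (i : ι) (n : ℤ), (act (upperUnip (c * x i)) f).fourier (n / c) =
      exp (2 * Real.pi * I * x i * n) * f.fourier (n / c) := by
    intro i n
    rw [fourier_upperUnip h]
    congr 2
    push_cast
    field_simp
  have hs : ∀ i ∈ s, Summable fun n : ℤ =>
      w i * (γ n * (act (upperUnip (c * x i)) f).fourier (n / c)) :=
    fun i _ => (summable_coeff_mul_fourier h hγ hc _).mul_left _
  simp only [sumForm, atInfty_upperUnip, mul_add, Finset.sum_add_distrib, ← tsum_mul_left]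
  rw [← Summable.tsum_finsetSum hs, Finset.mul_sum, Finset.sum_mul]
  congr 1
  · exact Finset.sum_congr rfl fun i _ => by ring
  · refine tsum_congr fun n => ?_
    rw [Finset.mul_sum, Finset.sum_mul]
    refine Finset.sum_congr rfl fun i _ => ?_
    rw [e]
    ring

/-- `T` is left unchanged by the operator `act G`. -/
def FixedBy (T : LineModel lam ℓ → ℂ) (G : Cover) : Prop := ∀ f, T (act G f) = T f

theorem fixedBy_one (T : LineModel lam ℓ → ℂ) : FixedBy T 1 := fun f => by rw [act_one]

theorem FixedBy.mul {T : LineModel lam ℓ → ℂ} {G H : Cover} (hG : FixedBy T G) (hH : FixedBy T H) :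
    FixedBy T (G * H) := fun f => by rw [act_mul, hG, hH]

theorem FixedBy.inv {T : LineModel lam ℓ → ℂ} {G : Cover} (hG : FixedBy T G) : FixedBy T G⁻¹ :=
  fun f => by rw [← hG, act_act_inv]

/-- An eigenvector relation for `H` depends only on the double coset of `H` by elements fixing `T`.
-/
theorem FixedBy.apply_mul_mul {T : LineModel lam ℓ → ℂ} {G K : Cover} (hG : FixedBy T G)
    (hK : FixedBy T K) {κ : ℂ} {H : Cover} :
    (∀ f, T (act (G * H * K) f) = κ * T f) ↔ ∀ f, T (act H f) = κ * T f := by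
  constructor
  · intro hH f
    have := hH (act K⁻¹ f)
    rwa [act_mul, act_mul, act_act_inv, hG, hK.inv] at this
  · intro hH f
    rw [act_mul, act_mul, hG, hH, hK]

theorem FixedBy.of_mem_closure {T : LineModel lam ℓ → ℂ} {s : Set Cover}
    (hs : ∀ G ∈ s, FixedBy T G) {G : Cover} (hG : G ∈ Subgroup.closure s) : FixedBy T G := by
  induction hG using Subgroup.closure_induction with
  | mem x hx => exact hs x hx
  | one => exact fixedBy_one T
  | mul x y _ _ hx hy => exact hx.mul hy
  | inv x _ hx => exact hx.inv

end LineModel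

open LineModel

section Summation

variable {lam : ℂ} {ℓ : ℤ} {N : ℕ} {α β : ℤ → ℂ} {αinf βinf : ℂ}

theorem SummationFormula.sumForm_inf (hsum : SummationFormula lam ℓ N α αinf β βinf)
    (f : LineModel lam ℓ) : sumForm β βinf N f.inf = sumForm α αinf 1 f := by
  have := hsum f
  simp only [sumForm, div_one]
  exact this.symm

theorem fixedBy_upperUnip (h : ∀ k : ℕ, 2 * lam - 1 + k ≠ 0) (k : ℤ) :
    FixedBy (sumForm (lam := lam) (ℓ := ℓ) α αinf 1) (upperUnip k) := fun f => by
  simpa using sumForm_upperUnip h α αinf one_pos k f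

/-- By the summation formula `T` is `S` after `w`, and `w` conjugates the lower unipotent to
translation by `-Nk`, which fixes `S`. -/
theorem fixedBy_lowerUnip (h : ∀ k : ℕ, 2 * lam - 1 + k ≠ 0) (hN : 0 < N)
    (hsum : SummationFormula lam ℓ N α αinf β βinf) (k : ℤ) :
    FixedBy (sumForm (lam := lam) (ℓ := ℓ) α αinf 1) (lowerUnip (N * k)) := fun f => by
  have hN' : (0 : ℝ) < N := by exact_mod_cast hN
  have e := sumForm_upperUnip h β βinf hN' (-k) f.inf
  rw [← hsum.sumForm_inf, ← act_weyl, ← act_mul, weyl_mul_lowerUnip, act_mul, act_weyl,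
    ← hsum.sumForm_inf, ← e]
  push_cast
  rw [mul_neg]

theorem isAutomorphic_deltaCover (h : ∀ k : ℕ, 2 * lam - 1 + k ≠ 0) (hN : 0 < N) (hα : PolyGrowth α)
    (hsum : SummationFormula lam ℓ N α αinf β βinf) :
    IsAutomorphic (DeltaCover N : Set Cover) (fun _ => 1)
      (sumDistrib (ℓ := ℓ) h hα αinf one_pos) := by
  intro G hG f
  have : FixedBy (sumForm (lam := lam) (ℓ := ℓ) α αinf 1) G := by
    refine FixedBy.of_mem_closure ?_ hG
    rintro _ (rfl | rfl)
    · simpa using fixedBy_upperUnip (ℓ := ℓ) (α := α) (αinf := αinf) h 1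
    · simpa using fixedBy_lowerUnip h hN hsum 1
  rw [one_mul]
  exact this.inv f

theorem sumForm_upperUnip_diagCover_inf (hsum : SummationFormula lam ℓ N α αinf β βinf) (y r : ℝ)
    (hr : 0 < r) (f : LineModel lam ℓ) :
    sumForm β βinf N (act (upperUnip y) (act (diagCover r hr) f.inf)) =
      sumForm α αinf 1 (act (diagCover r hr * lowerUnip y)⁻¹ f) := by
  have e : upperUnip y * diagCover r hr * weyl = weyl * (diagCover r hr * lowerUnip y)⁻¹ := by
    rw [eq_mul_inv_iff_mul_eq]
    exact upperUnip_mul_diagCover_mul_weyl y r hr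
  rw [← hsum.sumForm_inf, ← act_weyl f, ← act_weyl, ← act_mul, ← act_mul, ← act_mul, ← e, mul_assoc]

/-! ### The twisted summation formulas as relations for single elements -/

theorem sum_filter_coprime {r : ℕ} [Fact r.Prime] (ψ : DirichletCharacter ℂ r) (F : ℕ → ℂ) :
    ∑ m ∈ (Finset.range r).filter (fun m => Nat.Coprime m r), ψ (m : ZMod r) * F m =
      ∑ u : ZMod r, ψ u * F u.val := by
  have hr : NeZero r := ⟨(Fact.out : r.Prime).ne_zero⟩
  rw [Finset.sum_filter_of_ne]
  · refine Finset.sum_bij' (fun m _ => (m : ZMod r)) (fun u _ => u.val) (fun _ _ => Finset.mem_univ _)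
      (fun u _ => Finset.mem_range.2 (ZMod.val_lt u)) ?_ ?_ ?_
    · intro m hm
      exact ZMod.val_cast_of_lt (Finset.mem_range.1 hm)
    · intro u _
      exact ZMod.natCast_zmod_val u
    · intro m hm
      rw [ZMod.val_cast_of_lt (Finset.mem_range.1 hm)]
  · intro m _ hm
    by_contra hc
    refine hm ?_
    rw [MulChar.map_nonunit ψ, zero_mul]
    rwa [ZMod.isUnit_iff_coprime]

/-- On the right, `diagCover r` acting on `f_∞` supplies `r^{-2λ}` at infinity, `r^{2λ-2}` at the
frequencies, and the rescaling `n/N ↦ n/(Nr²)`. The resulting values of `S` are values of `T` by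
`sumForm_upperUnip_diagCover_inf`. -/
theorem twistedSummationFormula_iff (h : ∀ k : ℕ, 2 * lam - 1 + k ≠ 0) (hN : 0 < N)
    (hα : PolyGrowth α) (hβ : PolyGrowth β) (hsum : SummationFormula lam ℓ N α αinf β βinf)
    (χ : DirichletCharacter ℂ N) (r : ℕ) [Fact r.Prime] (hr : (0 : ℝ) < r)
    (ψ : DirichletCharacter ℂ r) :
    TwistedSummationFormula lam ℓ χ α αinf β βinf r ψ ↔ ∀ f : LineModel lam ℓ,
      ∑ u : ZMod r, ψ u * sumForm α αinf 1 (act (upperUnip (u.val / r)) f) =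
        starRingEnd ℂ (χ (r : ZMod N)) * constC ℓ r * psiStar ℓ ψ (-(N : ZMod r)) *
          ∑ v : ZMod r, psiStar ℓ ψ v *
            sumForm α αinf 1 (act (diagCover r hr * lowerUnip (N * (v.val / r)))⁻¹ f) := by
  have hN' : (0 : ℝ) < N := by exact_mod_cast hN
  have hg : ∀ (ψ : DirichletCharacter ℂ r) (n : ℤ), gaussTau ψ n =
      ∑ m ∈ (Finset.range r).filter (fun m => Nat.Coprime m r),
        ψ (m : ZMod r) * exp (2 * Real.pi * I * ((m / r : ℝ) : ℂ) * n) := by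
    intro ψ n
    refine Finset.sum_congr rfl fun m _ => ?_
    congr 2
    push_cast
    ring
  have hg0 : ∀ ψ : DirichletCharacter ℂ r, gaussTau ψ 0 =
      ∑ m ∈ (Finset.range r).filter (fun m => Nat.Coprime m r), ψ (m : ZMod r) := by
    intro ψ
    rw [hg]
    simp
  refine forall_congr' fun f => ?_
  have e1 := sum_mul_sumForm_upperUnip h hα αinf one_pos
    ((Finset.range r).filter (fun m => Nat.Coprime m r)) (fun m => ψ (m : ZMod r))
    (fun m => (m / r : ℝ)) f
  have e2 := sum_mul_sumForm_upperUnip h hβ βinf hN'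
    ((Finset.range r).filter (fun m => Nat.Coprime m r)) (fun m => psiStar ℓ ψ (m : ZMod r))
    (fun m => (m / r : ℝ)) (act (diagCover r hr) f.inf)
  simp only [← hg, ← hg0, one_mul, div_one] at e1 e2
  rw [sum_filter_coprime ψ fun m => sumForm α αinf 1 (act (upperUnip (m / r)) f)] at e1
  simp only [sumForm_upperUnip_diagCover_inf hsum] at e2
  rw [sum_filter_coprime (psiStar ℓ ψ) fun m =>
    sumForm α αinf 1 (act (diagCover r hr * lowerUnip (N * (m / r)))⁻¹ f)] at e2
  rw [e1, e2, atInfty_diagCover]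
  simp only [fourier_diagCover h]
  have e3 : ∀ n : ℤ, β n * gaussTau (psiStar ℓ ψ) n *
      (((r : ℝ) : ℂ) ^ (2 * lam - 2) * f.inf.fourier ((n : ℝ) / N / (r : ℝ) ^ 2)) =
      (r : ℂ) ^ (2 * lam - 2) *
        (β n * gaussTau (psiStar ℓ ψ) n * f.inf.fourier ((n : ℝ) / (N * (r : ℝ) ^ 2))) := by
    intro n
    rw [div_div, ofReal_natCast]
    ring
  simp only [e3, tsum_mul_left]
  rw [ofReal_natCast, mul_left_comm (βinf * _)]

/-- Orthogonality of characters. The point `u = 0` is invisible, because every character mod the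
prime `r`, the principal one included, vanishes there. -/
theorem forall_sum_dirichletCharacter_eq_zero_iff {r : ℕ} [Fact r.Prime] (X : ZMod r → ℂ) :
    (∀ ψ : DirichletCharacter ℂ r, ∑ u, ψ u * X u = 0) ↔ ∀ u, u ≠ 0 → X u = 0 := by
  have hr : NeZero r := ⟨(Fact.out : r.Prime).ne_zero⟩
  constructor
  · intro hX u hu
    have h1 : ∑ ψ : DirichletCharacter ℂ r, ψ u⁻¹ * ∑ v, ψ v * X v = 0 :=
      Finset.sum_eq_zero fun ψ _ => by rw [hX, mul_zero]
    simp only [Finset.mul_sum] at h1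
    rw [Finset.sum_comm] at h1
    have h2 : ∀ v, ∑ ψ : DirichletCharacter ℂ r, ψ u⁻¹ * (ψ v * X v) =
        (if u = v then (r.totient : ℂ) else 0) * X v := by
      intro v
      rw [← DirichletCharacter.sum_char_inv_mul_char_eq ℂ (isUnit_iff_ne_zero.2 hu) v,
        Finset.sum_mul]
      simp only [mul_assoc]
    simp only [h2, ite_mul, zero_mul, Finset.sum_ite_eq, Finset.mem_univ, if_true] at h1
    refine (mul_eq_zero.1 h1).resolve_left ?_
    have := Nat.totient_pos.2 (Fact.out : r.Prime).pos
    exact_mod_cast this.ne'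
  · intro hX ψ
    refine Finset.sum_eq_zero fun u _ => ?_
    by_cases hu : u = 0
    · rw [hu, MulChar.map_zero, zero_mul]
    · rw [hX u hu, mul_zero]

/-- The arguments multiply to `u⁻¹`, and the conjugation in `ψ*` undoes the inverse. This is the
role of the factor `ψ*(-N)`: it aligns the two character sums under `v = -(Nu)⁻¹`. -/
theorem psiStar_mul_psiStar {r : ℕ} [Fact r.Prime] (ℓ : ℤ) (ψ : DirichletCharacter ℂ r)
    {n u : ZMod r} (hn : n ≠ 0) (hu : u ≠ 0) :
    psiStar ℓ ψ (-n) * psiStar ℓ ψ (-(n * u)⁻¹) =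
      ψ u * ((quadraticChar (ZMod r) u : ℤ) : ℂ) ^ ℓ := by
  have hr : NeZero r := ⟨(Fact.out : r.Prime).ne_zero⟩
  have e : -n * -(n * u)⁻¹ = u⁻¹ := by field_simp
  have hq : ((quadraticChar (ZMod r)).ringHomComp (Int.castRingHom ℂ) ^ ℓ) u⁻¹ =
      ((quadraticChar (ZMod r) u : ℤ) : ℂ) ^ ℓ := by
    have h1 := MulChar.zpow_apply_coe ((quadraticChar (ZMod r)).ringHomComp (Int.castRingHom ℂ)) ℓ
      (Units.mk0 _ (inv_ne_zero hu))
    have h2 := map_zpow₀ (MulChar.toMonoidWithZeroHom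
      ((quadraticChar (ZMod r)).ringHomComp (Int.castRingHom ℂ))) u⁻¹ ℓ
    rw [Units.val_zpow_eq_zpow_val, Units.val_mk0] at h1
    rw [h1]
    refine h2.trans ?_
    rw [map_inv₀]
    change ((quadraticChar (ZMod r) u : ℤ) : ℂ)⁻¹ ^ ℓ = _
    rcases quadraticChar_dichotomy hu with h3 | h3 <;> rw [h3] <;> norm_num
  rw [← map_mul, e, psiStar, MulChar.mul_apply, hq, MulChar.star_eq_inv, MulChar.inv_apply', inv_inv]

/-- After the substitution `v = -(Nu)⁻¹` both sides are sums against `ψ(u)`, so orthogonality yields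
one identity for each `u ≠ 0`. Replacing `f` by its image under `B u` leaves a single group element
on the left. -/
theorem forall_twistedSummationFormula_iff (h : ∀ k : ℕ, 2 * lam - 1 + k ≠ 0) (hN : 0 < N)
    (hα : PolyGrowth α) (hβ : PolyGrowth β) (hsum : SummationFormula lam ℓ N α αinf β βinf)
    (χ : DirichletCharacter ℂ N) (r : ℕ) [Fact r.Prime] (hr : (0 : ℝ) < r)
    (hrN : (N : ZMod r) ≠ 0) :
    (∀ ψ : DirichletCharacter ℂ r, TwistedSummationFormula lam ℓ χ α αinf β βinf r ψ) ↔
      ∀ u : ZMod r, u ≠ 0 → ∀ f : LineModel lam ℓ,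
        sumForm α αinf 1 (act (bruhatCover r hr (u.val / r)
            (N * ((-((N : ZMod r) * u)⁻¹).val / r))) f) =
          starRingEnd ℂ (χ (r : ZMod N)) * constC ℓ r *
            ((quadraticChar (ZMod r) u : ℤ) : ℂ) ^ ℓ * sumForm α αinf 1 f := by
  have hr0 : NeZero r := ⟨(Fact.out : r.Prime).ne_zero⟩
  set κ : ℂ := starRingEnd ℂ (χ (r : ZMod N)) * constC ℓ r with hκ
  let B : ZMod r → Cover := fun u => diagCover r hr * lowerUnip (N * ((-((N : ZMod r) * u)⁻¹).val / r))
  let X : LineModel lam ℓ → ZMod r → ℂ := fun f u =>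
    sumForm α αinf 1 (act (upperUnip (u.val / r)) f) -
      κ * ((quadraticChar (ZMod r) u : ℤ) : ℂ) ^ ℓ * sumForm α αinf 1 (act (B u)⁻¹ f)
  -- With `0⁻¹ = 0` the map fixes `0`, so it permutes all of `ZMod r` and the sum can be reindexed
  -- without removing a point.
  have hinv : Function.Involutive fun u : ZMod r => -((N : ZMod r) * u)⁻¹ := by
    intro u
    by_cases hu : u = 0
    · simp [hu]
    · field_simp
  have key : ∀ (ψ : DirichletCharacter ℂ r), TwistedSummationFormula lam ℓ χ α αinf β βinf r ψ ↔
      ∀ f : LineModel lam ℓ, ∑ u, ψ u * X f u = 0 := by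
    intro ψ
    rw [twistedSummationFormula_iff h hN hα hβ hsum χ r hr ψ]
    refine forall_congr' fun f => ?_
    rw [← sub_eq_zero]
    simp only [X, mul_sub, Finset.sum_sub_distrib]
    rw [← hinv.bijective.sum_comp fun v => psiStar ℓ ψ v *
      sumForm α αinf 1 (act (diagCover r hr * lowerUnip (N * (v.val / r)))⁻¹ f), Finset.mul_sum]
    have : ∀ u : ZMod r, κ * psiStar ℓ ψ (-(N : ZMod r)) * (psiStar ℓ ψ (-((N : ZMod r) * u)⁻¹) *
        sumForm α αinf 1 (act (B u)⁻¹ f)) = ψ u * (κ * ((quadraticChar (ZMod r) u : ℤ) : ℂ) ^ ℓ *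
          sumForm α αinf 1 (act (B u)⁻¹ f)) := by
      intro u
      by_cases hu : u = 0
      · simp [hu, MulChar.map_zero]
      · linear_combination κ * sumForm α αinf 1 (act (B u)⁻¹ f) *
          psiStar_mul_psiStar ℓ ψ hrN hu
    rw [Finset.sum_congr rfl fun u _ => this u]
  simp only [key]
  rw [forall_comm]
  simp only [forall_sum_dirichletCharacter_eq_zero_iff]
  constructor
  · intro hX u hu f
    have := sub_eq_zero.1 (hX (act (B u) f) u hu)
    rwa [act_inv_act, ← act_mul] at this
  · intro hX f u hu
    have := hX u hu (act (B u)⁻¹ f)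
    rw [bruhatCover, act_mul, act_act_inv] at this
    exact sub_eq_zero.2 this

end Summation

/-! ### Integral lifts -/

/-- `G` is the lift of the integral matrix `(a b; c d)` occurring in `Gamma0Cover`. -/
structure IsThetaLift (ℓ : ℤ) (G : Cover) (a b c d : ℤ) : Prop where
  det : a * d - b * c = 1
  mat_zero_zero : G.mat 0 0 = a
  mat_zero_one : G.mat 0 1 = b
  mat_one_zero : G.mat 1 0 = c
  mat_one_one : G.mat 1 1 = d
  root_eq : if Even ℓ then G.root = 1 ∨ G.root = -1
    else G.root = (epsilon d)⁻¹ * (quadSymbol c d : ℂ)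

theorem mem_gamma0Cover_iff {N : ℕ} {ℓ : ℤ} {G : Cover} :
    G ∈ Gamma0Cover N ℓ ↔ ∃ a b m d : ℤ, IsThetaLift ℓ G a b (N * m) d := by
  constructor
  · rintro ⟨γ, hγ, hmat, hroot⟩
    rw [CongruenceSubgroup.Gamma0_mem, ZMod.intCast_zmod_eq_zero_iff_dvd] at hγ
    obtain ⟨m, hm⟩ := hγ
    refine ⟨γ 0 0, γ 0 1, m, γ 1 1, ?_, ?_, ?_, ?_, ?_, ?_⟩
    · have := γ.2
      rw [Matrix.det_fin_two] at this
      rw [← hm]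
      exact this
    · rw [hmat]; rfl
    · rw [hmat]; rfl
    · rw [hmat, ← hm]; rfl
    · rw [hmat]; rfl
    · rw [← hmat] at hroot
      rw [← hm]
      split_ifs at hroot ⊢
      · rcases hroot with h | h
        · exact Or.inl (Cover.root_eq_of_fn_eq (z := UpperHalfPlane.I) (by rw [h, one_mul]))
        · exact Or.inr (Cover.root_eq_of_fn_eq (z := UpperHalfPlane.I) (by rw [h, neg_one_mul]))
      · exact Cover.root_eq_of_fn_eq (hroot UpperHalfPlane.I)
  · rintro ⟨a, b, m, d, h⟩
    have hmat : G.mat = toReal ⟨!![a, b; N * m, d], by rw [Matrix.det_fin_two]; exact h.det⟩ :=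
      Cover.mat_ext h.mat_zero_zero h.mat_zero_one h.mat_one_zero h.mat_one_one
    refine ⟨⟨!![a, b; N * m, d], by rw [Matrix.det_fin_two]; exact h.det⟩, ?_, hmat, ?_⟩
    · refine CongruenceSubgroup.Gamma0_mem.2 ?_
      change ((N * m : ℤ) : ZMod N) = 0
      simp
    · rw [← hmat]
      have hr := h.root_eq
      split_ifs at hr ⊢
      · rcases hr with h1 | h1
        · exact Or.inl fun z => by rw [G.fn_eq, h1, one_mul]
        · exact Or.inr fun z => by rw [G.fn_eq, h1, neg_one_mul]
      · intro z
        rw [G.fn_eq, hr]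
        rfl

theorem exists_isThetaLift (ℓ : ℤ) {a b c d : ℤ} (h : a * d - b * c = 1) :
    ∃ G, IsThetaLift ℓ G a b c d := by
  have hcop : c.gcd d.natAbs = 1 := by
    rw [Int.gcd, Int.natAbs_natCast]
    exact Int.isCoprime_iff_gcd_eq_one.1 ⟨-b, a, by linarith⟩
  have hq : (quadSymbol c d : ℂ) ^ 4 = 1 := by
    have h1 : jacobiSym c d.natAbs ^ 2 = 1 := jacobiSym.sq_one hcop
    have : quadSymbol c d ^ 4 = 1 := by
      rw [quadSymbol, mul_pow, show jacobiSym c d.natAbs ^ 4 = (jacobiSym c d.natAbs ^ 2) ^ 2 by ring,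
        h1]
      split_ifs <;> norm_num
    exact_mod_cast this
  let g : SL(2, ℝ) := toReal ⟨!![a, b; c, d], by rw [Matrix.det_fin_two]; exact h⟩
  by_cases he : Even ℓ
  · refine ⟨Cover.lift g 1 (one_pow 4), h, rfl, rfl, rfl, rfl, ?_⟩
    rw [if_pos he, Cover.root_lift]
    exact Or.inl rfl
  · refine ⟨Cover.lift g ((epsilon d)⁻¹ * (quadSymbol c d : ℂ)) ?_, h, rfl, rfl, rfl, rfl, ?_⟩
    · rw [mul_pow, inv_pow, epsilon_pow_four, hq]
      norm_num
    · rw [if_neg he, Cover.root_lift]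

namespace IsThetaLift

variable {ℓ : ℤ} {G : Cover} {a b c d : ℤ}

/-- The multiplier is unchanged under `d ↦ d + ck`: `ε_d` because `4 ∣ c`, and the symbol by
`quadSymbol_eq_of_add_mul`. -/
theorem mul_upperUnip (hG : IsThetaLift ℓ G a b c d) (hc : c ≠ 0) (h4 : Odd ℓ → 4 ∣ c) {k : ℤ}
    {r : ℕ} (hr : d + c * k = r) : IsThetaLift ℓ (G * upperUnip k) a (a * k + b) c r := by
  have hroot : (G * upperUnip k).root = G.root := by
    have hcr : (c : ℝ) ≠ 0 := by exact_mod_cast hc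
    -- At this point the denominator `-cx + a` equals `1`.
    rw [Cover.root_mul_of_pos G _ ((a - 1) / c)]
    · simp
    · rw [hG.mat_one_zero, hG.mat_zero_zero]
      field_simp
      norm_num
    · simp
  refine ⟨?_, ?_, ?_, ?_, ?_, ?_⟩
  · rw [← hr]
    linear_combination hG.det
  · simp [Cover.mul_entry, -Matrix.SpecialLinearGroup.coe_mul, hG.mat_zero_zero]
  · simp [Cover.mul_entry, -Matrix.SpecialLinearGroup.coe_mul, hG.mat_zero_zero, hG.mat_zero_one]
  · simp [Cover.mul_entry, -Matrix.SpecialLinearGroup.coe_mul, hG.mat_one_zero]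
  · simp only [Cover.mul_mat, Cover.mul_entry, hG.mat_one_zero, hG.mat_one_one,
      upperUnip_mat_zero_one, upperUnip_mat_one_one]
    rw [← hr]
    push_cast
    ring
  · rw [hroot]
    have h := hG.root_eq
    split_ifs at h ⊢ with he
    · exact h
    · obtain ⟨c', rfl⟩ := h4 (Int.not_even_iff_odd.1 he)
      have hd : Odd d := by
        by_contra hd
        obtain ⟨e, rfl⟩ := Int.not_odd_iff_even.1 hd
        have := hG.det
        have h2 : 2 * (a * e - 2 * b * c') = 1 := by linear_combination this
        omega
      have hrpos : quadSymbol (4 * c') r = jacobiSym (4 * c') r := by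
        rw [quadSymbol, if_neg (by omega), one_mul, Int.natAbs_natCast]
      rw [h, hrpos, quadSymbol_eq_of_add_mul hc ⟨c', rfl⟩ hd hr,
        epsilon_eq_of_emod_eq (d := d) (e := r)]
      rw [← hr, mul_assoc]
      omega

/-- At `x = -b`, which `g⁻¹` sends to `0`, the phase of `G` is `i` times its root, as `c = 0`. The
product has lower left entry `-y < 0`, so there the phase is `-i` times the root; comparison gives
the sign. -/
theorem root_mul_lowerUnip (hG : IsThetaLift ℓ G a b 0 (-1)) {y : ℝ} (hy : 0 < y) :
    (G * lowerUnip y).root = -G.root := by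
  have ha : a = -1 := by have := hG.det; linarith
  have e00 : G.mat 0 0 = -1 := by rw [hG.mat_zero_zero, ha]; norm_num
  have e10 : G.mat 1 0 = 0 := by rw [hG.mat_one_zero]; norm_num
  have e11 : G.mat 1 1 = -1 := by rw [hG.mat_one_one]; norm_num
  have h := Cover.phase_mul G (lowerUnip y) (x := -b) (by simp [e00, e10])
    (by simp [e00, e10, e11, hG.mat_zero_one])
  simp only [e00, e10, e11, hG.mat_zero_one] at h
  norm_num at h
  have h1 : G.phase (-b) = I * G.root := by
    rw [Cover.phase, if_neg (by simp [e00, e10]), if_pos e10.ge]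
  have h2 : (lowerUnip y).phase 0 = 1 := by
    rw [Cover.phase_of_pos _ (by simp)]; simp
  have h3 : (G * lowerUnip y).phase (-b) = -I * (G * lowerUnip y).root := by
    rw [Cover.phase, if_neg, if_neg]
    · simp [Cover.mul_entry, -Matrix.SpecialLinearGroup.coe_mul, e10, e11, hy]
    · simp [Cover.mul_entry, -Matrix.SpecialLinearGroup.coe_mul, e10, e11, e00, hG.mat_zero_one]
      linarith
  rw [h1, h2, h3] at h
  have := mul_left_cancel₀ I_ne_zero (show I * (G * lowerUnip y).root = I * -G.root by
    linear_combination -h)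
  exact this

theorem mul_lowerUnip (hG : IsThetaLift ℓ G a b 0 (-1)) {N : ℕ} (hN : 0 < N) :
    IsThetaLift ℓ (G * lowerUnip N) (a + b * N) b (N * (-1)) (-1) := by
  have hN' : (0 : ℝ) < N := by exact_mod_cast hN
  refine ⟨?_, ?_, ?_, ?_, ?_, ?_⟩
  · linear_combination hG.det
  · simp [Cover.mul_entry, -Matrix.SpecialLinearGroup.coe_mul, hG.mat_zero_zero, hG.mat_zero_one]
  · simp [Cover.mul_entry, -Matrix.SpecialLinearGroup.coe_mul, hG.mat_zero_one]
  · simp [Cover.mul_entry, -Matrix.SpecialLinearGroup.coe_mul, hG.mat_one_zero, hG.mat_one_one]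
  · simp [Cover.mul_entry, -Matrix.SpecialLinearGroup.coe_mul, hG.mat_one_one]
  · rw [hG.root_mul_lowerUnip hN']
    have h := hG.root_eq
    split_ifs at h ⊢ with he
    · rcases h with h | h
      · exact Or.inr (by rw [h])
      · exact Or.inl (by rw [h, neg_neg])
    · rw [h]
      have h1 : quadSymbol (N * -1) (-1) = -1 := by
        rw [quadSymbol, if_pos (by constructor <;> omega)]
        simp
      have h2 : quadSymbol 0 (-1) = 1 := by
        simp [quadSymbol]
      rw [h1, h2]
      simp

/-- Modulo `r` the determinant gives `bc ≡ -1`, hence `(c/r) = (-1/r)(b/r)`. As `ε_r² = (-1/r)`, the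
root `ε_r⁻¹ (c/r)` equals `ε_r (b/r)`. For even `ℓ` both sides are `1`. -/
theorem root_zpow (hG : IsThetaLift ℓ G a b c d) {r : ℕ} [Fact r.Prime] (hr : Odd r)
    (hd : d = r) : G.root ^ ℓ = constC ℓ r * ((quadraticChar (ZMod r) b : ℤ) : ℂ) ^ ℓ := by
  subst hd
  have hdet : (b : ZMod r) * c = -1 := by
    have := congrArg (Int.cast : ℤ → ZMod r) hG.det
    push_cast at this
    rw [ZMod.natCast_self, mul_zero, zero_sub] at this
    linear_combination -this
  have hb : (b : ZMod r) ≠ 0 := by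
    intro h0
    rw [h0, zero_mul] at hdet
    exact one_ne_zero (neg_eq_zero.1 hdet.symm)
  have h := hG.root_eq
  rw [constC]
  split_ifs at h ⊢ with he
  · rw [one_mul]
    have e1 : G.root ^ ℓ = 1 := by
      rcases h with h | h <;> rw [h]
      · simp
      · exact he.neg_one_zpow
    rw [e1]
    rcases quadraticChar_dichotomy hb with h3 | h3 <;> rw [h3]
    · simp
    · push_cast
      exact he.neg_one_zpow.symm
  · rw [h, ← mul_zpow]
    congr 1
    have hJ : quadSymbol c r = jacobiSym c r := by
      rw [quadSymbol, if_neg (by omega), one_mul, Int.natAbs_natCast]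
    have hB : quadraticChar (ZMod r) b = jacobiSym b r := by
      rw [← jacobiSym.legendreSym.to_jacobiSym]; rfl
    have hprod : jacobiSym c r * jacobiSym b r = jacobiSym (-1) r := by
      rw [← jacobiSym.mul_left]
      refine jacobiSym.mod_left' ?_
      refine (ZMod.intCast_eq_intCast_iff _ _ r).1 ?_
      push_cast
      rw [mul_comm, hdet]
    have hsq : jacobiSym b r * jacobiSym b r = 1 := by
      rw [← hB]
      rcases quadraticChar_dichotomy hb with h3 | h3 <;> rw [h3] <;> norm_num
    have hJB : jacobiSym c r = jacobiSym (-1) r * jacobiSym b r := by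
      rw [← hprod, mul_assoc, hsq, mul_one]
    have hε := epsilon_sq hr
    have hε0 := epsilon_ne_zero r
    rw [hJ, hB, hJB]
    push_cast
    rw [← hε]
    field_simp

end IsThetaLift

open LineModel

/-! ### Reduction of `Γ̃₀(N)` to elements with prime lower right entry. -/

section Main

variable {lam : ℂ} {ℓ : ℤ} {N : ℕ}

/-- Evaluating at `π(γ) f` replaces `γ⁻¹` by `γ` and `χ(d)` by its inverse, which is its conjugate
since `d` is a unit mod `N`. -/
theorem isAutomorphic_gamma0Cover_iff (χ : DirichletCharacter ℂ N) (T : Distrib lam ℓ) :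
    IsAutomorphic (Gamma0Cover N ℓ) (inducedChar χ) T ↔
      ∀ (G : Cover) (a b m d : ℤ), IsThetaLift ℓ G a b (N * m) d →
        ∀ f, T (act G f) = starRingEnd ℂ (χ (d : ZMod N)) * T f := by
  have hunit : ∀ {G : Cover} {a b m d : ℤ}, IsThetaLift ℓ G a b (N * m) d →
      χ (d : ZMod N) * starRingEnd ℂ (χ (d : ZMod N)) = 1 := by
    intro G a b m d hG
    have hu : IsUnit (d : ZMod N) := by
      refine IsUnit.of_mul_eq_one (a : ZMod N) ?_
      have := congrArg (Int.cast : ℤ → ZMod N) hG.det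
      push_cast at this
      rw [ZMod.natCast_self, zero_mul, mul_zero, sub_zero] at this
      rw [mul_comm, this]
    obtain ⟨u, hu⟩ := hu
    rw [← hu, mul_conj, normSq_eq_norm_sq, DirichletCharacter.unit_norm_eq_one]
    simp
  have hfl : ∀ {G : Cover} {a b m d : ℤ}, IsThetaLift ℓ G a b (N * m) d →
      inducedChar χ G = χ (d : ZMod N) := by
    intro G a b m d hG
    rw [inducedChar, hG.mat_one_one, Int.floor_intCast]
  constructor
  · intro h G a b m d hG f
    have h1 := h G (mem_gamma0Cover_iff.2 ⟨a, b, m, d, hG⟩) (act G f)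
    rw [dualAct, act_inv_act, hfl hG] at h1
    rw [h1, ← mul_assoc, mul_comm (starRingEnd ℂ _), hunit hG, one_mul]
  · intro h G hG f
    obtain ⟨a, b, m, d, hG⟩ := mem_gamma0Cover_iff.1 hG
    have h1 := h G a b m d hG (act G⁻¹ f)
    rw [act_act_inv] at h1
    rw [dualAct, hfl hG, h1, ← mul_assoc, hunit hG, one_mul]

/-- Integral translations and lower unipotents by multiples of `N` fix `T`, so `b` and `m` matter
only mod `r`. -/
theorem bruhatCover_relation_iff {T : LineModel lam ℓ → ℂ} (hU : ∀ k : ℤ, FixedBy T (upperUnip k))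
    (hL : ∀ k : ℤ, FixedBy T (lowerUnip (N * k))) {r : ℕ} (hr : (0 : ℝ) < r) [Fact r.Prime]
    (b m : ℤ) (κ : ℂ) :
    (∀ f, T (act (bruhatCover r hr (b / r) (N * (m / r))) f) = κ * T f) ↔
      ∀ f, T (act (bruhatCover r hr ((b : ZMod r).val / r) (N * ((m : ZMod r).val / r))) f) =
        κ * T f := by
  have hr0 : NeZero r := ⟨(Fact.out : r.Prime).ne_zero⟩
  have e : ∀ k : ℤ, ∃ s : ℤ, (k / r : ℝ) = s + (k : ZMod r).val / r := by
    intro k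
    refine ⟨k / r, ?_⟩
    have h1 : ((k : ZMod r).val : ℤ) = k % r := ZMod.val_intCast k
    have h2 : (k : ℝ) = (k % r : ℤ) + r * ((k / r : ℤ) : ℝ) := by
      exact_mod_cast (Int.emod_add_mul_ediv k r).symm
    rw [h2, ← h1]
    field_simp
    push_cast
    ring
  obtain ⟨s, hs⟩ := e b
  obtain ⟨t, ht⟩ := e m
  rw [hs, ht, show (N : ℝ) * (t + (m : ZMod r).val / r) = N * ((m : ZMod r).val / r) + N * t by ring,
    bruhatCover_add]
  exact (hU s).apply_mul_mul (hL t)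

/-- The two elements have the same matrix and differ by the root of `G`, whose `ℓ`-th power is given
by `root_zpow`. -/
theorem IsThetaLift.relation_iff_bruhatCover {G : Cover} {a b m : ℤ} {r : ℕ} [Fact r.Prime]
    (hG : IsThetaLift ℓ G a b (N * m) r) (hr : Odd r) (hr0 : (0 : ℝ) < r) (T : Distrib lam ℓ)
    (κ : ℂ) : (∀ f, T (act G f) = κ * T f) ↔
      ∀ f, T (act (bruhatCover r hr0 (b / r) (N * (m / r))) f) =
        κ * constC ℓ r * ((quadraticChar (ZMod r) b : ℤ) : ℂ) ^ ℓ * T f := by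
  have hroot := hG.root_zpow hr rfl
  have hne : G.root ^ ℓ ≠ 0 := zpow_ne_zero _ G.root_ne_zero
  have hmat := mat_eq_bruhatCover G r hr0 (by rw [hG.mat_one_one]; norm_cast)
  rw [hG.mat_zero_one, hG.mat_one_zero, show (((N : ℤ) * m : ℤ) : ℝ) / r = N * (m / r) by
    push_cast; ring] at hmat
  refine forall_congr' fun f => ?_
  rw [act_eq_of_mat_eq hmat, bruhatCover_root, inv_one, mul_one, map_smul, smul_eq_mul, zpow_neg,
    inv_mul_eq_iff_eq_mul₀ hne, hroot]
  constructor <;> intro h <;> linear_combination h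

/-- Left to right, `Nmb ≡ -1` mod `r` makes `(1 + Nmb)/r` the missing integral entry. Conversely, an
element with `c ≠ 0` is moved by a translation to one whose lower right entry is a prime of `P`, and
the case `c = 0` is a translation or is reduced to `c ≠ 0`. -/
theorem automorphic_iff_bruhatCover (hN : 0 < N) (hN4 : Odd ℓ → 4 ∣ N) (χ : DirichletCharacter ℂ N)
    {P : Set ℕ} (hP : IsAdmissible N P) (T : Distrib lam ℓ)
    (hU : ∀ k : ℤ, FixedBy T (upperUnip k)) (hL : ∀ k : ℤ, FixedBy T (lowerUnip (N * k))) :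
    IsAutomorphic (Gamma0Cover N ℓ) (inducedChar χ) T ↔
      ∀ (r : ℕ) [Fact r.Prime] (hr : (0 : ℝ) < r), r ∈ P → ∀ b m : ℤ,
        (N : ZMod r) * m * b = -1 → ∀ f, T (act (bruhatCover r hr (b / r) (N * (m / r))) f) =
          starRingEnd ℂ (χ (r : ZMod N)) * constC ℓ r *
            ((quadraticChar (ZMod r) b : ℤ) : ℂ) ^ ℓ * T f := by
  rw [isAutomorphic_gamma0Cover_iff]
  constructor
  · intro h r _ hr hrP b m hbm
    have hdvd : (r : ℤ) ∣ 1 + b * (N * m) := by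
      rw [← ZMod.intCast_zmod_eq_zero_iff_dvd]
      push_cast
      linear_combination hbm
    obtain ⟨a, ha⟩ := hdvd
    obtain ⟨G, hG⟩ := exists_isThetaLift ℓ (a := a) (b := b) (c := N * m) (d := r)
      (by linear_combination -ha)
    refine (hG.relation_iff_bruhatCover (hP.1 r hrP).2.1 hr T _).1 ?_
    simpa using h G a b m r hG
  · intro h
    have main : ∀ (G : Cover) (a b m d : ℤ), m ≠ 0 → IsThetaLift ℓ G a b (N * m) d →
        ∀ f, T (act G f) = starRingEnd ℂ (χ (d : ZMod N)) * T f := by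
      intro G a b m d hm hG
      have hc : (N : ℤ) * m ≠ 0 := mul_ne_zero (by exact_mod_cast hN.ne') hm
      set c : ℤ := N * m with hcdef
      have habs : (0 : ℤ) < |c| := abs_pos.2 hc
      have hb0 : 0 ≤ d % |c| := Int.emod_nonneg _ habs.ne'
      -- A representative of `d` mod `|c|` that is strictly positive, as admissibility requires; the
      -- bare remainder could be `0` when `|c| = 1`.
      obtain ⟨e, he⟩ : ∃ e : ℕ, (e : ℤ) = d % |c| + |c| :=
        ⟨(d % |c| + |c|).toNat, Int.toNat_of_nonneg (by omega)⟩
      have hcn : ((c.natAbs : ℕ) : ℤ) = |c| := Int.natCast_natAbs c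
      have hed : (e : ℤ) = d + |c| * (1 - d / |c|) := by
        rw [he]
        linear_combination Int.emod_add_mul_ediv d |c|
      have hdvdc : ∀ x : ℤ, ∃ y : ℤ, |c| * x = c * y := by
        intro x
        obtain ⟨z, hz⟩ := (dvd_abs c c).2 dvd_rfl
        exact ⟨z * x, by rw [hz]; ring⟩
      have hcop : Nat.Coprime c.natAbs e := by
        rw [← Nat.isCoprime_iff_coprime, hcn]
        obtain ⟨y, hy⟩ := hdvdc (1 - d / |c|)
        rw [hed, hy]
        have h1 : IsCoprime c (d + c * y) := ⟨-b - a * y, a, by linear_combination hG.det⟩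
        rcases abs_choice c with h2 | h2 <;> rw [h2]
        · exact h1
        · exact h1.neg_left
      obtain ⟨n, _, hnP⟩ := hP.2 c.natAbs e (by omega) (by omega) hcop
      set r := c.natAbs * n + e with hrdef
      have : Fact r.Prime := ⟨(hP.1 r hnP).1⟩
      have hr0 : (0 : ℝ) < r := by exact_mod_cast (hP.1 r hnP).1.pos
      obtain ⟨k, hk⟩ := hdvdc (n + (1 - d / |c|))
      have hr : d + c * k = r := by
        rw [← hk, hrdef]
        push_cast
        rw [hed]
        ring
      have h4 : Odd ℓ → 4 ∣ c := fun ho => by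
        have : (4 : ℤ) ∣ N := by exact_mod_cast hN4 ho
        exact this.mul_right m
      have hG' := hG.mul_upperUnip hc h4 hr
      have hdet := congrArg (Int.cast : ℤ → ZMod r) hG'.det
      have hrel := h r hr0 hnP (a * k + b) m (by
        push_cast [hcdef] at hdet ⊢
        rw [ZMod.natCast_self, mul_zero] at hdet
        linear_combination -hdet)
      have hχ : χ (d : ZMod N) = χ (r : ZMod N) := by
        congr 1
        have := congrArg (Int.cast : ℤ → ZMod N) hr
        push_cast [hcdef] at this
        rw [ZMod.natCast_self, zero_mul, zero_mul, add_zero] at this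
        exact this
      rw [hχ]
      have := (hG'.relation_iff_bruhatCover (hP.1 r hnP).2.1 hr0 T _).2 hrel
      refine ((fixedBy_one T).apply_mul_mul (hU k)).1 ?_
      rwa [one_mul]
    intro G a b m d hG
    rcases eq_or_ne m 0 with rfl | hm
    · rw [mul_zero] at hG
      have had : a * d = 1 := by linear_combination hG.det
      rcases Int.eq_one_or_neg_one_of_mul_eq_one' had with ⟨rfl, rfl⟩ | ⟨rfl, rfl⟩
      · intro f
        have hmat : G.mat = (upperUnip b).mat := by
          refine Cover.mat_ext ?_ ?_ ?_ ?_
          · simp [hG.mat_zero_zero]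
          · simp [hG.mat_zero_one]
          · simp [hG.mat_one_zero]
          · simp [hG.mat_one_one]
        have hroot : G.root ^ (-ℓ) = 1 := by
          have h1 := hG.root_eq
          split_ifs at h1 with he
          · rcases h1 with h1 | h1 <;> rw [h1]
            · simp
            · exact he.neg.neg_one_zpow
          · rw [h1]
            simp [epsilon, quadSymbol]
        rw [act_eq_of_mat_eq hmat, upperUnip_root, inv_one, mul_one, hroot, one_smul, hU]
        simp
      -- Here `c = 0` and `d = -1`. Right multiplication by the lower unipotent, which fixes `T`,
      -- makes the lower left entry `-N ≠ 0` and keeps `d`, so `main` applies.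
      · have hG' := hG.mul_lowerUnip hN
        refine ((fixedBy_one T).apply_mul_mul (hL 1)).1 ?_
        rw [one_mul, Int.cast_one, mul_one]
        exact main _ _ _ _ _ (by norm_num) hG'
    · exact main G a b m d hm hG

theorem forall_bruhatCover_relation_iff {T : LineModel lam ℓ → ℂ}
    (hU : ∀ k : ℤ, FixedBy T (upperUnip k)) (hL : ∀ k : ℤ, FixedBy T (lowerUnip (N * k))) {r : ℕ}
    [Fact r.Prime] (hr : (0 : ℝ) < r) (hrN : (N : ZMod r) ≠ 0) (κ : ℂ) :
    (∀ u : ZMod r, u ≠ 0 → ∀ f, T (act (bruhatCover r hr (u.val / r)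
        (N * ((-((N : ZMod r) * u)⁻¹).val / r))) f) =
          κ * ((quadraticChar (ZMod r) u : ℤ) : ℂ) ^ ℓ * T f) ↔
      ∀ b m : ℤ, (N : ZMod r) * m * b = -1 →
        ∀ f, T (act (bruhatCover r hr (b / r) (N * (m / r))) f) =
          κ * ((quadraticChar (ZMod r) b : ℤ) : ℂ) ^ ℓ * T f := by
  have hr0 : NeZero r := ⟨(Fact.out : r.Prime).ne_zero⟩
  constructor
  · intro h b m hbm
    have hb : (b : ZMod r) ≠ 0 := by
      intro h0
      rw [h0, mul_zero] at hbm
      exact one_ne_zero (neg_eq_zero.1 hbm.symm)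
    rw [bruhatCover_relation_iff hU hL]
    have e : (m : ZMod r) = -((N : ZMod r) * b)⁻¹ := by
      field_simp
      linear_combination hbm
    rw [e]
    exact h b hb
  · intro h u hu
    have := h u.val (-((N : ZMod r) * u)⁻¹).val (by
      rw [Int.cast_natCast, Int.cast_natCast, ZMod.natCast_zmod_val, ZMod.natCast_zmod_val]
      field_simp)
    simpa using this

end Main

end FerrarSuzuki

end

theorem mainTheorem6 (lam : ℂ) (hlam : ∀ k : ℕ, lam ≠ 1 / 2 - (k : ℂ) / 2) (ℓ : ℤ) (N : ℕ)
    (hN : 0 < N) (hN4 : Odd ℓ → 4 ∣ N) (χ : DirichletCharacter ℂ N)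
    (hχ : χ (-1) = if Even ℓ then Complex.I ^ ℓ else 1)
    (P : Set ℕ) (hP : FerrarSuzuki.IsAdmissible N P)
    (α β : ℤ → ℂ) (αinf βinf : ℂ)
    (hα : FerrarSuzuki.PolyGrowth α) (hβ : FerrarSuzuki.PolyGrowth β)
    (hsum : FerrarSuzuki.SummationFormula lam ℓ N α αinf β βinf) :
    ∃ T : FerrarSuzuki.Distrib lam ℓ,
      (∀ f : FerrarSuzuki.LineModel lam ℓ,
        T f = αinf * f.atInfty + ∑' n : ℤ, α n * f.fourier n) ∧
      FerrarSuzuki.IsAutomorphic (FerrarSuzuki.DeltaCover N : Set FerrarSuzuki.Cover)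
        (fun _ => 1) T ∧
      (FerrarSuzuki.IsAutomorphic (FerrarSuzuki.Gamma0Cover N ℓ) (FerrarSuzuki.inducedChar χ) T ↔
        ∀ (r : ℕ) [Fact r.Prime], r ∈ P → ∀ ψ : DirichletCharacter ℂ r,
          FerrarSuzuki.TwistedSummationFormula lam ℓ χ α αinf β βinf r ψ) := by
  -- The excluded values of `λ` are exactly those at which a factor `2λ - 1 + k` of the recursion
  -- for the regularized integral vanishes.
  have h : ∀ k : ℕ, 2 * lam - 1 + k ≠ 0 := fun k hk =>
    hlam k (by linear_combination hk / 2)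
  have hU := FerrarSuzuki.fixedBy_upperUnip (ℓ := ℓ) (α := α) (αinf := αinf) h
  have hL := FerrarSuzuki.fixedBy_lowerUnip h hN hsum
  refine ⟨FerrarSuzuki.LineModel.sumDistrib h hα αinf one_pos, fun f => ?_,
    FerrarSuzuki.isAutomorphic_deltaCover h hN hα hsum, ?_⟩
  · simp [FerrarSuzuki.LineModel.sumDistrib_apply, FerrarSuzuki.LineModel.sumForm]
  · rw [FerrarSuzuki.automorphic_iff_bruhatCover hN hN4 χ hP _ hU hL]
    refine forall_congr' fun r => forall_congr' fun hr => ?_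
    have hr0 : (0 : ℝ) < r := by exact_mod_cast hr.out.pos
    have key : r ∈ P → ((N : ZMod r) ≠ 0) := fun hrP h0 =>
      (hP.1 r hrP).2.2 ((ZMod.natCast_eq_zero_iff N r).1 h0)
    constructor
    · intro H hrP
      rw [FerrarSuzuki.forall_twistedSummationFormula_iff h hN hα hβ hsum χ r hr0 (key hrP)]
      exact (FerrarSuzuki.forall_bruhatCover_relation_iff hU hL hr0 (key hrP) _).2 (H hr0 hrP)
    · intro H hr1 hrP
      have := H hrP
      rw [FerrarSuzuki.forall_twistedSummationFormula_iff h hN hα hβ hsum χ r hr0 (key hrP)] at this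
      exact (FerrarSuzuki.forall_bruhatCover_relation_iff hU hL hr0 (key hrP) _).1 this
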